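/- A \emph{comparator circuit} on variables $x_1,\dots,x_n$ with $\ell$ wires consists of $\ell$ wires, each labelled by a literal $x_i$ or $\neg x_i$, a finite sequence of gates, which are ordered pairs $(w,w')$ of wires, and an output wire. On an input, each wire starts with the value of its label; each gate $(w,w')$ in turn replaces the values $u,v$ of $w,w'$ by $u\wedge v$ on $w$ and $u\vee v$ on $w'$; the result is the final value of the output wire. Let $\mathcal C_{n,\varepsilon}$ be the class of all functions $\{0,1\}^n\to\{0,1\}$ computed by comparator circuits with at most $n^{1.5-\varepsilon}$ wires (and any number of gates). Algorithms are programs of a random access machine with logarithmic cost and random bits; $n$ (and the parameters $k,a$ below) are inputs. A hypothesis is given by the current memory together with a fixed oracle-free evaluation program of the learner, and an equivalence query is charged the worst-case time to evaluate its hypothesis at a point. Membership queries return $f(x)$; equivalence queries return a counterexample, chosen arbitrarily and possibly depending on the earlier queries, unless the hypothesis is equal to $f$. There is an absolute constant $c>0$ such that for every $\varepsilon>0$ the following hold. (1) There is a randomized exact learning algorithm with membership and equivalence queries for the classes $\mathcal C_{n,\varepsilon}$ that runs in time $2^{\,n-n^{c\varepsilon}}\cdot\mathrm{poly}(n,k)$: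 for all $n,k$, every target $f\in\mathcal C_{n,\varepsilon}$ and every equivalence oracle it always halts within this time, and with probability at least $1-2^{-k}$ over its random bits it ends with a hypothesis that is equal to $f$ and can be evaluated at every point within this time. (2) There is a distribution-independent PAC learning algorithm with membership queries for the classes $\mathcal C_{n,\varepsilon}$ that runs in time $2^{\,n-n^{c\varepsilon}}\cdot\mathrm{poly}(n,k,a)$: for all $n,k$ and $a\ge1$, every target $f\in\mathcal C_{n,\varepsilon}$ and every probability distribution $\mathcal D$ on $\{0,1\}^n$, given access to independent examples $(x,f(x))$ with $x\sim\mathcal D$, it always halts within this time, and with probability at least $1-2^{-k}$ over its random bits and the examples it ends with a hypothesis $h$ that can be evaluated at every point within this time and satisfies $\Pr_{x\sim\mathcal D}[h(x)\ne f(x)]\le 1/a$. The polynomials may depend on $\varepsilon$. -/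

import Mathlib

open MeasureTheory

/-! ### Boolean functions and comparator circuits -/

/-- Points of the Boolean cube `{0,1}^n`. -/
abbrev Cube (n : ℕ) : Type := Fin n → Bool

/-- Boolean functions of `n` variables. -/
abbrev BoolFn (n : ℕ) : Type := Cube n → Bool

/-- A comparator circuit on `n` variables with `ℓ` wires: every wire is labelled by a literal
(`(i, true)` is the variable `x_i`, `(i, false)` its negation), the gates are a sequence of
ordered pairs of wires, and one wire is the output wire. -/
structure ComparatorCircuit (n ℓ : ℕ) where
  label : Fin ℓ → Fin n × Bool
  gates : List (Fin ℓ × Fin ℓ)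
  output : Fin ℓ

/-- The gate `(w, w')` puts the conjunction of the two values on `w` and their disjunction
on `w'`. -/
def applyComparator {ℓ : ℕ} (v : Fin ℓ → Bool) (g : Fin ℓ × Fin ℓ) : Fin ℓ → Bool :=
  fun w => if w = g.1 then v g.1 && v g.2 else if w = g.2 then v g.1 || v g.2 else v w

/-- The Boolean function computed by a comparator circuit. -/
def ComparatorCircuit.eval {n ℓ : ℕ} (C : ComparatorCircuit n ℓ) : BoolFn n := fun x =>
  C.gates.foldl applyComparator
    (fun w => if (C.label w).2 then x (C.label w).1 else !x (C.label w).1) C.output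

/-- The `n`-variate functions computed by comparator circuits with at most `r` wires. -/
def comparatorClass (n : ℕ) (r : ℝ) : Set (BoolFn n) :=
  {f | ∃ ℓ : ℕ, (ℓ : ℝ) ≤ r ∧ ∃ C : ComparatorCircuit n ℓ, C.eval = f}

/-! ### Random access machines with logarithmic cost

Programs are structured (sequencing, branching, loops) and act on a random access memory.
Every arithmetic operation and every memory access is charged the bit length of the
number that it produces. -/

/-- The memory of the machine: cell `i` holds the natural number `m i`. -/
abbrev Memory : Type := ℕ → ℕ

/-- The memory with the numbers of a list in its first cells, and `0` everywhere else. -/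
def Memory.ofList (l : List ℕ) : Memory := fun i => l.getD i 0

/-- The arithmetic operations (on natural numbers; subtraction is truncated, and a division
by `0` gives `0`). -/
inductive ArithOp
  | add | sub | mul | div | mod

def ArithOp.val : ArithOp → ℕ → ℕ → ℕ
  | .add, a, b => a + b
  | .sub, a, b => a - b
  | .mul, a, b => a * b
  | .div, a, b => a / b
  | .mod, a, b => a % b

/-- Expressions: constants, the content of the cell with a computed address, arithmetic. -/
inductive RamExpr
  | lit (c : ℕ)
  | cell (a : RamExpr)
  | arith (o : ArithOp) (a b : RamExpr)

/-- The value of an expression in a memory. -/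
def RamExpr.val (m : Memory) : RamExpr → ℕ
  | .lit c => c
  | .cell a => m (a.val m)
  | .arith o a b => o.val (a.val m) (b.val m)

/-- The time needed to evaluate an expression: each node is charged one plus the bit length
of its value. -/
def RamExpr.cost (m : Memory) : RamExpr → ℕ
  | .lit c => 1 + c.size
  | .cell a => a.cost m + (1 + (m (a.val m)).size)
  | .arith o a b => a.cost m + b.cost m + (1 + (o.val (a.val m) (b.val m)).size)

/-- Programs, with calls to external operations from `Op` (oracles, random bits).
`assign a e` stores the value of `e` in the cell whose address is the value of `a`;
a condition counts as true when its value is not `0`. -/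
inductive RamProg (Op : Type)
  | skip
  | assign (a e : RamExpr)
  | seq (p q : RamProg Op)
  | cond (e : RamExpr) (p q : RamProg Op)
  | loop (e : RamExpr) (p : RamProg Op)
  | call (o : Op)

/-- `Runs ext p s s' t`: started in `s`, the program `p` halts in `s'` after time exactly `t`.
States consist of the memory and of the state of the environment; `ext o s s' t` says that
the external operation `o` leads from `s` to `s'` and takes time `t`. -/
inductive Runs {Op E : Type} (ext : Op → Memory × E → Memory × E → ℕ → Prop) :
    RamProg Op → Memory × E → Memory × E → ℕ → Prop
  | skip (s : Memory × E) : Runs ext .skip s s 1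
  | assign (a e : RamExpr) (m : Memory) (z : E) :
      Runs ext (.assign a e) (m, z) (Function.update m (a.val m) (e.val m), z)
        (a.cost m + e.cost m + 1)
  | seq {p q : RamProg Op} {s s' s'' : Memory × E} {t t' : ℕ} :
      Runs ext p s s' t → Runs ext q s' s'' t' → Runs ext (.seq p q) s s'' (t + t')
  | cond_true {e : RamExpr} {p q : RamProg Op} {s s' : Memory × E} {t : ℕ} :
      e.val s.1 ≠ 0 → Runs ext p s s' t → Runs ext (.cond e p q) s s' (e.cost s.1 + 1 + t)
  | cond_false {e : RamExpr} {p q : RamProg Op} {s s' : Memory × E} {t : ℕ} :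
      e.val s.1 = 0 → Runs ext q s s' t → Runs ext (.cond e p q) s s' (e.cost s.1 + 1 + t)
  | loop_true {e : RamExpr} {p : RamProg Op} {s s' s'' : Memory × E} {t t' : ℕ} :
      e.val s.1 ≠ 0 → Runs ext p s s' t → Runs ext (.loop e p) s' s'' t' →
      Runs ext (.loop e p) s s'' (e.cost s.1 + 1 + t + t')
  | loop_false {e : RamExpr} {p : RamProg Op} {s : Memory × E} :
      e.val s.1 = 0 → Runs ext (.loop e p) s s (e.cost s.1 + 1)
  | call {o : Op} {s s' : Memory × E} {t : ℕ} : ext o s s' t → Runs ext (.call o) s s' t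

/-! ### Learners, hypotheses and oracles -/

/-- The number whose binary digits are the coordinates of `x`. -/
def cubeCode {n : ℕ} (x : Cube n) : ℕ := ∑ i : Fin n, (x i).toNat * 2 ^ (i : ℕ)

/-- The point of the cube given by the `n` lowest binary digits of `v`. -/
def cubePoint (n v : ℕ) : Cube n := fun i => v.testBit i

/-- A learning algorithm: a main program with external operations from `Op`, and a program
without external operations that evaluates the hypothesis stored in the memory. -/
structure Learner (Op : Type) where
  main : RamProg Op
  hyp : RamProg Empty

/-- The evaluation program `ev` and the memory `m` together represent the hypothesis `h`, with
evaluation times `t`: on every point `x`, if `ev` is started with the code of `x` in cell `0`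
and with `m` in all other cells, then it halts after time `t x`, and cell `0` then holds a
non-zero number if and only if `h x = 1`. -/
def Represents {n : ℕ} (ev : RamProg Empty) (m : Memory) (h : BoolFn n) (t : Cube n → ℕ) : Prop :=
  ∀ x : Cube n, ∃ m' : Memory,
    Runs (E := Unit) (fun o _ _ _ => o.elim) ev
      (Function.update m 0 (cubeCode x), ()) (m', ()) (t x) ∧
    (m' 0 ≠ 0 ↔ h x = true)

/-- The memory `m` holds, with respect to `ev`, a hypothesis satisfying `P` that can be
evaluated at every point in time at most `T`. -/
def HoldsHypothesis {n : ℕ} (ev : RamProg Empty) (m : Memory) (T : ℝ) (P : BoolFn n → Prop) :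
    Prop :=
  ∃ (h : BoolFn n) (t : Cube n → ℕ), Represents ev m h t ∧ (∀ x, (t x : ℝ) ≤ T) ∧ P h

/-- A query of an exact learner: membership or equivalence. -/
inductive Query (n : ℕ)
  | member (x : Cube n)
  | equiv (h : BoolFn n)

/-- An equivalence oracle for `f`. Given the past queries (latest first) and the hypothesis `h`,
it confirms (`none`) when `h = f`, and otherwise returns a point at which `h` and `f` differ. The
choice of the counterexample is arbitrary and may depend on the past queries. -/
structure EquivOracle {n : ℕ} (f : BoolFn n) where
  reply : List (Query n) → BoolFn n → Option (Cube n)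
  reply_none : ∀ past h, reply past h = none ↔ h = f
  reply_some : ∀ past h x, reply past h = some x → h x ≠ f x

/-- What is stored as the reply: `0` for a confirmation, one plus the code of the point for a
counterexample. -/
def replyCode {n : ℕ} : Option (Cube n) → ℕ
  | none => 0
  | some x => 1 + cubeCode x

/-- The external operations of a randomized exact learner. Each stores its result in the cell
whose address is the value of `a`: a random bit; the value of the target at the point coded by
the value of `e`; the reply to an equivalence query on the hypothesis held in the memory. -/
inductive ExactOp
  | coin (a : RamExpr)
  | member (a e : RamExpr)
  | equiv (a : RamExpr)

/-- Environment of an exact learner: the unread random bits and the past queries. -/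
structure ExactEnv (n : ℕ) where
  coins : ℕ → Bool
  past : List (Query n)

/-- The effect and the cost of the operations of an exact learner with evaluation program `ev`,
for the target `f` and the equivalence oracle `O`. An equivalence query is charged the worst-case
evaluation time of the hypothesis. -/
inductive ExactCall {n : ℕ} (ev : RamProg Empty) (f : BoolFn n) (O : EquivOracle f) :
    ExactOp → Memory × ExactEnv n → Memory × ExactEnv n → ℕ → Prop
  | coin (a : RamExpr) (m : Memory) (ω : ℕ → Bool) (past : List (Query n)) :
      ExactCall ev f O (.coin a) (m, ⟨ω, past⟩)
        (Function.update m (a.val m) (ω 0).toNat, ⟨fun i => ω (i + 1), past⟩)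
        (a.cost m + 2)
  | member (a e : RamExpr) (m : Memory) (ω : ℕ → Bool) (past : List (Query n)) :
      ExactCall ev f O (.member a e) (m, ⟨ω, past⟩)
        (Function.update m (a.val m) (f (cubePoint n (e.val m))).toNat,
          ⟨ω, .member (cubePoint n (e.val m)) :: past⟩)
        (a.cost m + e.cost m + n + 2)
  | equiv (a : RamExpr) (m : Memory) (ω : ℕ → Bool) (past : List (Query n))
      (h : BoolFn n) (t : Cube n → ℕ) : Represents ev m h t →
      ExactCall ev f O (.equiv a) (m, ⟨ω, past⟩)
        (Function.update m (a.val m) (replyCode (O.reply past h)), ⟨ω, .equiv h :: past⟩)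
        (a.cost m + Finset.univ.sup t + n + 2)

/-- The law of an infinite sequence of independent fair bits. -/
noncomputable def coinMeasure : Measure (ℕ → Bool) :=
  Measure.infinitePi fun _ => (PMF.uniformOfFintype Bool).toMeasure

/-- With random bits `ω`, the learner, started with `n` and `k` in cells `0` and `1`, halts
within time `T` with final memory `m`. -/
def Learner.ExactHalts (L : Learner ExactOp) {n : ℕ} (f : BoolFn n) (O : EquivOracle f) (k : ℕ)
    (T : ℝ) (ω : ℕ → Bool) (m : Memory) : Prop :=
  ∃ (z : ExactEnv n) (t : ℕ), (t : ℝ) ≤ T ∧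
    Runs (ExactCall L.hyp f O) L.main (Memory.ofList [n, k], ⟨ω, []⟩) (m, z) t

/-- `L` is a randomized exact learning algorithm with membership and equivalence queries for the
classes `𝒞 n`, running in time `T n k`: for every target in the class and every equivalence oracle
it always halts within that time, and with probability at least `1 - 2^(-k)` the hypothesis that
it ends with is equal to the target. -/
def Learner.LearnsExactly (L : Learner ExactOp) (𝒞 : (n : ℕ) → Set (BoolFn n))
    (T : ℕ → ℕ → ℝ) : Prop :=
  ∀ (n k : ℕ), ∀ f ∈ 𝒞 n, ∀ O : EquivOracle f,
    (∀ ω, ∃ m, L.ExactHalts f O k (T n k) ω m) ∧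
    1 - (1 / 2 : ℝ) ^ k ≤ coinMeasure.real
      {ω | ∃ m, L.ExactHalts f O k (T n k) ω m ∧
        HoldsHypothesis L.hyp m (T n k) fun h => h = f}

/-- The external operations of a PAC learner with membership queries: a random bit; the value of
the target at the point coded by the value of `e`; a random example `(x, f x)`, with the code of
`x` stored in the cell addressed by `a` and then `f x` in the cell addressed by `b`. -/
inductive PACOp
  | coin (a : RamExpr)
  | member (a e : RamExpr)
  | sample (a b : RamExpr)

/-- Environment of a PAC learner: the unread random bits and the unread sample points. -/
structure PACEnv (n : ℕ) where
  coins : ℕ → Bool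
  samples : ℕ → Cube n

/-- The effect and the cost of the operations of a PAC learner for the target `f`. -/
inductive PACCall {n : ℕ} (f : BoolFn n) :
    PACOp → Memory × PACEnv n → Memory × PACEnv n → ℕ → Prop
  | coin (a : RamExpr) (m : Memory) (ω : ℕ → Bool) (ξ : ℕ → Cube n) :
      PACCall f (.coin a) (m, ⟨ω, ξ⟩)
        (Function.update m (a.val m) (ω 0).toNat, ⟨fun i => ω (i + 1), ξ⟩)
        (a.cost m + 2)
  | member (a e : RamExpr) (m : Memory) (ω : ℕ → Bool) (ξ : ℕ → Cube n) :
      PACCall f (.member a e) (m, ⟨ω, ξ⟩)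
        (Function.update m (a.val m) (f (cubePoint n (e.val m))).toNat, ⟨ω, ξ⟩)
        (a.cost m + e.cost m + n + 2)
  | sample (a b : RamExpr) (m : Memory) (ω : ℕ → Bool) (ξ : ℕ → Cube n) :
      PACCall f (.sample a b) (m, ⟨ω, ξ⟩)
        (Function.update (Function.update m (a.val m) (cubeCode (ξ 0))) (b.val m) (f (ξ 0)).toNat,
          ⟨ω, fun i => ξ (i + 1)⟩)
        (a.cost m + b.cost m + n + 2)

/-- With random bits `ω` and sample points `ξ`, the learner, started with `n`, `k` and `a` in
cells `0`, `1` and `2`, halts within time `T` with final memory `m`. -/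
def Learner.PACHalts (L : Learner PACOp) {n : ℕ} (f : BoolFn n) (k a : ℕ) (T : ℝ)
    (ω : ℕ → Bool) (ξ : ℕ → Cube n) (m : Memory) : Prop :=
  ∃ (z : PACEnv n) (t : ℕ), (t : ℝ) ≤ T ∧
    Runs (PACCall f) L.main (Memory.ofList [n, k, a], ⟨ω, ξ⟩) (m, z) t

/-- `L` is a (distribution-independent) PAC learning algorithm with membership queries for the
classes `𝒞 n`, running in time `T n k a`: for every target `f` in the class, every distribution
`D` and every `a ≥ 1` it always halts within that time, and with probability at least
`1 - 2^(-k)` over its random bits and its independent samples from `D`, the hypothesis that it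
ends with differs from `f` with `D`-probability at most `1 / a`. -/
def Learner.PACLearns (L : Learner PACOp) (𝒞 : (n : ℕ) → Set (BoolFn n))
    (T : ℕ → ℕ → ℕ → ℝ) : Prop :=
  ∀ (n k a : ℕ), 1 ≤ a → ∀ f ∈ 𝒞 n, ∀ (D : Measure (Cube n)) [IsProbabilityMeasure D],
    (∀ ω ξ, ∃ m, L.PACHalts f k a (T n k a) ω ξ m) ∧
    1 - (1 / 2 : ℝ) ^ k ≤ (coinMeasure.prod (Measure.infinitePi fun _ : ℕ => D)).real
      {p | ∃ m, L.PACHalts f k a (T n k a) p.1 p.2 m ∧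
        HoldsHypothesis L.hyp m (T n k a) fun h => D.real {x | h x ≠ f x} ≤ 1 / (a : ℝ)}

/-! Let `m` be the integer part of the `(2 * t + 3)`-th root of `n`, with `t` of order `1 / ε`, and
cut the variables into `n / m` blocks of length `m`. By averaging, some block labels at most `(2 *
m) ^ t` wires (`exists_goodBlock`, `wires_bound`). Once the variables outside this block are fixed,
all other wires start with constants. A gate between wires carrying comparable functions does
nothing or swaps the two wires; any other gate strictly increases the number of comparable ordered
pairs among the non-constant wires (`card_comparablePairs_lt`). So quadratically many gates suffice
(`exists_short_gates`), and each subfunction on the block has a code of `s = O(m ^ (2 * t + 1))`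
bits (`exists_code`, `codes_le`). The exponent `3 / 2` enters here: the squared number of wires per
block, times `m ^ 2`, has to stay below `n`.

All `2 ^ (n - m)` subfunctions are learned simultaneously by halving. The prediction is the majority
vote of the codes consistent with the past counterexamples, and each mistake at least halves the set
of these codes, so a subfunction with a code causes at most `s` mistakes. Which block is good is
unknown, so the blocks are tried in order and a block is abandoned when some subfunction has no code
left; this never happens to a good block (`LearnState.Valid.next`). At most `n * 2 ^ (n - m) * (s +
1)` mistakes occur in total.

A vote depends only on the history of a subfunction and on the queried point. There are only `2 ^
O(m * s)` histories, so their version counts are tabulated once; this costs at most `2 ^ (n - m)`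
times a polynomial (`table_time_le`), and every later prediction is a constant number of operations
on numbers of polynomial length.

For exact learning the mistakes are the counterexamples of equivalence queries; neither coins nor
membership queries are needed (`runs_exact`). For PAC learning they are found among the examples,
and the learner stops after a long run of correct predictions (`runs_pac`). A hypothesis is
determined by the examples that precede its test, so a union bound over the starting times of the
tests bounds the failure probability (`measure_exists_bad_le`).

The programs are verified with the triples `Exec`, whose time is measured in units of `β + 1`, where
`β` bounds the bit length of all memory cells. -/

/-! ### Reasoning about programs -/

/-- All cells hold numbers with at most `β` bits. -/
def Memory.Bounded (β : ℕ) (m : Memory) : Prop := ∀ i, m i < 2 ^ β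

/-- A bound for the bit length of the value of an expression, in units of `β + 1`. -/
def RamExpr.width : RamExpr → ℕ
  | .lit c => c
  | .cell _ => 1
  | .arith _ a b => a.width + b.width

/-- A bound for the cost of an expression, in units of `β + 1`. -/
def RamExpr.weight : RamExpr → ℕ
  | .lit c => 1 + c
  | .cell a => a.weight + 1
  | .arith _ a b => a.weight + b.weight + (1 + (a.width + b.width))

theorem Nat.size_add_le_add (a b : ℕ) : (a + b).size ≤ a.size + b.size := by
  rcases Nat.eq_zero_or_pos a with rfl | ha
  · simp
  rcases Nat.eq_zero_or_pos b with rfl | hb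
  · simp
  rw [Nat.size_le, pow_add]
  have h1 := Nat.lt_size_self a
  have h2 := Nat.lt_size_self b
  nlinarith

theorem Nat.size_mul_le_add (a b : ℕ) : (a * b).size ≤ a.size + b.size := by
  rw [Nat.size_le, pow_add]
  exact Nat.mul_lt_mul'' (Nat.lt_size_self a) (Nat.lt_size_self b)

theorem ArithOp.size_val_le (o : ArithOp) (a b : ℕ) : (o.val a b).size ≤ a.size + b.size := by
  have key : ∀ c, c ≤ a → c.size ≤ a.size + b.size :=
    fun c hc => (Nat.size_le_size hc).trans (Nat.le_add_right _ _)
  cases o with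
  | add => exact Nat.size_add_le_add a b
  | sub => exact key _ (Nat.sub_le a b)
  | mul => exact Nat.size_mul_le_add a b
  | div => exact key _ (Nat.div_le_self a b)
  | mod => exact key _ (Nat.mod_le a b)

theorem RamExpr.size_val_le {β : ℕ} {m : Memory} (hm : m.Bounded β) (e : RamExpr) :
    (e.val m).size ≤ e.width * (β + 1) := by
  induction e with
  | lit c =>
    have : c.size ≤ c := Nat.size_le.2 Nat.lt_two_pow_self
    simp only [val, width]; nlinarith
  | cell a _ =>
    have := Nat.size_le.2 (hm (a.val m))
    simp only [val, width]; omega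
  | arith o a b iha ihb =>
    have := o.size_val_le (a.val m) (b.val m)
    simp only [val, width]
    nlinarith

/-- Bit lengths at most add up under each operation, so the cost is linear in the word size, with a
factor depending on the syntax alone. For a concrete expression this factor can be found by
`decide`. -/
theorem RamExpr.cost_le {β : ℕ} {m : Memory} (hm : m.Bounded β) (e : RamExpr) :
    e.cost m ≤ e.weight * (β + 1) := by
  induction e with
  | lit c =>
    have : c.size ≤ c := Nat.size_le.2 Nat.lt_two_pow_self
    simp only [cost, weight]; nlinarith
  | cell a iha =>
    have := Nat.size_le.2 (hm (a.val m))
    simp only [cost, weight]; nlinarith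
  | arith o a b iha ihb =>
    have := (RamExpr.arith o a b).size_val_le hm
    simp only [val, width] at this
    simp only [cost, weight]
    nlinarith

/-! ### Triples with a time bound for programs that leave the environment alone -/

section Exec

variable {Op E : Type} {ext : Op → Memory × E → Memory × E → ℕ → Prop} {β : ℕ}

/-- Started in memory `m`, the program halts without touching the environment after time at most
`τ * (β + 1)`, in a memory that is bounded and satisfies `Q`. -/
def Exec (ext : Op → Memory × E → Memory × E → ℕ → Prop) (β : ℕ) (p : RamProg Op) (m : Memory)
    (τ : ℕ) (Q : Memory → Prop) : Prop :=
  ∀ z, ∃ m' t, Runs ext p (m, z) (m', z) t ∧ t ≤ τ * (β + 1) ∧ m'.Bounded β ∧ Q m'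

theorem Exec.mono {p : RamProg Op} {m : Memory} {τ τ' : ℕ} {Q Q' : Memory → Prop}
    (h : Exec ext β p m τ Q) (hτ : τ ≤ τ') (hQ : ∀ m', m'.Bounded β → Q m' → Q' m') :
    Exec ext β p m τ' Q' := fun z =>
  let ⟨m', t, hr, ht, hb, hq⟩ := h z
  ⟨m', t, hr, ht.trans (Nat.mul_le_mul_right _ hτ), hb, hQ m' hb hq⟩

theorem Memory.Bounded.update {m : Memory} (hm : m.Bounded β) {i v : ℕ} (hv : v < 2 ^ β) :
    Memory.Bounded β (Function.update m i v) := by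
  intro j
  rw [Function.update_apply]
  split_ifs
  exacts [hv, hm j]

theorem Exec.skip {m : Memory} {Q : Memory → Prop} (hm : m.Bounded β) (h : Q m) :
    Exec ext β .skip m 1 Q := fun z => ⟨m, 1, .skip _, by omega, hm, h⟩

theorem Exec.assign {m : Memory} {a e : RamExpr} {Q : Memory → Prop} (hm : m.Bounded β)
    (hv : e.val m < 2 ^ β) (h : Q (Function.update m (a.val m) (e.val m))) :
    Exec ext β (.assign a e) m (a.weight + e.weight + 1) Q := fun z => by
  refine ⟨_, _, .assign a e m z, ?_, hm.update hv, h⟩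
  have h1 := a.cost_le hm
  have h2 := e.cost_le hm
  nlinarith

theorem Exec.seq {p q : RamProg Op} {m : Memory} {τ τ' : ℕ} {Q Q' : Memory → Prop}
    (h : Exec ext β p m τ Q) (h' : ∀ m', m'.Bounded β → Q m' → Exec ext β q m' τ' Q') :
    Exec ext β (.seq p q) m (τ + τ') Q' := fun z => by
  obtain ⟨m1, t1, hr1, ht1, hb1, hq1⟩ := h z
  obtain ⟨m2, t2, hr2, ht2, hb2, hq2⟩ := h' m1 hb1 hq1 z
  exact ⟨m2, t1 + t2, .seq hr1 hr2, by rw [add_mul]; omega, hb2, hq2⟩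

theorem Exec.cond {e : RamExpr} {p q : RamProg Op} {m : Memory} {τ τ' : ℕ} {Q : Memory → Prop}
    (hm : m.Bounded β) (h : e.val m ≠ 0 → Exec ext β p m τ Q)
    (h' : e.val m = 0 → Exec ext β q m τ' Q) :
    Exec ext β (.cond e p q) m (e.weight + 1 + (τ + τ')) Q := fun z => by
  have hc := e.cost_le hm
  by_cases he : e.val m = 0
  · obtain ⟨m1, t1, hr1, ht1, hb1, hq1⟩ := h' he z
    exact ⟨m1, _, .cond_false he hr1, by simp only [add_mul]; omega, hb1, hq1⟩
  · obtain ⟨m1, t1, hr1, ht1, hb1, hq1⟩ := h he z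
    exact ⟨m1, _, .cond_true he hr1, by simp only [add_mul]; omega, hb1, hq1⟩

theorem Exec.loop_done {e : RamExpr} {p : RamProg Op} {m : Memory} {Q : Memory → Prop}
    (hm : m.Bounded β) (he : e.val m = 0) (h : Q m) :
    Exec ext β (.loop e p) m (e.weight + 1) Q := fun z =>
  ⟨m, _, .loop_false he, by have := e.cost_le hm; simp only [add_mul]; omega, hm, h⟩

theorem Exec.loop_step {e : RamExpr} {p : RamProg Op} {m : Memory} {τ τ' : ℕ}
    {Q Q' : Memory → Prop} (hm : m.Bounded β) (he : e.val m ≠ 0) (h : Exec ext β p m τ Q)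
    (h' : ∀ m', m'.Bounded β → Q m' → Exec ext β (.loop e p) m' τ' Q') :
    Exec ext β (.loop e p) m (e.weight + 1 + τ + τ') Q' := fun z => by
  obtain ⟨m1, t1, hr1, ht1, hb1, hq1⟩ := h z
  obtain ⟨m2, t2, hr2, ht2, hb2, hq2⟩ := h' m1 hb1 hq1 z
  refine ⟨m2, _, .loop_true he hr1 hr2, ?_, hb2, hq2⟩
  have hc := e.cost_le hm
  simp only [add_mul]
  omega

/-- A loop whose invariant is indexed by the number of remaining iterations. -/
theorem Exec.loop {e : RamExpr} {p : RamProg Op} {τ : ℕ} {I : ℕ → Memory → Prop}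
    (h0 : ∀ m, I 0 m → e.val m = 0) (h1 : ∀ c m, I (c + 1) m → e.val m ≠ 0)
    (h : ∀ c m, m.Bounded β → I (c + 1) m → Exec ext β p m τ (I c)) (c : ℕ) (m : Memory)
    (hm : m.Bounded β) (hI : I c m) :
    Exec ext β (.loop e p) m ((c + 1) * (e.weight + 1 + τ)) (I 0) := by
  induction c generalizing m with
  | zero => exact (Exec.loop_done hm (h0 m hI) hI).mono (by omega) fun _ _ h => h
  | succ c ih =>
    refine (Exec.loop_step hm (h1 c m hI) (h c m hm hI) fun m' hm' hI' => ih m' hm' hI').mono ?_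
      fun _ _ h => h
    rw [add_mul (c + 1) 1]
    omega

/-- A sequence of assignments. -/
def RamProg.block : List (RamExpr × RamExpr) → RamProg Op
  | [] => .skip
  | c :: l => .seq (.assign c.1 c.2) (block l)

def blockWeight : List (RamExpr × RamExpr) → ℕ
  | [] => 1
  | c :: l => c.1.weight + c.2.weight + 1 + blockWeight l

/-- The condition that all assigned values are bounded and `Q` holds in the end. -/
def BlockPost (β : ℕ) (Q : Memory → Prop) : List (RamExpr × RamExpr) → Memory → Prop
  | [], m => Q m
  | c :: l, m => c.2.val m < 2 ^ β ∧
      BlockPost β Q l (Function.update m (c.1.val m) (c.2.val m))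

theorem Exec.block {l : List (RamExpr × RamExpr)} {m : Memory} {Q : Memory → Prop}
    (hm : m.Bounded β) (h : BlockPost β Q l m) :
    Exec ext β (.block l) m (blockWeight l) Q := by
  induction l generalizing m with
  | nil => exact Exec.skip hm h
  | cons c l ih =>
    exact Exec.seq (Q := fun m' => BlockPost β Q l m') (Exec.assign hm h.1 h.2)
      fun m' hm' h' => ih hm' h'

end Exec

/-! ### Comparator circuits coded by numbers -/

/-- The value of the literal with code `c` at the point `y`: `2 * 2 ^ i` codes the bit `i` of `y`,
and `2 * 2 ^ i + 1` its negation. -/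
def litVal (c y : ℕ) : ℕ := (y / (c / 2) + c % 2) % 2

/-- The wires `0, …, t - 1` receive the literals given by the digits of `E` in base `4 * M`. -/
def wiresInit (M y : ℕ) : ℕ → ℕ → (ℕ → ℕ) → ℕ → ℕ
  | 0, _, V => V
  | t + 1, E, V => wiresInit M y t (E / (4 * M)) (Function.update V t (litVal (E % (4 * M)) y))

/-- The comparator gate on wires holding bits. -/
def gateStep (V : ℕ → ℕ) (i j : ℕ) : ℕ → ℕ :=
  Function.update (Function.update V i (V i * V j)) j (V i + V j - V i * V j)

/-- The `t` gates given by the digits of `E` in base `L`. -/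
def gateRun (L : ℕ) : ℕ → ℕ → (ℕ → ℕ) → ℕ → ℕ
  | 0, _, V => V
  | t + 1, E, V => gateRun L t (E / L / L) (gateStep V (E % L) (E / L % L))

/-- The value at `y` of the function coded by `D`. -/
def codeEval (M L D y : ℕ) : ℕ :=
  gateRun L (L * L) (D / (4 * M) ^ L) (wiresInit M y L D fun _ => 0) 0

theorem wiresInit_of_le (M y t E : ℕ) (V : ℕ → ℕ) {w : ℕ} (hw : t ≤ w) :
    wiresInit M y t E V w = V w := by
  induction t generalizing E V with
  | zero => rfl
  | succ t ih => rw [wiresInit, ih _ _ (by omega), Function.update_of_ne (by omega)]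

/-- The labels are the low digits in base `4 * M`; the free upper part `E'` will hold the gates. -/
theorem exists_wires_code {M : ℕ} (hM : 0 < M) (E' t : ℕ) (c : ℕ → ℕ) (hc : ∀ w, c w < 4 * M) :
    ∃ E, E / (4 * M) ^ t = E' ∧
      ∀ y V w, w < t → wiresInit M y t E V w = litVal (c w) y := by
  induction t with
  | zero => exact ⟨E', by simp, fun _ _ _ h => absurd h (by omega)⟩
  | succ t ih =>
    obtain ⟨E, hE, h⟩ := ih
    have h1 : (c t + 4 * M * E) % (4 * M) = c t := by
      rw [Nat.add_mul_mod_self_left, Nat.mod_eq_of_lt (hc t)]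
    have h2 : (c t + 4 * M * E) / (4 * M) = E := by
      rw [Nat.add_mul_div_left _ _ (by omega), Nat.div_eq_of_lt (hc t), zero_add]
    refine ⟨c t + 4 * M * E, by rw [pow_succ', ← Nat.div_div_eq_div_mul, h2, hE], ?_⟩
    intro y V w hw
    rw [wiresInit, h1, h2]
    rcases Nat.lt_succ_iff_lt_or_eq.1 hw with hw | rfl
    · exact h _ _ _ hw
    · rw [wiresInit_of_le _ _ _ _ _ le_rfl, Function.update_self]

/-- Zero digits code the gate `(0, 0)`. As it is void on bits, a short gate list can be padded to
any prescribed length. -/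
theorem gateStep_zero_zero {V : ℕ → ℕ} (h : V 0 ≤ 1) : gateStep V 0 0 = V := by
  have h' : V 0 = 0 ∨ V 0 = 1 := by omega
  funext i
  rcases h' with h' | h' <;> simp only [gateStep, Function.update_apply, h'] <;> split_ifs <;>
    simp_all

theorem gateRun_zero {L t : ℕ} {V : ℕ → ℕ} (h : V 0 ≤ 1) : gateRun L t 0 V = V := by
  induction t with
  | zero => rfl
  | succ t ih => simp only [gateRun, Nat.zero_div, Nat.zero_mod, gateStep_zero_zero h, ih]

theorem gateStep_le_one {V : ℕ → ℕ} (hV : ∀ w, V w ≤ 1) (i j w : ℕ) : gateStep V i j w ≤ 1 := by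
  have h1 := hV i
  have h2 := hV j
  have h3 := hV w
  simp only [gateStep, Function.update_apply]
  interval_cases V i <;> interval_cases V j <;> split_ifs <;> simp [h3]

theorem gateRun_le_one {L t E : ℕ} {V : ℕ → ℕ} (hV : ∀ w, V w ≤ 1) (w : ℕ) :
    gateRun L t E V w ≤ 1 := by
  induction t generalizing E V with
  | zero => exact hV w
  | succ t ih => exact ih fun w => gateStep_le_one hV _ _ w

theorem wiresInit_le_one {M y t E : ℕ} {V : ℕ → ℕ} (hV : ∀ w, V w ≤ 1) (w : ℕ) :
    wiresInit M y t E V w ≤ 1 := by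
  induction t generalizing E V with
  | zero => exact hV w
  | succ t ih =>
    refine ih fun w => ?_
    rw [Function.update_apply]
    split_ifs
    · exact Nat.lt_succ_iff.1 (Nat.mod_lt _ two_pos)
    · exact hV w

theorem codeEval_le_one (M L D y : ℕ) : codeEval M L D y ≤ 1 :=
  gateRun_le_one (fun w => wiresInit_le_one (fun _ => Nat.zero_le _) w) 0

theorem exists_gates_code {L : ℕ} (hL : 0 < L) (gs : List (ℕ × ℕ))
    (hgs : ∀ g ∈ gs, g.1 < L ∧ g.2 < L) (t : ℕ) (ht : gs.length ≤ t) :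
    ∃ E < (L * L) ^ t, ∀ V : ℕ → ℕ, (∀ w, V w ≤ 1) →
      gateRun L t E V = gs.foldl (fun V g => gateStep V g.1 g.2) V := by
  induction gs generalizing t with
  | nil => exact ⟨0, by positivity, fun V hV => gateRun_zero (hV 0)⟩
  | cons g gs ih =>
    obtain ⟨t, rfl⟩ : ∃ t', t = t' + 1 := ⟨t - 1, by simp at ht; omega⟩
    obtain ⟨E, hE, h⟩ := ih (fun g hg => hgs g (by simp [hg])) t (by simpa using ht)
    obtain ⟨h1, h2⟩ := hgs g (by simp)
    have e1 : (g.1 + L * (g.2 + L * E)) % L = g.1 := by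
      rw [Nat.add_mul_mod_self_left, Nat.mod_eq_of_lt h1]
    have e2 : (g.1 + L * (g.2 + L * E)) / L = g.2 + L * E := by
      rw [Nat.add_mul_div_left _ _ hL, Nat.div_eq_of_lt h1, zero_add]
    have e3 : (g.2 + L * E) % L = g.2 := by
      rw [Nat.add_mul_mod_self_left, Nat.mod_eq_of_lt h2]
    have e4 : (g.2 + L * E) / L = E := by
      rw [Nat.add_mul_div_left _ _ hL, Nat.div_eq_of_lt h2, zero_add]
    refine ⟨g.1 + L * (g.2 + L * E), ?_, fun V hV => ?_⟩
    · calc g.1 + L * (g.2 + L * E) < L * (L * (E + 1)) := by nlinarith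
        _ = L * L * (E + 1) := by ring
        _ ≤ L * L * (L * L) ^ t := Nat.mul_le_mul_left _ hE
        _ = (L * L) ^ (t + 1) := by ring
    · rw [gateRun, e1, e2, e3, e4, h _ fun w => gateStep_le_one hV _ _ w]
      rfl

/-! ### Few gates suffice -/

section Gates

variable {ℓ : ℕ} {Y : Type}

/-- `V a ≤ V b` pointwise. -/
def WireLE (V : Fin ℓ → Y → Bool) (a b : Fin ℓ) : Prop := ∀ y, V a y = true → V b y = true

/-- The functions on the wires after a gate. -/
def gateFun (V : Fin ℓ → Y → Bool) (g : Fin ℓ × Fin ℓ) : Fin ℓ → Y → Bool :=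
  fun w y => applyComparator (fun w => V w y) g w

open Classical in
/-- The ordered pairs of wires in `A` with comparable functions. -/
noncomputable def comparablePairs (A : Finset (Fin ℓ)) (V : Fin ℓ → Y → Bool) :
    Finset (Fin ℓ × Fin ℓ) :=
  (A ×ˢ A).filter fun p => WireLE V p.1 p.2

/-- The gate makes `(i, j)` comparable. It can destroy only pairs `(j, b)` and `(a, i)`, and then
`(i, b)`, respectively `(a, j)`, becomes comparable: the conjunction lies below `V j` and the
disjunction above `V i`. The replacement was not comparable before, since otherwise the destroyed
pair would have survived; so nothing is counted twice. -/
theorem card_comparablePairs_lt {A : Finset (Fin ℓ)} {V : Fin ℓ → Y → Bool} {i j : Fin ℓ}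
    (hi : i ∈ A) (hj : j ∈ A) (hij : ¬ WireLE V i j) (hji : ¬ WireLE V j i) :
    (comparablePairs A V).card < (comparablePairs A (gateFun V (i, j))).card := by
  classical
  have hne : i ≠ j := by rintro rfl; exact hij fun _ h => h
  set U := gateFun V (i, j) with hU
  have Ui : ∀ y, U i y = (V i y && V j y) := fun y => by simp [hU, gateFun, applyComparator]
  have Uj : ∀ y, U j y = (V i y || V j y) := fun y => by
    simp [hU, gateFun, applyComparator, hne.symm]
  have Uw : ∀ w, w ≠ i → w ≠ j → ∀ y, U w y = V w y := fun w h1 h2 y => by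
    simp [hU, gateFun, applyComparator, h1, h2]
  let π : Fin ℓ × Fin ℓ → Fin ℓ × Fin ℓ := fun p => (Equiv.swap i j p.1, Equiv.swap i j p.2)
  have hππ : ∀ p, π (π p) = p := fun p => by simp [π]
  -- a comparable pair that the gate destroys is replaced by its mirror image
  have key : ∀ a b, WireLE V a b → ¬ WireLE U a b →
      WireLE U (π (a, b)).1 (π (a, b)).2 ∧ ¬ WireLE V (π (a, b)).1 (π (a, b)).2 ∧
      π (a, b) ≠ (i, j) := by
    intro a b hab hn
    by_cases hai : a = i
    · subst hai
      by_cases hbi : b = a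
      · subst hbi; exact absurd (fun _ h => h) hn
      by_cases hbj : b = j
      · subst hbj; exact absurd hab hij
      refine absurd (fun y hy => ?_) hn
      rw [Uw b hbi hbj]
      rw [Ui, Bool.and_eq_true] at hy
      exact hab y hy.1
    by_cases haj : a = j
    · subst haj
      by_cases hba : b = a
      · subst hba; exact absurd (fun _ h => h) hn
      by_cases hbi : b = i
      · subst hbi; exact absurd hab hji
      have e : π (a, b) = (i, b) := by simp [π, Equiv.swap_apply_of_ne_of_ne hbi hba]
      rw [e]
      refine ⟨fun y hy => ?_, fun h => hn fun y hy => ?_, by simp [hba]⟩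
      · simp only [Ui, Bool.and_eq_true] at hy
        simp only [Uw b hbi hba]
        exact hab y hy.2
      · rw [Uj, Bool.or_eq_true] at hy
        rw [Uw b hbi hba]
        exact hy.elim (h y) (hab y)
    by_cases hbi : b = i
    · subst hbi
      have e : π (a, b) = (a, j) := by simp [π, Equiv.swap_apply_of_ne_of_ne hai haj]
      rw [e]
      refine ⟨fun y hy => ?_, fun h => hn fun y hy => ?_, by simp [hai]⟩
      · simp only [Uw a hai haj] at hy
        simp only [Uj, Bool.or_eq_true]
        exact Or.inl (hab y hy)
      · rw [Uw a hai haj] at hy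
        rw [Ui, Bool.and_eq_true]
        exact ⟨hab y hy, h y hy⟩
    by_cases hbj : b = j
    · subst hbj
      refine absurd (fun y hy => ?_) hn
      rw [Uw a hai haj] at hy
      rw [Uj, Bool.or_eq_true]
      exact Or.inr (hab y hy)
    · refine absurd (fun y hy => ?_) hn
      rw [Uw a hai haj] at hy
      rw [Uw b hbi hbj]
      exact hab y hy
  have hswap : ∀ a ∈ A, Equiv.swap i j a ∈ A := fun a ha => by
    rw [Equiv.swap_apply_def]; split_ifs <;> assumption
  have hmem : (i, j) ∈ comparablePairs A U := by
    refine Finset.mem_filter.2 ⟨by simp [hi, hj], fun y hy => ?_⟩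
    simp only [Ui, Bool.and_eq_true] at hy
    simp [Uj, hy.1]
  -- Surviving pairs are kept and destroyed ones mirrored; this injection misses `(i, j)`, which
  -- makes the inequality strict.
  refine lt_of_le_of_lt (Finset.card_le_card_of_injOn
    (t := (comparablePairs A U).erase (i, j))
    (fun p => if WireLE U p.1 p.2 then p else π p) ?_ ?_) (Finset.card_erase_lt_of_mem hmem)
  · rintro ⟨a, b⟩ hp
    obtain ⟨hA, hab⟩ := Finset.mem_filter.1 (Finset.mem_coe.1 hp)
    rw [Finset.mem_product] at hA
    rw [Finset.mem_coe, Finset.mem_erase]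
    dsimp only
    split_ifs with h
    · refine ⟨?_, Finset.mem_filter.2 ⟨Finset.mem_product.2 hA, h⟩⟩
      rintro ⟨⟩
      exact hij hab
    · obtain ⟨h1, h2, h3⟩ := key a b hab h
      exact ⟨h3, Finset.mem_filter.2
        ⟨Finset.mem_product.2 ⟨hswap _ hA.1, hswap _ hA.2⟩, h1⟩⟩
  · rintro ⟨a, b⟩ hp ⟨a', b'⟩ hp' he
    have hab := (Finset.mem_filter.1 (Finset.mem_coe.1 hp)).2
    have hab' := (Finset.mem_filter.1 (Finset.mem_coe.1 hp')).2
    dsimp only at he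
    split_ifs at he with h h' h'
    · exact he
    · exact absurd (he ▸ hab) (key a' b' hab' h').2.1
    · exact absurd (he.symm ▸ hab') (key a b hab h).2.1
    · rw [← hππ (a, b), he, hππ]

/-- If the functions on the wires outside `A` are constant, then, up to a permutation of the
wires, `A.card ^ 2` gates between wires in `A` suffice. -/
theorem exists_short_gates (A : Finset (Fin ℓ)) (gates : List (Fin ℓ × Fin ℓ))
    (V : Fin ℓ → Y → Bool) (σ : Equiv.Perm (Fin ℓ)) (hV : ∀ w ∉ A, ∀ y y', V w y = V w y') :
    ∃ (gates' : List (Fin ℓ × Fin ℓ)) (τ : Equiv.Perm (Fin ℓ)),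
      (∀ g ∈ gates', g.1 ∈ A ∧ g.2 ∈ A) ∧
      gates'.length + (comparablePairs A V).card ≤ A.card * A.card ∧
      ∀ y w, gates.foldl applyComparator (fun w => V (σ w) y) w =
        gates'.foldl applyComparator (fun w => V w y) (τ w) := by
  classical
  induction gates generalizing V σ with
  | nil =>
    refine ⟨[], σ, by simp, ?_, by simp⟩
    rw [← Finset.card_product]
    simpa [comparablePairs] using Finset.card_filter_le (A ×ˢ A) fun p => WireLE V p.1 p.2
  | cons g gates ih =>
    obtain ⟨i, j⟩ := g
    -- If the first function is below the second, conjunction and disjunction are already in place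
    -- and the gate is dropped.
    by_cases h1 : WireLE V (σ i) (σ j)
    · obtain ⟨gs, τ, hA, hc, he⟩ := ih V σ hV
      refine ⟨gs, τ, hA, hc, fun y w => ?_⟩
      rw [← he, List.foldl_cons]
      refine congrFun (congrArg (fun v => gates.foldl applyComparator v) (funext fun w => ?_)) w
      have := h1 y
      simp only [applyComparator]
      split_ifs with h h'
      · rw [h]; revert this; cases V (σ i) y <;> cases V (σ j) y <;> simp
      · rw [h']; revert this; cases V (σ i) y <;> cases V (σ j) y <;> simp
      · rfl
    -- In the opposite order the gate exchanges the two wires, which the permutation absorbs.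
    by_cases h2 : WireLE V (σ j) (σ i)
    · obtain ⟨gs, τ, hA, hc, he⟩ := ih V ((Equiv.swap i j).trans σ) hV
      refine ⟨gs, τ, hA, hc, fun y w => ?_⟩
      rw [← he, List.foldl_cons]
      refine congrFun (congrArg (fun v => gates.foldl applyComparator v) (funext fun w => ?_)) w
      have := h2 y
      simp only [applyComparator, Equiv.trans_apply, Equiv.swap_apply_def]
      split_ifs with h h' <;> revert this <;> cases V (σ i) y <;> cases V (σ j) y <;> simp
    -- A constant function is comparable with every function, so a gate that has to be kept joins
    -- two wires of `A`.
    have hmem : ∀ a b : Fin ℓ, ¬ WireLE V a b → ¬ WireLE V b a → a ∈ A := by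
      intro a b hab hba
      by_contra ha
      have hc := hV a ha
      simp only [WireLE, not_forall] at hab hba
      obtain ⟨y, hy, _⟩ := hab
      obtain ⟨y', _, hy'⟩ := hba
      exact hy' (hc y y' ▸ hy)
    have hi := hmem _ _ h1 h2
    have hj := hmem _ _ h2 h1
    obtain ⟨gs, τ, hA, hc, he⟩ := ih (gateFun V (σ i, σ j)) σ (by
      intro w hw y y'
      have e1 : w ≠ σ i := by rintro rfl; exact hw hi
      have e2 : w ≠ σ j := by rintro rfl; exact hw hj
      simpa [gateFun, applyComparator, e1, e2] using hV w hw y y')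
    refine ⟨(σ i, σ j) :: gs, τ, ?_, ?_, fun y w => ?_⟩
    · intro g hg
      rcases List.mem_cons.1 hg with rfl | hg
      exacts [⟨hi, hj⟩, hA g hg]
    · have := card_comparablePairs_lt hi hj h1 h2
      simp only [List.length_cons]
      omega
    · rw [List.foldl_cons, List.foldl_cons]
      refine Eq.trans ?_ (he y w)
      refine congrFun (congrArg (fun v => gates.foldl applyComparator v) (funext fun w => ?_)) w
      simp [gateFun, applyComparator]

end Gates

/-- Renaming wires by a map that is injective on the wires in use. -/
theorem foldl_gateStep_rename {ℓ : ℕ} {A : Finset (Fin ℓ)} {e : Fin ℓ → ℕ}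
    (he : Set.InjOn e A) (gates : List (Fin ℓ × Fin ℓ)) (hg : ∀ g ∈ gates, g.1 ∈ A ∧ g.2 ∈ A)
    (U : ℕ → ℕ) (v : Fin ℓ → Bool) (hU : ∀ w ∈ A, U (e w) = (v w).toNat) :
    ∀ w ∈ A, (gates.map fun g => (e g.1, e g.2)).foldl (fun V g => gateStep V g.1 g.2) U (e w) =
      (gates.foldl applyComparator v w).toNat := by
  induction gates generalizing U v with
  | nil => exact hU
  | cons g gates ih =>
    obtain ⟨hi, hj⟩ := hg g (by simp)
    refine ih (fun g h => hg g (by simp [h])) _ _ fun w hw => ?_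
    have e1 : e w = e g.1 ↔ w = g.1 := ⟨fun h => he hw hi h, fun h => h ▸ rfl⟩
    have e2 : e w = e g.2 ↔ w = g.2 := ⟨fun h => he hw hj h, fun h => h ▸ rfl⟩
    simp only [gateStep, Function.update_apply, applyComparator, e1, e2, hU _ hi, hU _ hj,
      hU _ hw]
    split_ifs with h1 h2 <;> subst_vars <;> first | rfl | skip
    · rw [h2]; cases v g.1 <;> rfl
    · cases v g.1 <;> cases v g.2 <;> rfl
    · cases v g.1 <;> cases v g.2 <;> rfl

/-! ### Splitting off a block of variables -/

/-- The bits of `x` in the block of length `log M` starting at position `log p`. -/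
def innerPart (p M x : ℕ) : ℕ := x / p % M

/-- The bits of `x` outside the block. -/
def outerPart (p M x : ℕ) : ℕ := x % p + p * (x / (p * M))

/-- With respect to the block `b` of `m` variables, all subfunctions of `F` on the block are coded
by numbers with at most `s` bits. -/
def GoodBlock (n m L s : ℕ) (F : ℕ → Bool) (b : ℕ) : Prop :=
  (b + 1) * m ≤ n ∧ ∃ D : ℕ → ℕ, (∀ ρ, D ρ < 2 ^ s) ∧ ∀ x < 2 ^ n,
    codeEval (2 ^ m) L (D (outerPart ((2 ^ m) ^ b) (2 ^ m) x)) (innerPart ((2 ^ m) ^ b) (2 ^ m) x) =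
      (F x).toNat

/-- The outer part is `x` with the block cut out, so the bits above the block are moved down by `m`.
-/
theorem testBit_eq_parts (m b x i : ℕ) : x.testBit i =
    if i < b * m then (outerPart ((2 ^ m) ^ b) (2 ^ m) x).testBit i
    else if i < (b + 1) * m then (innerPart ((2 ^ m) ^ b) (2 ^ m) x).testBit (i - b * m)
    else (outerPart ((2 ^ m) ^ b) (2 ^ m) x).testBit (i - m) := by
  have e1 : (2 ^ m) ^ b = 2 ^ (b * m) := by rw [← pow_mul, mul_comm]
  have e2 : 2 ^ (b * m) * 2 ^ m = 2 ^ ((b + 1) * m) := by rw [← pow_add]; congr 1; ring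
  have hlt : x % 2 ^ (b * m) < 2 ^ (b * m) := Nat.mod_lt _ (by positivity)
  rw [outerPart, innerPart, e1, e2, add_comm]
  split_ifs with h1 h2
  · rw [Nat.testBit_two_pow_mul_add _ hlt, if_pos h1, Nat.testBit_mod_two_pow]
    simp [h1]
  · rw [Nat.testBit_mod_two_pow, Nat.testBit_div_two_pow]
    have h3 : i - b * m < m := by rw [add_mul] at h2; omega
    have h4 : i - b * m + b * m = i := by omega
    simp [h3, h4]
  · have h3 : ¬ i - m < b * m := by rw [add_mul] at h2; omega
    rw [Nat.testBit_two_pow_mul_add _ hlt, if_neg h3, Nat.testBit_div_two_pow]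
    congr 1
    rw [add_mul] at h2 ⊢
    omega

/-- Adding the parity of the code modulo two flips the selected bit exactly for negated literals. -/
theorem litVal_literal (k y : ℕ) (pos : Bool) :
    litVal (2 * 2 ^ k + (!pos).toNat) y = (if pos then y.testBit k else !y.testBit k).toNat := by
  have h1 : (2 * 2 ^ k + (!pos).toNat) / 2 = 2 ^ k := by cases pos <;> simp; omega
  have h2 : (2 * 2 ^ k + (!pos).toNat) % 2 = (!pos).toNat := by cases pos <;> simp
  rw [litVal, h1, h2, Nat.testBit_eq_decide_div_mod_eq]
  rcases Nat.mod_two_eq_zero_or_one (y / 2 ^ k) with h | h <;> cases pos <;>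
    simp [h, Nat.add_mod]

/-- This renumbers the wires in use, with the output as number `0`, the wire that `codeEval` reads.
-/
theorem exists_injOn_lt_card {α : Type*} [DecidableEq α] (A : Finset α) {o : α} (ho : o ∈ A) :
    ∃ e : α → ℕ, Set.InjOn e A ∧ (∀ w ∈ A, e w < A.card) ∧ e o = 0 := by
  have hl : ((o :: (A.erase o).toList).length) = A.card := by
    rw [List.length_cons, Finset.length_toList, Finset.card_erase_add_one ho]
  have hmem : ∀ w ∈ A, w ∈ o :: (A.erase o).toList := fun w hw => by
    by_cases h : w = o <;> simp [h, hw]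
  refine ⟨fun w => (o :: (A.erase o).toList).idxOf w, fun a ha b _ h => ?_, fun w hw => ?_, ?_⟩
  · exact (List.idxOf_inj (hmem a ha)).1 h
  · rw [← hl]; exact List.idxOf_lt_length_iff.2 (hmem w hw)
  · simp

/-- After the reduction to few gates, only the wires of `A` and the output matter, so the size of
the code does not depend on the number `ℓ` of wires of the original circuit. -/
theorem exists_code {ℓ : ℕ} {m L : ℕ} (A : Finset (Fin ℓ)) (hA : A.card + 1 ≤ L)
    (var : Fin ℓ → ℕ) (pos : Fin ℓ → Bool) (const : Fin ℓ → Bool) (hvar : ∀ w ∈ A, var w < m)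
    (gates : List (Fin ℓ × Fin ℓ)) (out : Fin ℓ) :
    ∃ D < (4 * 2 ^ m) ^ L * (L * L) ^ (L * L), ∀ y < 2 ^ m, codeEval (2 ^ m) L D y =
      (gates.foldl applyComparator (fun w => if w ∈ A then
        (if pos w then y.testBit (var w) else !y.testBit (var w)) else const w) out).toNat := by
  classical
  set V : Fin ℓ → ℕ → Bool := fun w y => if w ∈ A then
    (if pos w then y.testBit (var w) else !y.testBit (var w)) else const w with hV
  obtain ⟨gs, τ, hgs, hlen, hfold⟩ := exists_short_gates A gates V (Equiv.refl _)
    (fun w hw y y' => by simp [hV, hw])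
  -- The permuted output may be one of the constant wires; this is why one more wire than `A.card`
  -- is allowed.
  set A' := insert (τ out) A with hA'
  have ho : τ out ∈ A' := Finset.mem_insert_self _ _
  have hcard : A'.card ≤ L := (Finset.card_insert_le _ _).trans hA
  obtain ⟨e, he, hlt, heo⟩ := exists_injOn_lt_card A' ho
  have hL : 0 < L := by omega
  have : Nonempty (Fin ℓ) := ⟨out⟩
  -- the code of the label of a wire
  let code : Fin ℓ → ℕ := fun w => if w ∈ A then 2 * 2 ^ var w + (!pos w).toNat
    else 2 * 2 ^ m + (const w).toNat
  have hcode : ∀ w, code w < 4 * 2 ^ m := fun w => by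
    have hb : ∀ b : Bool, b.toNat ≤ 1 := Bool.toNat_le
    simp only [code]
    split_ifs with h
    · have h1 := hb (!pos w)
      have h2 : 2 ^ var w < 2 ^ m := Nat.pow_lt_pow_right (by norm_num) (hvar w h)
      omega
    · have h1 := hb (const w)
      have h2 : 0 < 2 ^ m := by positivity
      omega
  have hval : ∀ w, ∀ y < 2 ^ m, litVal (code w) y = (V w y).toNat := fun w y hy => by
    simp only [code, hV]
    split_ifs with h h'
    · simpa [h'] using litVal_literal (var w) y (pos w)
    · simpa [h'] using litVal_literal (var w) y (pos w)
    -- Constants are coded as literals of bit `m`, which is zero at every point `y < 2 ^ m`.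
    · have := litVal_literal m y (!const w)
      rw [Bool.not_not] at this
      rw [this, Nat.testBit_lt_two_pow hy]
      cases const w <;> rfl
  have hM : 0 < 2 ^ m := by positivity
  have hgs' : ∀ g ∈ gs, g.1 ∈ A' ∧ g.2 ∈ A' := fun g hg =>
    ⟨Finset.mem_insert_of_mem (hgs g hg).1, Finset.mem_insert_of_mem (hgs g hg).2⟩
  obtain ⟨E, hE, hgate⟩ := exists_gates_code hL (gs.map fun g => (e g.1, e g.2)) (by
    intro g hg
    obtain ⟨g', hg', rfl⟩ := List.mem_map.1 hg
    exact ⟨(hlt _ (hgs' g' hg').1).trans_le hcard, (hlt _ (hgs' g' hg').2).trans_le hcard⟩)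
    (L * L) (by
      rw [List.length_map]
      have : A.card * A.card ≤ L * L := Nat.mul_le_mul (by omega) (by omega)
      omega)
  obtain ⟨D, hD, hwire⟩ := exists_wires_code hM E L (fun i => code (Function.invFunOn e A' i))
    fun i => hcode _
  refine ⟨D, ?_, fun y hy => ?_⟩
  · have h4 : 0 < (4 * 2 ^ m) ^ L := by positivity
    have := (Nat.div_lt_iff_lt_mul h4).1 (hD.trans_lt hE)
    rwa [mul_comm]
  · rw [codeEval, hD, hgate _ fun w => wiresInit_le_one (fun _ => Nat.zero_le _) w]
    have hr := foldl_gateStep_rename he gs hgs' (wiresInit (2 ^ m) y L D fun _ => 0)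
      (fun w => V w y) (fun w hw => by
        rw [hwire y _ _ ((hlt w hw).trans_le hcard), he.leftInvOn_invFunOn hw, hval w y hy])
      (τ out) ho
    rw [heo] at hr
    rw [hr]
    exact congrArg Bool.toNat (hfold y out).symm

/-- The blocks label disjoint sets of wires, so some block labels at most the average number. For
different outer parts only the constants on the remaining wires change. -/
theorem exists_goodBlock {n ℓ m L s : ℕ} (C : ComparatorCircuit n ℓ) (hm : 0 < m) (hmn : m ≤ n)
    (hL : ∀ a, a * (n / m) ≤ ℓ → a + 1 ≤ L)
    (hs : (4 * 2 ^ m) ^ L * (L * L) ^ (L * L) ≤ 2 ^ s) :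
    ∃ b, GoodBlock n m L s (fun x => C.eval (cubePoint n x)) b := by
  classical
  set A : ℕ → Finset (Fin ℓ) := fun b => Finset.univ.filter fun w => ((C.label w).1 : ℕ) / m = b
    with hA
  have hnb : 0 < n / m := Nat.div_pos hmn hm
  have hsum : ∑ b ∈ Finset.range (n / m), (A b).card ≤ ℓ := by
    rw [Finset.sum_card_fiberwise_eq_card_filter]
    exact (Finset.card_filter_le _ _).trans (by simp)
  obtain ⟨b, hb, hcard⟩ : ∃ b ∈ Finset.range (n / m), (A b).card * (n / m) ≤ ℓ := by
    refine Finset.exists_le_of_sum_le (Finset.nonempty_range_iff.2 hnb.ne') ?_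
    rw [← Finset.sum_mul, Finset.sum_const, Finset.card_range, smul_eq_mul, mul_comm]
    exact Nat.mul_le_mul_left _ hsum
  have hbn : (b + 1) * m ≤ n := (Nat.le_div_iff_mul_le hm).1 (Finset.mem_range.1 hb)
  have hmemA : ∀ w, w ∈ A b ↔ b * m ≤ (C.label w).1 ∧ ((C.label w).1 : ℕ) < (b + 1) * m := by
    intro w
    simp only [hA, Finset.mem_filter, Finset.mem_univ, true_and, Nat.div_eq_iff hm]
    have := Nat.succ_mul b m
    simp only [Nat.succ_eq_add_one] at this
    omega
  have hD := fun ρ : ℕ => exists_code (m := m) (A b) (hL _ hcard)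
    (fun w => (C.label w).1 - b * m) (fun w => (C.label w).2)
    -- The constant on a wire outside the block is read off `ρ`, where variables above the block sit
    -- `m` places lower.
    (fun w => if ((C.label w).1 : ℕ) < b * m
      then (if (C.label w).2 then ρ.testBit (C.label w).1 else !ρ.testBit (C.label w).1)
      else (if (C.label w).2 then ρ.testBit ((C.label w).1 - m)
        else !ρ.testBit ((C.label w).1 - m)))
    (fun w hw => by
      obtain ⟨h1, h2⟩ := (hmemA w).1 hw
      rw [add_mul] at h2
      omega) C.gates C.output
  choose D hD1 hD2 using hD
  refine ⟨b, hbn, D, fun ρ => (hD1 ρ).trans_le hs, fun x _ => ?_⟩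
  rw [hD2 _ (innerPart _ _ x) (Nat.mod_lt _ (by positivity))]
  refine congrArg Bool.toNat (congrFun (congrArg
    (fun v => C.gates.foldl applyComparator v) (funext fun w => ?_)) C.output)
  simp only [cubePoint, hmemA]
  rw [testBit_eq_parts m b x]
  split_ifs <;> first | rfl | omega

/-! ### The halving algorithm on all subfunctions -/

/-- The number `D` is consistent with the history `h`, a number whose digits in base `2 * M + 1` are
`2 * y + v + 1` for the points `y` with value `v`. -/
def Consistent (M L D h : ℕ) : Prop :=
  ∀ d ∈ Nat.digits (2 * M + 1) h, codeEval M L D ((d - 1) / 2) = (d - 1) % 2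

instance (M L D h : ℕ) : Decidable (Consistent M L D h) :=
  inferInstanceAs (Decidable (∀ d ∈ Nat.digits (2 * M + 1) h, _))

/-- The number of codes with `s` bits that are consistent with the history `h`. -/
def versionCount (M L s h : ℕ) : ℕ := ((Finset.range (2 ^ s)).filter (Consistent M L · h)).card

/-- The history `h` extended by the point `y` with value `v`. -/
def extendHistory (M h y v : ℕ) : ℕ := h * (2 * M + 1) + (2 * y + 1 + v)

/-- The majority vote at `y` after the history `h`. -/
def predict (M L s h y : ℕ) : Bool :=
  decide (versionCount M L s (extendHistory M h y 0) ≤ versionCount M L s (extendHistory M h y 1))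

/-! ### Version counts under extension of a history -/

section History

variable {M L s : ℕ}

/-- The shift by one keeps every digit non-zero, so no entry is lost even on top of the empty
history `0`; the base `2 * M + 1` leaves just enough room. -/
theorem digits_extendHistory {h y v : ℕ} (hy : y < M) (hv : v ≤ 1) :
    Nat.digits (2 * M + 1) (extendHistory M h y v) =
      (2 * y + 1 + v) :: Nat.digits (2 * M + 1) h := by
  rw [extendHistory, mul_comm h, add_comm (_ * h)]
  exact Nat.digits_add (2 * M + 1) (by omega) (2 * y + 1 + v) h (by omega) (Or.inl (by omega))

theorem consistent_extendHistory {D h y v : ℕ} (hy : y < M) (hv : v ≤ 1) :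
    Consistent M L D (extendHistory M h y v) ↔ codeEval M L D y = v ∧ Consistent M L D h := by
  have h1 : (2 * y + 1 + v - 1) / 2 = y := by omega
  have h2 : (2 * y + 1 + v - 1) % 2 = v := by omega
  rw [Consistent, digits_extendHistory hy hv, List.forall_mem_cons, h1, h2]
  rfl

theorem versionCount_extendHistory_add {h y : ℕ} (hy : y < M) :
    versionCount M L s (extendHistory M h y 0) + versionCount M L s (extendHistory M h y 1) =
      versionCount M L s h := by
  simp only [versionCount, consistent_extendHistory hy (zero_le_one),
    consistent_extendHistory hy le_rfl]
  rw [← Finset.card_union_of_disjoint]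
  · congr 1
    ext D
    have := codeEval_le_one M L D y
    simp only [Finset.mem_union, Finset.mem_filter]
    constructor
    · tauto
    · rintro ⟨h1, h2⟩
      rcases Nat.le_one_iff_eq_zero_or_eq_one.1 this with h | h <;> simp [h1, h2, h]
  · rw [Finset.disjoint_filter]
    rintro D - ⟨h1, -⟩ ⟨h2, -⟩
    omega

/-- The two possible answers split the consistent codes, and the vote names a larger part; a wrong
vote leaves the smaller one. -/
theorem two_mul_versionCount_le {h y : ℕ} (hy : y < M) :
    2 * versionCount M L s (extendHistory M h y (!predict M L s h y).toNat) ≤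
      versionCount M L s h := by
  rw [← versionCount_extendHistory_add hy (h := h)]
  by_cases hp : versionCount M L s (extendHistory M h y 0) ≤
    versionCount M L s (extendHistory M h y 1)
  · simp only [predict, hp, decide_true, Bool.not_true, Bool.toNat_false]; omega
  · simp only [predict, hp, decide_false, Bool.not_false, Bool.toNat_true]; omega

theorem versionCount_le (h : ℕ) : versionCount M L s h ≤ 2 ^ s :=
  (Finset.card_filter_le _ _).trans (by simp)

theorem versionCount_pos {D h : ℕ} (hD : D < 2 ^ s) (hc : Consistent M L D h) :
    0 < versionCount M L s h :=
  Finset.card_pos.2 ⟨D, by simp [hD, hc]⟩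

theorem consistent_zero (M L D : ℕ) : Consistent M L D 0 := by simp [Consistent]

end History

/-- The state of the learner: the current block and the histories of all subfunctions. -/
structure LearnState where
  block : ℕ
  hist : ℕ → ℕ

/-! ### The halving learner across the blocks: invariant and mistake bound -/

section Learn

variable (n m L s : ℕ)

/-- The history of the subfunction containing the point `x`. -/
def LearnState.histAt (σ : LearnState) (x : ℕ) : ℕ :=
  σ.hist (outerPart ((2 ^ m) ^ σ.block) (2 ^ m) x)

/-- The value of the current hypothesis at `x`. -/
def LearnState.value (σ : LearnState) (x : ℕ) : Bool :=
  predict (2 ^ m) L s (σ.histAt m x) (innerPart ((2 ^ m) ^ σ.block) (2 ^ m) x)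

/-- The new history of the subfunction containing the counterexample `x`. -/
def LearnState.newHist (σ : LearnState) (x : ℕ) : ℕ :=
  extendHistory (2 ^ m) (σ.histAt m x) (innerPart ((2 ^ m) ^ σ.block) (2 ^ m) x)
    (!σ.value m L s x).toNat

/-- The update of the learner on the counterexample `x`: when no code is left for the
subfunction, the learner proceeds to the next block. -/
def LearnState.next (σ : LearnState) (x : ℕ) : LearnState :=
  if versionCount (2 ^ m) L s (σ.newHist m L s x) = 0 then ⟨σ.block + 1, fun _ => 0⟩
  else ⟨σ.block,
    Function.update σ.hist (outerPart ((2 ^ m) ^ σ.block) (2 ^ m) x) (σ.newHist m L s x)⟩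

/-- The length of a history. -/
def historyLength (h : ℕ) : ℕ := (Nat.digits (2 * 2 ^ m + 1) h).length

/-- A bound for the number of mistakes still to come, if the block `b` is good. -/
def LearnState.potential (b : ℕ) (σ : LearnState) : ℕ :=
  (b - σ.block) * (2 ^ (n - m) * (s + 1)) +
    ∑ ρ ∈ Finset.range (2 ^ (n - m)), (s + 1 - historyLength m (σ.hist ρ))

/-- The invariant of the learner, if the subfunctions on the block `b` have the codes `D ρ`. -/
structure LearnState.Valid (b : ℕ) (D : ℕ → ℕ) (σ : LearnState) : Prop where
  block_le : σ.block ≤ b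
  count_pos : ∀ ρ, 0 < versionCount (2 ^ m) L s (σ.hist ρ)
  count_le : ∀ ρ, versionCount (2 ^ m) L s (σ.hist ρ) * 2 ^ historyLength m (σ.hist ρ) ≤ 2 ^ s
  consistent : σ.block = b → ∀ ρ, Consistent (2 ^ m) L (D ρ) (σ.hist ρ)

variable {n m L s} {b : ℕ} {D : ℕ → ℕ} {σ : LearnState}

theorem LearnState.valid_start (b₀ : ℕ) (h : b₀ ≤ b) (D : ℕ → ℕ) :
    LearnState.Valid m L s b D ⟨b₀, fun _ => 0⟩ where
  block_le := h
  count_pos _ := versionCount_pos (D := 0) (by positivity) (consistent_zero _ _ _)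
  count_le _ := by simpa [historyLength] using versionCount_le 0
  consistent _ _ := consistent_zero _ _ _

/-- At least one code survives although each entry has at least halved their number from `2 ^ s`. -/
theorem LearnState.Valid.historyLength_le (h : σ.Valid m L s b D) (ρ : ℕ) :
    historyLength m (σ.hist ρ) ≤ s := by
  have h1 := h.count_pos ρ
  have h2 := h.count_le ρ
  exact (Nat.pow_le_pow_iff_right one_lt_two).1 ((Nat.le_mul_of_pos_left _ h1).trans h2)

theorem LearnState.Valid.hist_lt (h : σ.Valid m L s b D) (ρ : ℕ) :
    σ.hist ρ < (2 * 2 ^ m + 1) ^ s := by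
  have hM : 0 < 2 ^ m := by positivity
  refine (Nat.lt_base_pow_length_digits (b := 2 * 2 ^ m + 1) (by omega)).trans_le ?_
  exact Nat.pow_le_pow_right (by omega) (h.historyLength_le ρ)

theorem innerPart_lt (p x : ℕ) : innerPart p (2 ^ m) x < 2 ^ m :=
  Nat.mod_lt _ (by positivity)

theorem extendHistory_lt {h y v : ℕ} (hh : h < (2 * 2 ^ m + 1) ^ s) (hy : y < 2 ^ m)
    (hv : v ≤ 1) : extendHistory (2 ^ m) h y v < (2 * 2 ^ m + 1) ^ (s + 1) := by
  rw [extendHistory, pow_succ]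
  nlinarith

theorem outerPart_lt {b x : ℕ} (hb : (b + 1) * m ≤ n) (hx : x < 2 ^ n) :
    outerPart ((2 ^ m) ^ b) (2 ^ m) x < 2 ^ (n - m) := by
  rw [add_mul, one_mul] at hb
  have e1 : (2 ^ m) ^ b = 2 ^ (b * m) := by rw [← pow_mul, mul_comm]
  have e2 : 2 ^ (n - m) = 2 ^ (b * m) * 2 ^ (n - m - b * m) := by
    rw [← pow_add]; congr 1; omega
  have e3 : 2 ^ n = 2 ^ (b * m) * 2 ^ m * 2 ^ (n - m - b * m) := by
    rw [← pow_add, ← pow_add]; congr 1; omega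
  have h1 : x / (2 ^ (b * m) * 2 ^ m) < 2 ^ (n - m - b * m) := by
    rw [Nat.div_lt_iff_lt_mul (by positivity), mul_comm, ← e3]
    exact hx
  have h2 : x % 2 ^ (b * m) < 2 ^ (b * m) := Nat.mod_lt _ (by positivity)
  have h3 := Nat.mul_le_mul_left (2 ^ (b * m)) (Nat.succ_le_of_lt h1)
  rw [Nat.mul_succ] at h3
  rw [outerPart, e1, e2]
  omega

theorem LearnState.value_eq_not {F : Bool} {x : ℕ} (hF : σ.value m L s x ≠ F) :
    (!σ.value m L s x) = F := by
  revert hF; cases σ.value m L s x <;> cases F <;> simp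

/-- On block `b` the true codes `D ρ` always remain consistent, so the learner cannot move past `b`.
A mistake either lengthens one history, lowering one summand of the potential, or moves on to the
next block, lowering the first term. -/
theorem LearnState.Valid.next (h : σ.Valid m L s b D) (hD : ∀ ρ, D ρ < 2 ^ s) {F : ℕ → Bool}
    (hb : (b + 1) * m ≤ n) (hDF : ∀ x < 2 ^ n, codeEval (2 ^ m) L
      (D (outerPart ((2 ^ m) ^ b) (2 ^ m) x)) (innerPart ((2 ^ m) ^ b) (2 ^ m) x) = (F x).toNat)
    {x : ℕ} (hx : x < 2 ^ n) (hF : σ.value m L s x ≠ F x) :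
    (σ.next m L s x).Valid m L s b D ∧
      (σ.next m L s x).potential n m s b < σ.potential n m s b := by
  have hy := innerPart_lt (m := m) ((2 ^ m) ^ σ.block) x
  have hv : (!σ.value m L s x).toNat ≤ 1 := Bool.toNat_le _
  have hlast : σ.block = b → Consistent (2 ^ m) L (D (outerPart ((2 ^ m) ^ σ.block) (2 ^ m) x))
      (σ.newHist m L s x) := fun hσ => by
    rw [newHist, consistent_extendHistory hy hv]
    refine ⟨?_, h.consistent hσ _⟩
    rw [hσ, hDF x hx, LearnState.value_eq_not hF]
  have hρ : outerPart ((2 ^ m) ^ σ.block) (2 ^ m) x < 2 ^ (n - m) :=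
    outerPart_lt ((Nat.mul_le_mul_right m (Nat.add_le_add_right h.block_le 1)).trans hb) hx
  unfold LearnState.next
  split_ifs with h0
  · have hlt : σ.block < b := lt_of_le_of_ne h.block_le fun hσ =>
      (versionCount_pos (hD _) (hlast hσ)).ne' h0
    refine ⟨valid_start _ hlt D, ?_⟩
    obtain ⟨k, hk⟩ : ∃ k, b = σ.block + 1 + k := ⟨b - σ.block - 1, by omega⟩
    have e1 : b - (σ.block + 1) = k := by omega
    have e2 : b - σ.block = k + 1 := by omega
    -- Moving on frees `2 ^ (n - m) * (s + 1)`, exactly the value of the reset sum; the decrease is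
    -- strict because the old sum was positive. Hence the bound `s + 1` per history instead of `s`.
    have hpos : 0 < ∑ ρ ∈ Finset.range (2 ^ (n - m)), (s + 1 - historyLength m (σ.hist ρ)) :=
      Finset.sum_pos (fun ρ _ => by have := h.historyLength_le ρ; omega)
        ⟨0, Finset.mem_range.2 (by positivity)⟩
    simp only [potential, e1, e2, historyLength, Nat.digits_zero, List.length_nil, Finset.sum_const,
      Finset.card_range, smul_eq_mul, Nat.sub_zero]
    simp only [historyLength] at hpos
    linarith
  · have hlen : historyLength m (σ.newHist m L s x) = historyLength m (σ.histAt m x) + 1 := by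
      rw [historyLength, newHist, digits_extendHistory hy hv]; rfl
    have h2 := two_mul_versionCount_le (L := L) (s := s) (h := σ.histAt m x) hy
    refine ⟨⟨h.block_le, fun ρ => ?_, fun ρ => ?_, fun hσ ρ => ?_⟩, ?_⟩
    · dsimp only
      rw [Function.update_apply]
      split_ifs
      exacts [Nat.pos_of_ne_zero h0, h.count_pos ρ]
    · dsimp only
      rw [Function.update_apply]
      split_ifs
      · rw [hlen, pow_succ']
        refine le_trans ?_ (h.count_le (outerPart ((2 ^ m) ^ σ.block) (2 ^ m) x))
        rw [← mul_assoc, mul_comm _ 2]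
        exact Nat.mul_le_mul_right _ h2
      · exact h.count_le ρ
    · dsimp only at hσ ⊢
      rw [Function.update_apply]
      split_ifs with hρ'
      · rw [hρ']; exact hlast hσ
      · exact h.consistent hσ ρ
    · refine Nat.add_lt_add_left (Finset.sum_lt_sum (fun ρ _ => ?_)
        ⟨_, Finset.mem_range.2 hρ, ?_⟩) _
      · dsimp only
        rw [Function.update_apply]
        split_ifs with hρ'
        · rw [hlen, hρ']; exact Nat.sub_le_sub_left (Nat.le_succ _) _
        · exact le_rfl
      · dsimp only
        rw [Function.update_self, hlen]
        have := h.historyLength_le (outerPart ((2 ^ m) ^ σ.block) (2 ^ m) x)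
        rw [histAt]
        omega

theorem LearnState.potential_start_le (hm : 0 < m) (hb : (b + 1) * m ≤ n) :
    LearnState.potential n m s b ⟨0, fun _ => 0⟩ ≤ n * (2 ^ (n - m) * (s + 1)) := by
  have h1 : b + 1 ≤ n := (Nat.le_mul_of_pos_right _ hm).trans hb
  have h2 : LearnState.potential n m s b ⟨0, fun _ => 0⟩ = (b + 1) * (2 ^ (n - m) * (s + 1)) := by
    simp only [potential, historyLength, Nat.digits_zero, List.length_nil, Finset.sum_const,
      Finset.card_range, smul_eq_mul, Nat.sub_zero]
    ring
  rw [h2]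
  exact Nat.mul_le_mul_right _ h1

end Learn

/-! ### Programs computing the table of version counts

The memory is divided into the cells `0, …, 31`, the table of version counts (`32 + 3 * i`),
the histories (`33 + 3 * i`) and the wires (`34 + 3 * i`). The parameters `M`, `L`, `2 ^ s` and
the size of the table are in the cells `5`, `6`, `8`, `9`. -/

instance : Add RamExpr := ⟨.arith .add⟩
instance : Sub RamExpr := ⟨.arith .sub⟩
instance : Mul RamExpr := ⟨.arith .mul⟩
instance : Div RamExpr := ⟨.arith .div⟩
instance : Mod RamExpr := ⟨.arith .mod⟩

/-- Constants. -/
abbrev num (c : ℕ) : RamExpr := .lit c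

/-- The content of the cell `i`. -/
def reg (i : ℕ) : RamExpr := .cell (.lit i)

/-- The address of an entry of the table of version counts. -/
def countAddr (e : RamExpr) : RamExpr := num 32 + num 3 * e

/-- The address of a history. -/
def histAddr (e : RamExpr) : RamExpr := num 33 + num 3 * e

/-- The address of a wire. -/
def wireAddr (e : RamExpr) : RamExpr := num 34 + num 3 * e

section Val

variable (m : Memory) (a b : RamExpr)

@[simp] theorem RamExpr.val_lit (c : ℕ) : (RamExpr.lit c).val m = c := rfl
@[simp] theorem RamExpr.val_reg (i : ℕ) : (reg i).val m = m i := rfl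
@[simp] theorem RamExpr.val_cell : (RamExpr.cell a).val m = m (a.val m) := rfl
@[simp] theorem RamExpr.val_add : (a + b).val m = a.val m + b.val m := rfl
@[simp] theorem RamExpr.val_sub : (a - b).val m = a.val m - b.val m := rfl
@[simp] theorem RamExpr.val_mul : (a * b).val m = a.val m * b.val m := rfl
@[simp] theorem RamExpr.val_div : (a / b).val m = a.val m / b.val m := rfl
@[simp] theorem RamExpr.val_mod : (a % b).val m = a.val m % b.val m := rfl
@[simp] theorem RamExpr.val_countAddr : (countAddr a).val m = 32 + 3 * a.val m := rfl
@[simp] theorem RamExpr.val_histAddr : (histAddr a).val m = 33 + 3 * a.val m := rfl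
@[simp] theorem RamExpr.val_wireAddr : (wireAddr a).val m = 34 + 3 * a.val m := rfl

end Val

/-- Cell `16` holds the unread part of the code, cell `17` the number of wires still to be set and
cell `18` the point. -/
def labelBody : List (RamExpr × RamExpr) :=
  [(num 17, reg 17 - num 1),
   (wireAddr (reg 17),
      (reg 18 / (reg 16 % (num 4 * reg 5) / num 2) + reg 16 % (num 4 * reg 5) % num 2) % num 2),
   (num 16, reg 16 / (num 4 * reg 5))]

/-- Both wires are copied to the cells `22` and `23` before either is overwritten; if they coincide,
the second write wins, as in `gateStep`. -/
def gateBody : List (RamExpr × RamExpr) :=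
  [(num 17, reg 17 - num 1), (num 20, reg 16 % reg 6), (num 16, reg 16 / reg 6), (num 21, reg 16 % reg 6),
   (num 16, reg 16 / reg 6), (num 22, .cell (wireAddr (reg 20))), (num 23, .cell (wireAddr (reg 21))),
   (wireAddr (reg 20), reg 22 * reg 23),
   (wireAddr (reg 21), reg 22 + reg 23 - reg 22 * reg 23)]

section Address

variable {k c d : ℕ}

theorem eq_wire_false (h : k < 32) : (k = 34 + 3 * c) = False := by simp; omega
theorem wire_eq_false (h : k < 32) : (34 + 3 * c = k) = False := by simp; omega

end Address

/-! ### Decoding and running a coded circuit -/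

section Table

variable {Op E : Type} {ext : Op → Memory × E → Memory × E → ℕ → Prop} {β : ℕ}

/-- The loop invariant says that the remaining iterations of `wiresInit` lead to the same final
wires as the whole run. `V` is compared with the memory only from wire `t` on, so leftovers of an
earlier evaluation do no harm. Addresses of wires are `1` modulo `3`; other cells from `32` on are
untouched. -/
theorem exec_labels {m : Memory} {M L t : ℕ} (hm : m.Bounded β) (hβ : 0 < β) (h5 : m 5 = M)
    (h17 : m 17 = t) (V : ℕ → ℕ) (hV : ∀ w, t ≤ w → w < L → m (34 + 3 * w) = V w) :
    Exec ext β (.loop (reg 17) (.block labelBody)) m ((t + 1) * 1000) fun m' =>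
      (∀ w < L, m' (34 + 3 * w) = wiresInit M (m 18) t (m 16) V w) ∧
      m' 16 = m 16 / (4 * M) ^ t ∧
      ∀ i, i ≠ 16 → i ≠ 17 → (i < 32 ∨ i % 3 ≠ 1) → m' i = m i := by
  have h2 : 1 < 2 ^ β := Nat.one_lt_two_pow hβ.ne'
  have key := Exec.loop (ext := ext) (β := β) (e := reg 17) (p := .block labelBody)
    (τ := blockWeight labelBody)
    (I := fun c m' => m' 17 = c ∧
      (∀ i, i ≠ 16 → i ≠ 17 → (i < 32 ∨ i % 3 ≠ 1) → m' i = m i) ∧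
      ∃ V', (∀ w, c ≤ w → w < L → m' (34 + 3 * w) = V' w) ∧
        wiresInit M (m 18) c (m' 16) V' = wiresInit M (m 18) t (m 16) V ∧
        m' 16 / (4 * M) ^ c = m 16 / (4 * M) ^ t)
    (fun m' h => h.1) (fun c m' h => by simp [h.1]) (fun c m' hb h => by
      obtain ⟨hc, hF, V', hw, he, hd⟩ := h
      have e5 : m' 5 = M := (hF 5 (by omega) (by omega) (by omega)).trans h5
      have e18 : m' 18 = m 18 := hF 18 (by omega) (by omega) (by omega)
      have b17 := hb 17
      have b16 := hb 16
      refine Exec.block hb ?_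
      simp [labelBody, BlockPost, Function.update_apply, hc, e5, e18, eq_wire_false, wire_eq_false]
      refine ⟨by omega, (Nat.le_of_lt_succ (Nat.mod_lt _ two_pos)).trans_lt h2,
        (Nat.div_le_self _ _).trans_lt b16, fun i h16 h17 h => ?_,
        Function.update V' c (litVal (m' 16 % (4 * M)) (m 18)), fun w hcw hwL => ?_, ?_, ?_⟩
      · rw [if_neg h16, if_neg (by omega), if_neg h17]
        exact hF i h16 h17 h
      · rw [Function.update_apply]
        split_ifs
        · simp [litVal]
        · exact hw w (by omega) hwL
      · rw [← he]; rfl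
      · rw [← hd, Nat.div_div_eq_div_mul, pow_succ'])
  refine (key t m hm ⟨h17, fun _ _ _ _ => rfl, V, hV, rfl, rfl⟩).mono
    (Nat.mul_le_mul_left _ (by decide)) fun m' _ h => ?_
  obtain ⟨-, hF, V', hw, he, hd⟩ := h
  exact ⟨fun w hw' => by rw [hw w (Nat.zero_le _) hw', ← he]; rfl, by simpa using hd, hF⟩

theorem exec_gates {m : Memory} {L t : ℕ} (hm : m.Bounded β) (hβ : 0 < β) (h6 : m 6 = L)
    (hL : 0 < L) (h17 : m 17 = t) (V : ℕ → ℕ) (hV : ∀ w < L, m (34 + 3 * w) = V w)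
    (hV1 : ∀ w, V w ≤ 1) :
    Exec ext β (.loop (reg 17) (.block gateBody)) m ((t + 1) * 1000) fun m' =>
      (∀ w < L, m' (34 + 3 * w) = gateRun L t (m 16) V w) ∧
      ∀ i, (i < 16 ∨ i = 18 ∨ i = 19 ∨ 24 ≤ i) → (i < 32 ∨ i % 3 ≠ 1) → m' i = m i := by
  have h2 : 1 < 2 ^ β := Nat.one_lt_two_pow hβ.ne'
  have key := Exec.loop (ext := ext) (β := β) (e := reg 17) (p := .block gateBody)
    (τ := blockWeight gateBody)
    (I := fun c m' => m' 17 = c ∧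
      (∀ i, (i < 16 ∨ i = 18 ∨ i = 19 ∨ 24 ≤ i) → (i < 32 ∨ i % 3 ≠ 1) → m' i = m i) ∧
      ∃ V', (∀ w < L, m' (34 + 3 * w) = V' w) ∧ (∀ w, V' w ≤ 1) ∧
        gateRun L c (m' 16) V' = gateRun L t (m 16) V)
    (fun m' h => h.1) (fun c m' h => by simp [h.1]) (fun c m' hb h => by
      obtain ⟨hc, hF, V', hw, hV1', he⟩ := h
      have e6 : m' 6 = L := (hF 6 (by omega) (by omega)).trans h6
      have b17 := hb 17
      have b16 := hb 16
      have bi : m' 16 % L < L := Nat.mod_lt _ hL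
      have bj : m' 16 / L % L < L := Nat.mod_lt _ hL
      have v1 := hV1' (m' 16 % L)
      have v2 := hV1' (m' 16 / L % L)
      have le_one : ∀ {x y : ℕ}, x ≤ 1 → y ≤ 1 → x * y ≤ 1 ∧ x + y - x * y ≤ 1 := by
        intro x y hx hy
        interval_cases x <;> interval_cases y <;> simp
      refine Exec.block hb ?_
      simp [gateBody, BlockPost, Function.update_apply, hc, e6, eq_wire_false, wire_eq_false,
        hw _ bi, hw _ bj]
      refine ⟨by omega, (Nat.mod_le _ _).trans_lt b16, (Nat.div_le_self _ _).trans_lt b16,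
        (Nat.mod_le _ _).trans_lt ((Nat.div_le_self _ _).trans_lt b16),
        (Nat.div_le_self _ _).trans_lt ((Nat.div_le_self _ _).trans_lt b16),
        by omega, by omega, (le_one v1 v2).1.trans_lt h2, (le_one v1 v2).2.trans_lt h2,
        fun i h h' => ?_, gateStep V' (m' 16 % L) (m' 16 / L % L), fun w hwL => ?_,
        fun w => gateStep_le_one hV1' _ _ w, ?_⟩
      · repeat rw [if_neg (by omega)]
        exact hF i h h'
      · simp only [gateStep, Function.update_apply]
        split_ifs
        · rfl
        · rfl
        · exact hw w hwL
      · rw [← he]; rfl)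
  refine (key t m hm ⟨h17, fun _ _ _ => rfl, V, hV, hV1, rfl⟩).mono
    (Nat.mul_le_mul_left _ (by decide)) fun m' _ h => ?_
  obtain ⟨-, hF, V', hw, -, he⟩ := h
  exact ⟨fun w hw' => by rw [hw w hw', ← he]; rfl, hF⟩

end Table

/-- The lowest digit minus one is `2 * y + v`; the point `y` goes to cell `18` and the recorded
value `v` to cell `19`. -/
def digitStart : List (RamExpr × RamExpr) :=
  [(num 18, (reg 14 % (num 2 * reg 5 + num 1) - num 1) / num 2),
   (num 19, (reg 14 % (num 2 * reg 5 + num 1) - num 1) % num 2),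
   (num 14, reg 14 / (num 2 * reg 5 + num 1)), (num 16, reg 12), (num 17, reg 6)]

section Programs

variable (Op : Type)

/-- Check the lowest digit of the history in cell `14` against the code in cell `12`. -/
def digitProg : RamProg Op :=
  .seq (.block digitStart) (.seq (.loop (reg 17) (.block labelBody))
    (.seq (.block [(num 17, reg 6 * reg 6)]) (.seq (.loop (reg 17) (.block gateBody))
      (.block [(num 15, reg 15 * (num 1 - (.cell (num 34) + reg 19) % num 2))]))))

/-- Add one to cell `13` if the next code is consistent with the history in cell `11`. -/
def codeProg : RamProg Op :=
  .seq (.block [(num 12, reg 12 - num 1), (num 14, reg 11), (num 15, num 1)])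
    (.seq (.loop (reg 14) (digitProg Op)) (.block [(num 13, reg 13 + reg 15)]))

/-- Compute the next entry of the table of version counts. -/
def entryProg : RamProg Op :=
  .seq (.block [(num 11, reg 11 - num 1), (num 13, num 0), (num 12, reg 8)])
    (.seq (.loop (reg 12) (codeProg Op)) (.block [(countAddr (reg 11), reg 13)]))

end Programs

/-- This and the next two bounds are in units of `β + 1`; the constants are generous bounds for the
weights of the blocks of assignments. -/
def digitTime (L : ℕ) : ℕ := 5000 + (L + 1) * 1000 + (L * L + 1) * 1000

def codeTime (L s : ℕ) : ℕ := 1000 + (s + 2) * (digitTime L + 100)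

def entryTime (L s : ℕ) : ℕ := 1000 + (2 ^ s + 1) * (codeTime L s + 100)

/-! ### Counting the codes consistent with each history -/

section Table

variable {Op E : Type} {ext : Op → Memory × E → Memory × E → ℕ → Prop} {β : ℕ}

theorem exec_digit {m : Memory} {M L : ℕ} (hm : m.Bounded β) (hβ : 0 < β) (h5 : m 5 = M)
    (h6 : m 6 = L) (hL : 0 < L) (hLβ : L * L < 2 ^ β) (h15 : m 15 ≤ 1) :
    Exec ext β (digitProg Op) m (digitTime L) fun m' =>
      m' 14 = m 14 / (2 * M + 1) ∧ m' 15 ≤ 1 ∧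
      (m' 15 = 1 ↔ m 15 = 1 ∧ codeEval M L (m 12) ((m 14 % (2 * M + 1) - 1) / 2) =
        (m 14 % (2 * M + 1) - 1) % 2) ∧
      ∀ i, (i < 14 ∨ 24 ≤ i) → (i < 32 ∨ i % 3 ≠ 1) → m' i = m i := by
  have h2 : 1 < 2 ^ β := Nat.one_lt_two_pow hβ.ne'
  refine Exec.mono (τ := blockWeight digitStart + ((L + 1) * 1000 + (100 +
    ((L * L + 1) * 1000 + 1000)))) ?_ ?_ (fun _ _ h => h)
  swap
  · have : blockWeight digitStart ≤ 3000 := by decide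
    rw [digitTime]; omega
  set d := m 14 % (2 * M + 1) - 1 with hd
  have hdβ : d < 2 ^ β := ((Nat.sub_le _ _).trans (Nat.mod_le _ _)).trans_lt (hm 14)
  refine Exec.seq (Q := fun m' => m' 18 = d / 2 ∧ m' 19 = d % 2 ∧ m' 14 = m 14 / (2 * M + 1) ∧
      m' 16 = m 12 ∧ m' 17 = L ∧
      ∀ i, (i < 14 ∨ i = 15 ∨ 24 ≤ i) → m' i = m i) (Exec.block hm ?_) fun m1 hm1 h1 => ?_
  · have b14 := hm 14
    have b12 := hm 12
    have b6 := hm 6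
    simp [digitStart, BlockPost, Function.update_apply, h5, h6, ← hd]
    refine ⟨(Nat.div_le_self _ _).trans_lt hdβ, (Nat.mod_le _ _).trans_lt hdβ,
        (Nat.div_le_self _ _).trans_lt b14, b12, by omega, fun i h => ?_⟩
    repeat rw [if_neg (by omega)]
  obtain ⟨h18, h19, h14, h16, h17, hF1⟩ := h1
  refine Exec.seq (exec_labels (M := M) (L := L) hm1 hβ ((hF1 5 (by omega)).trans h5) h17
    (fun _ => 0) fun w hw hw' => absurd hw' (by omega)) fun m2 hm2 h2' => ?_
  obtain ⟨hw2, h16', hF2⟩ := h2'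
  rw [h18, h16] at hw2
  rw [h16] at h16'
  refine Exec.seq (Q := fun m' => m' 17 = L * L ∧ ∀ i, i ≠ 17 → m' i = m2 i)
    (Exec.mono (Exec.block hm2 ?_) (by decide) fun _ _ h => h) fun m3 hm3 h3 => ?_
  · have e6 : m2 6 = L := by
      rw [hF2 6 (by omega) (by omega) (by omega), hF1 6 (by omega), h6]
    simp [BlockPost, e6, Function.update_apply, hLβ]
    intro i h h'
    exact absurd h' h
  obtain ⟨h17', hF3⟩ := h3
  refine Exec.seq (exec_gates (L := L) hm3 hβ ?_ hL h17' (wiresInit M (d / 2) L (m 12) fun _ => 0)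
    (fun w hw => ?_) fun w => wiresInit_le_one (fun _ => Nat.zero_le _) w) fun m4 hm4 h4 => ?_
  · rw [hF3 6 (by omega), hF2 6 (by omega) (by omega) (by omega), hF1 6 (by omega), h6]
  · rw [hF3 _ (by omega), hw2 w hw]
  obtain ⟨hw4, hF4⟩ := h4
  have e0 : m4 34 = codeEval M L (m 12) (d / 2) := by
    rw [hF3 16 (by omega), h16'] at hw4
    exact hw4 0 hL
  have e19 : m4 19 = d % 2 := by
    rw [hF4 19 (by omega) (by omega), hF3 19 (by omega),
      hF2 19 (by omega) (by omega) (by omega), h19]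
  have e14 : m4 14 = m 14 / (2 * M + 1) := by
    rw [hF4 14 (by omega) (by omega), hF3 14 (by omega),
      hF2 14 (by omega) (by omega) (by omega), h14]
  have hF : ∀ i, (i < 14 ∨ i = 15 ∨ 24 ≤ i) → (i < 32 ∨ i % 3 ≠ 1) → m4 i = m i := by
    intro i h h'
    rw [hF4 i (by omega) h', hF3 i (by omega), hF2 i (by omega) (by omega) h', hF1 i h]
  have e15 := hF 15 (by omega) (by omega)
  refine Exec.mono (Exec.block hm4 ?_) (by decide) fun _ _ h => h
  have hc := codeEval_le_one M L (m 12) (d / 2)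
  have hd2 : d % 2 ≤ 1 := Nat.le_of_lt_succ (Nat.mod_lt _ two_pos)
  simp only [BlockPost, RamExpr.val_mul, RamExpr.val_sub, RamExpr.val_mod, RamExpr.val_add,
    RamExpr.val_cell, RamExpr.val_lit, RamExpr.val_reg, e0, e19, e15, Function.update_self]
  -- On bits, one minus the sum modulo two tests equality, and the product with cell `15` is the
  -- conjunction with the earlier tests.
  have hv : (m 15 * (1 - (codeEval M L (m 12) (d / 2) + d % 2) % 2) ≤ 1) ∧
      (m 15 * (1 - (codeEval M L (m 12) (d / 2) + d % 2) % 2) = 1 ↔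
        m 15 = 1 ∧ codeEval M L (m 12) (d / 2) = d % 2) := by
    generalize codeEval M L (m 12) (d / 2) = c at hc ⊢
    generalize d % 2 = v at hd2 ⊢
    generalize m 15 = o at h15 ⊢
    interval_cases c <;> interval_cases v <;> interval_cases o <;> simp
  refine ⟨hv.1.trans_lt h2, ?_, hv.1, hv.2, fun i h h' => ?_⟩
  · simpa using e14
  · rw [Function.update_of_ne (by omega), hF i (by omega) h']

theorem exec_code {m : Memory} {M L s : ℕ} (hm : m.Bounded β) (hβ : 0 < β) (h5 : m 5 = M)
    (hM : 0 < M) (h6 : m 6 = L) (hL : 0 < L) (hLβ : L * L < 2 ^ β)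
    (h11 : m 11 < (2 * M + 1) ^ (s + 1)) (h13 : m 13 + 1 < 2 ^ β) :
    Exec ext β (codeProg Op) m (codeTime L s) fun m' =>
      m' 12 = m 12 - 1 ∧
      m' 13 = m 13 + (if Consistent M L (m 12 - 1) (m 11) then 1 else 0) ∧
      ∀ i, (i < 12 ∨ 24 ≤ i) → (i < 32 ∨ i % 3 ≠ 1) → m' i = m i := by
  have h2 : 1 < 2 ^ β := Nat.one_lt_two_pow hβ.ne'
  refine Exec.mono (τ := 500 + ((s + 2) * (digitTime L + 100) + 500)) ?_
    (by rw [codeTime]; omega) (fun _ _ h => h)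
  refine Exec.seq (Q := fun m' => m' 12 = m 12 - 1 ∧ m' 14 = m 11 ∧ m' 15 = 1 ∧
      ∀ i, (i ≠ 12 ∧ i ≠ 14 ∧ i ≠ 15) → m' i = m i)
    (Exec.mono (Exec.block hm ?_) (by decide) fun _ _ h => h) fun m1 hm1 h1 => ?_
  · have b11 := hm 11
    have b12 := hm 12
    simp [BlockPost, Function.update_apply]
    refine ⟨by omega, by omega, by omega, fun i h h' h'' => ?_⟩
    repeat rw [if_neg (by omega)]
  obtain ⟨h12, h14, h15, hF1⟩ := h1
  -- The remaining iterations are the remaining digits of the history, at most `s + 1` by the bound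
  -- on cell `11`. The flag together with consistency of the unread digits is equivalent to
  -- consistency of the whole history.
  have key := Exec.loop (ext := ext) (β := β) (e := reg 14) (p := digitProg Op)
    (τ := digitTime L)
    (I := fun c m' => (Nat.digits (2 * M + 1) (m' 14)).length = c ∧ m' 15 ≤ 1 ∧
      (m' 15 = 1 ∧ Consistent M L (m 12 - 1) (m' 14) ↔ Consistent M L (m 12 - 1) (m 11)) ∧
      ∀ i, (i < 14 ∨ 24 ≤ i) → (i < 32 ∨ i % 3 ≠ 1) → m' i = m1 i)
    (fun m' h => Nat.digits_eq_nil_iff_eq_zero.1 (List.length_eq_zero_iff.1 h.1)) (fun c m' h => by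
      intro h0
      rw [RamExpr.val_reg] at h0
      simp [h0] at h) (fun c m' hb h => by
      obtain ⟨hc, h15', hC, hF⟩ := h
      refine (exec_digit (M := M) (L := L) hb hβ ?_ ?_ hL hLβ h15').mono le_rfl
        fun m'' hb' h' => ?_
      · rw [hF 5 (by omega) (by omega), hF1 5 (by omega), h5]
      · rw [hF 6 (by omega) (by omega), hF1 6 (by omega), h6]
      obtain ⟨k1, k2, k3, k4⟩ := h'
      have hpos : 0 < m' 14 := by
        rcases Nat.eq_zero_or_pos (m' 14) with h0 | h0
        · simp [h0] at hc
        · exact h0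
      have hdig := Nat.digits_def' (b := 2 * M + 1) (by omega) hpos
      have e12 : m' 12 = m 12 - 1 := by rw [hF 12 (by omega) (by omega), h12]
      refine ⟨?_, k2, ?_, fun i h h' => by rw [k4 i h h', hF i h h']⟩
      · rw [hdig, List.length_cons] at hc
        rw [k1]
        omega
      · rw [← hC, k3, k1, Consistent, Consistent, hdig, List.forall_mem_cons, e12]
        tauto)
  refine Exec.seq (Q := fun m' => m' 15 = (if Consistent M L (m 12 - 1) (m 11) then 1 else 0) ∧
      ∀ i, (i < 14 ∨ 24 ≤ i) → (i < 32 ∨ i % 3 ≠ 1) → m' i = m1 i)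
    (Exec.mono (key _ m1 hm1 ⟨rfl, h15.le, by simp [h15, h14], fun _ _ _ => rfl⟩) ?_
      fun m' _ h => ?_) fun m2 hm2 h2' => ?_
  · refine Nat.mul_le_mul ?_ ?_
    · rw [h14]
      have := (Nat.digits_length_le_iff (b := 2 * M + 1) (k := s + 1) (by omega) (m 11)).2 h11
      omega
    · have : (reg 14).weight + 1 ≤ 100 := by decide
      omega
  · obtain ⟨k1, k2, k3, k4⟩ := h
    have h0 : m' 14 = 0 := Nat.digits_eq_nil_iff_eq_zero.1 (List.length_eq_zero_iff.1 k1)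
    rw [h0] at k3
    have := consistent_zero M L (m 12 - 1)
    refine ⟨?_, k4⟩
    split_ifs with hC
    · tauto
    · have : m' 15 ≠ 1 := by tauto
      omega
  obtain ⟨k1, k2⟩ := h2'
  have e13 : m2 13 = m 13 := by rw [k2 13 (by omega) (by omega), hF1 13 (by omega)]
  refine Exec.mono (Exec.block hm2 ?_) (by decide) fun _ _ h => h
  simp only [BlockPost, RamExpr.val_add, RamExpr.val_lit, RamExpr.val_reg, k1, e13,
    Function.update_self]
  refine ⟨?_, ?_, trivial, fun i h h' => ?_⟩
  · split_ifs <;> omega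
  · rw [Function.update_of_ne (by omega), k2 12 (by omega) (by omega), h12]
  · rw [Function.update_of_ne (by omega), k2 i (by omega) h', hF1 i (by omega)]

theorem exec_entry {m : Memory} {M L s : ℕ} (hm : m.Bounded β) (hsβ : 2 ^ s + 1 < 2 ^ β)
    (h5 : m 5 = M) (hM : 0 < M) (h6 : m 6 = L) (hL : 0 < L) (hLβ : L * L < 2 ^ β)
    (h8 : m 8 = 2 ^ s) (h11 : m 11 ≤ (2 * M + 1) ^ (s + 1)) (h11' : m 11 ≠ 0) :
    Exec ext β (entryProg Op) m (entryTime L s) fun m' =>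
      m' 11 = m 11 - 1 ∧ m' (32 + 3 * (m 11 - 1)) = versionCount M L s (m 11 - 1) ∧
      ∀ i, (i < 11 ∨ 24 ≤ i) → (i < 32 ∨ i % 3 ≠ 1) → i ≠ 32 + 3 * (m 11 - 1) → m' i = m i := by
  have hβ : 0 < β := by
    rcases Nat.eq_zero_or_pos β with rfl | h
    · have : 0 < 2 ^ s := by positivity
      omega
    · exact h
  have h2 : 1 < 2 ^ β := Nat.one_lt_two_pow hβ.ne'
  refine Exec.mono (τ := 500 + ((2 ^ s + 1) * (codeTime L s + 100) + 500)) ?_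
    (by rw [entryTime]; omega) (fun _ _ h => h)
  refine Exec.seq (Q := fun m' => m' 11 = m 11 - 1 ∧ m' 13 = 0 ∧ m' 12 = 2 ^ s ∧
      ∀ i, (i ≠ 11 ∧ i ≠ 12 ∧ i ≠ 13) → m' i = m i)
    (Exec.mono (Exec.block hm ?_) (by decide) fun _ _ h => h) fun m1 hm1 h1 => ?_
  · have b11 := hm 11
    simp [BlockPost, Function.update_apply, h8]
    refine ⟨by omega, by omega, fun i h h' h'' => ?_⟩
    repeat rw [if_neg (by omega)]
  obtain ⟨k11, k13, k12, hF1⟩ := h1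
  -- Codes are tried downwards: those already counted plus the consistent ones below `c` always make
  -- up the version count. This also keeps cell `13` bounded.
  have key := Exec.loop (ext := ext) (β := β) (e := reg 12) (p := codeProg Op)
    (τ := codeTime L s)
    (I := fun c m' => m' 12 = c ∧ m' 13 +
        ((Finset.range c).filter (Consistent M L · (m 11 - 1))).card =
          versionCount M L s (m 11 - 1) ∧
      ∀ i, (i < 12 ∨ 24 ≤ i) → (i < 32 ∨ i % 3 ≠ 1) → m' i = m1 i)
    (fun m' h => h.1) (fun c m' h => by simp [h.1]) (fun c m' hb h => by
      obtain ⟨hc, hN, hF⟩ := h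
      have e11 : m' 11 = m 11 - 1 := by rw [hF 11 (by omega) (by omega), k11]
      rw [Finset.range_add_one, Finset.filter_insert] at hN
      by_cases hC : Consistent M L c (m 11 - 1)
      all_goals
        simp only [hC, if_true, if_false] at hN
        refine (exec_code (M := M) (L := L) (s := s) hb hβ ?_ hM ?_ hL hLβ ?_ ?_).mono le_rfl
          fun m'' hb' h' => ?_
        · rw [hF 5 (by omega) (by omega), hF1 5 (by omega), h5]
        · rw [hF 6 (by omega) (by omega), hF1 6 (by omega), h6]
        · omega
        · have := versionCount_le (M := M) (L := L) (s := s) (m 11 - 1)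
          omega
        obtain ⟨l1, l2, l3⟩ := h'
        rw [hc, Nat.add_sub_cancel] at l1
        rw [hc, Nat.add_sub_cancel, e11] at l2
        simp only [hC, if_true, if_false] at l2
        refine ⟨l1, ?_, fun i h h' => by rw [l3 i h h', hF i h h']⟩
        try rw [Finset.card_insert_of_notMem (by simp)] at hN
        omega)
  refine Exec.seq (Exec.mono (key (2 ^ s) m1 hm1 ⟨k12, by rw [k13, versionCount, zero_add],
      fun _ _ _ => rfl⟩) (Nat.mul_le_mul_left _ ?_) fun m' _ h => h) fun m2 hm2 h2' => ?_
  · have : (reg 12).weight + 1 ≤ 100 := by decide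
    omega
  obtain ⟨-, l2, l3⟩ := h2'
  have e11 : m2 11 = m 11 - 1 := by rw [l3 11 (by omega) (by omega), k11]
  have e13 : m2 13 = versionCount M L s (m 11 - 1) := by simpa using l2
  refine Exec.mono (Exec.block hm2 ?_) (by decide) fun _ _ h => h
  simp only [BlockPost, RamExpr.val_countAddr, RamExpr.val_reg, e11, e13, Function.update_self]
  refine ⟨(versionCount_le _).trans_lt (by omega), ?_, trivial, fun i h h' h'' => ?_⟩
  · rw [Function.update_of_ne (by omega), e11]
  · rw [Function.update_of_ne h'', l3 i (by omega) h', hF1 i (by omega)]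

end Table

/-- Powers with a constant exponent. -/
def powExpr (e : RamExpr) : ℕ → RamExpr
  | 0 => num 1
  | k + 1 => powExpr e k * e

@[simp] theorem val_powExpr (m : Memory) (e : RamExpr) (k : ℕ) :
    (powExpr e k).val m = e.val m ^ k := by
  induction k with
  | zero => rfl
  | succ k ih => rw [powExpr, RamExpr.val_mul, ih, pow_succ]

/-- The number of variables of the circuits on a block is the largest `m` for which
`m ^ (2 * t + 3) ≤ n`. -/
def rootCond (t : ℕ) : RamExpr := reg 3 + num 1 - powExpr (reg 4 + num 1) (2 * t + 3)

def rootBody : List (RamExpr × RamExpr) := [(num 4, reg 4 + num 1), (num 5, reg 5 * num 2)]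

def paramBody (t : ℕ) : List (RamExpr × RamExpr) :=
  [(num 6, powExpr (num 2 * reg 4) t + num 1), (num 7, num (2 * t + 5) * reg 4 * reg 6 * reg 6),
   (num 8, num 1), (num 9, num 2 * reg 5 + num 1), (num 10, reg 7)]

def sizeBody : List (RamExpr × RamExpr) :=
  [(num 8, reg 8 * num 2), (num 9, reg 9 * (num 2 * reg 5 + num 1)), (num 10, reg 10 - num 1)]

/-- Compute the parameters and the table of version counts, for the input `n` in cell `0`. -/
def setupProg (Op : Type) (t : ℕ) : RamProg Op :=
  .seq (.block [(num 3, reg 0), (num 4, num 0), (num 5, num 1)])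
    (.seq (.loop (rootCond t) (.block rootBody))
      (.seq (.block (paramBody t))
        (.seq (.loop (reg 10) (.block sizeBody))
          (.seq (.block [(num 11, reg 9)])
            (.seq (.loop (reg 11) (entryProg Op)) (.block [(num 24, num 1), (num 25, num 0)]))))))

/-- The parameters of the learner: the block length `m`, the number `L` of wires and the number
`s` of bits of a code; `β` bounds the numbers in the memory. -/
structure Params (t n m L s β : ℕ) : Prop where
  n_pos : 0 < n
  root_le : m ^ (2 * t + 3) ≤ n
  lt_root : n < (m + 1) ^ (2 * t + 3)
  wires : L = (2 * m) ^ t + 1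
  bits : s = (2 * t + 5) * m * L * L
  size_n : 2 * n + 1 ≤ β
  size_table : (2 * 2 ^ m + 1) ^ (s + 1) < 2 ^ β

theorem Params.m_pos {t n m L s β : ℕ} (P : Params t n m L s β) : 0 < m := by
  rcases Nat.eq_zero_or_pos m with rfl | h
  · have := P.lt_root
    have := P.n_pos
    simp at *
    omega
  · exact h

theorem Params.m_le_n {t n m L s β : ℕ} (P : Params t n m L s β) : m ≤ n :=
  (Nat.le_self_pow (by omega) m).trans P.root_le

theorem Params.two_pow_s {t n m L s β : ℕ} (P : Params t n m L s β) : 2 ^ s + 1 < 2 ^ β := by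
  have h1 : 2 ^ (s + 1) ≤ (2 * 2 ^ m + 1) ^ (s + 1) :=
    Nat.pow_le_pow_left (by have := Nat.one_le_two_pow (n := m); omega) _
  have h2 := P.size_table
  have h3 := Nat.one_le_two_pow (n := s)
  rw [pow_succ] at h1
  omega

theorem Params.sq_le {t n m L s β : ℕ} (P : Params t n m L s β) : L * L ≤ s := by
  rw [P.bits, mul_assoc _ L L]
  exact Nat.le_mul_of_pos_left _ (Nat.mul_pos (by omega) P.m_pos)

theorem Params.n_lt {t n m L s β : ℕ} (P : Params t n m L s β) : 2 ^ n < 2 ^ β :=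
  Nat.pow_lt_pow_right (by norm_num) (by have := P.size_n; omega)

def setupConst (t : ℕ) : ℕ :=
  (rootCond t).weight + 1 + blockWeight rootBody + blockWeight (paramBody t) + 5000

def setupTime (t m L s : ℕ) : ℕ :=
  (m + s + 4) * setupConst t + ((2 * 2 ^ m + 1) ^ (s + 1) + 1) * (entryTime L s + 100)

/-! ### Correctness and cost of the set-up phase -/

section Setup

variable {Op E : Type} {ext : Op → Memory × E → Memory × E → ℕ → Prop} {β : ℕ}

theorem exec_setup {t n m L s : ℕ} (P : Params t n m L s β) {mem : Memory}
    (hm : mem.Bounded β) (h0 : mem 0 = n) (harr : ∀ i, 32 ≤ i → mem i = 0) :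
    Exec ext β (setupProg Op t) mem (setupTime t m L s) fun m' =>
      m' 3 = n ∧ m' 5 = 2 ^ m ∧ m' 7 = s ∧ m' 24 = 1 ∧ m' 25 = 0 ∧
      (∀ h < (2 * 2 ^ m + 1) ^ (s + 1), m' (32 + 3 * h) = versionCount (2 ^ m) L s h) ∧
      (∀ i, m' (33 + 3 * i) = 0) ∧ ∀ i, (i < 3 ∨ 26 ≤ i ∧ i < 32) → m' i = mem i := by
  set H := (2 * 2 ^ m + 1) ^ (s + 1) with hH
  have hM := Nat.one_le_two_pow (n := m)
  have hn := P.n_lt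
  have hs2 := P.two_pow_s
  have hs1 : 2 ^ s < 2 ^ β := by omega
  have hβ1 : 1 < 2 ^ β := by have := Nat.one_le_two_pow (n := s); omega
  have hβ0 : 0 < β := by have := P.size_n; omega
  have hsβ : s < 2 ^ β := Nat.lt_two_pow_self.trans hs1
  have hLL := P.sq_le
  have hL : 0 < L := by rw [P.wires]; omega
  have hLs : L ≤ s := (Nat.le_mul_of_pos_left L hL).trans hLL
  have hmm : 2 ^ m ≤ 2 ^ n := Nat.pow_le_pow_right (by norm_num) P.m_le_n
  have hmn := P.m_le_n
  have hnn : n < 2 ^ n := Nat.lt_two_pow_self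
  refine Exec.mono (τ := 1000 + ((m + 1) * ((rootCond t).weight + 1 + blockWeight rootBody) +
    (blockWeight (paramBody t) + ((s + 1) * 3000 + (1000 +
    ((H + 1) * (entryTime L s + 100) + 1000)))))) ?_ ?_ (fun _ _ h => h)
  swap
  · have hS : setupConst t = (rootCond t).weight + 1 + blockWeight rootBody +
      blockWeight (paramBody t) + 5000 := rfl
    rw [setupTime]
    generalize (rootCond t).weight = w1 at *
    generalize blockWeight rootBody = w2 at *
    generalize blockWeight (paramBody t) = w3 at *
    generalize setupConst t = S at *
    generalize (H + 1) * (entryTime L s + 100) = T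
    have e1 : w1 + 1 + w2 ≤ S := by omega
    have f1 := Nat.mul_le_mul_left (m + 1) e1
    have f2 := Nat.mul_le_mul_left (s + 1) (show 3000 ≤ S by omega)
    have f3 : (m + s + 4) * S = (m + 1) * S + (s + 1) * S + S + S := by ring
    omega
  refine Exec.seq (Q := fun m' => m' 3 = n ∧ m' 4 = 0 ∧ m' 5 = 1 ∧
      ∀ i, (i < 3 ∨ 6 ≤ i) → m' i = mem i)
    (Exec.mono (Exec.block hm ?_) (by decide) fun _ _ h => h) fun m1 hm1 h1 => ?_
  · simp [BlockPost, Function.update_apply, h0]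
    refine ⟨by omega, by omega, fun i h => ?_⟩
    repeat rw [if_neg (by omega)]
  obtain ⟨k3, k4, k5, hF1⟩ := h1
  -- The truncated difference in `rootCond` is non-zero exactly while the next candidate still has
  -- its power at most `n`; hence the search from `0` takes `m` steps.
  have key1 := Exec.loop (ext := ext) (β := β) (e := rootCond t) (p := .block rootBody)
    (τ := blockWeight rootBody)
    (I := fun c m' => ∃ j, j + c = m ∧ m' 4 = j ∧ m' 5 = 2 ^ j ∧
      ∀ i, (i < 4 ∨ 6 ≤ i) → m' i = m1 i)
    (fun m' h => by
      obtain ⟨j, rfl, h4, h5, hF⟩ := h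
      have := P.lt_root
      rw [add_zero] at this
      simp only [rootCond, RamExpr.val_sub, RamExpr.val_add, RamExpr.val_reg, RamExpr.val_lit,
        val_powExpr, h4, hF 3 (by omega), k3]
      omega)
    (fun c m' h => by
      obtain ⟨j, hj, h4, h5, hF⟩ := h
      have h1 : (j + 1) ^ (2 * t + 3) ≤ n :=
        (Nat.pow_le_pow_left (by omega) _).trans P.root_le
      simp only [rootCond, RamExpr.val_sub, RamExpr.val_add, RamExpr.val_reg, RamExpr.val_lit,
        val_powExpr, h4, hF 3 (by omega), k3]
      omega)
    (fun c m' hb h => by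
      obtain ⟨j, hj, h4, h5, hF⟩ := h
      refine Exec.block hb ?_
      have hjm : 2 ^ (j + 1) ≤ 2 ^ m := Nat.pow_le_pow_right (by norm_num) (by omega)
      simp [rootBody, BlockPost, Function.update_apply, h4, h5]
      rw [← pow_succ]
      refine ⟨by omega, by omega, by omega, rfl, fun i h => ?_⟩
      repeat rw [if_neg (by omega)]
      exact hF i h)
  refine Exec.seq (key1 m m1 hm1 ⟨0, by omega, k4, by simpa using k5, fun _ _ => rfl⟩)
    fun m2 hm2 h2 => ?_
  obtain ⟨j, hj, l4, l5, hF2⟩ := h2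
  rw [add_zero] at hj
  subst hj
  refine Exec.seq (Q := fun m' => m' 6 = L ∧ m' 7 = s ∧ m' 8 = 1 ∧ m' 9 = 2 * 2 ^ j + 1 ∧
      m' 10 = s ∧ ∀ i, (i < 6 ∨ 11 ≤ i) → m' i = m2 i) (Exec.block hm2 ?_) fun m3 hm3 h3 => ?_
  · have e1 : (2 * j) ^ t + 1 = L := P.wires.symm
    have e2 : (2 * t + 5) * j * L * L = s := P.bits.symm
    simp [paramBody, BlockPost, Function.update_apply, l4, l5, e1, e2]
    have h6 : 2 * 2 ^ j + 1 ≤ H := Nat.le_self_pow (by omega) _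
    have h7 := P.size_table
    refine ⟨by omega, by omega, by omega, by omega, by omega, fun i h => ?_⟩
    repeat rw [if_neg (by omega)]
  obtain ⟨n6, n7, n8, n9, n10, hF3⟩ := h3
  have n5 : m3 5 = 2 ^ j := by rw [hF3 5 (by omega), l5]
  -- Relating the partial powers to the final ones also shows that the intermediate values fit into
  -- the word size.
  have key2 := Exec.loop (ext := ext) (β := β) (e := reg 10) (p := .block sizeBody)
    (τ := blockWeight sizeBody)
    (I := fun c m' => m' 10 = c ∧ c ≤ s ∧ m' 8 * 2 ^ c = 2 ^ s ∧
      m' 9 * (2 * 2 ^ j + 1) ^ c = H ∧ ∀ i, (i < 8 ∨ 11 ≤ i) → m' i = m3 i)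
    (fun m' h => h.1) (fun c m' h => by simp [h.1]) (fun c m' hb h => by
      obtain ⟨hc, hcs, h8, h9, hF⟩ := h
      have e5 : m' 5 = 2 ^ j := by rw [hF 5 (by omega), n5]
      have g8 : m' 8 * 2 * 2 ^ c = 2 ^ s := by rw [← h8, pow_succ']; ring
      have g9 : m' 9 * (2 * 2 ^ j + 1) * (2 * 2 ^ j + 1) ^ c = H := by
        rw [← h9, pow_succ']; ring
      refine Exec.block hb ?_
      simp [sizeBody, BlockPost, Function.update_apply, hc, e5]
      have h7 := P.size_table
      refine ⟨?_, ?_, by omega, by omega, g8, g9, fun i h => ?_⟩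
      · refine lt_of_le_of_lt ?_ hs1
        rw [← g8]
        exact Nat.le_mul_of_pos_right _ (by positivity)
      · refine lt_of_le_of_lt ?_ P.size_table
        rw [← hH, ← g9]
        exact Nat.le_mul_of_pos_right _ (by positivity)
      · repeat rw [if_neg (by omega)]
        exact hF i h)
  refine Exec.seq (Exec.mono (key2 s m3 hm3 ⟨n10, le_rfl, by rw [n8, one_mul],
    by rw [n9, hH, pow_succ'], fun _ _ => rfl⟩) (Nat.mul_le_mul_left _ (by decide))
    fun _ _ h => h) fun m4 hm4 h4 => ?_
  obtain ⟨-, -, o8, o9, hF4⟩ := h4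
  rw [pow_zero, mul_one] at o8 o9
  refine Exec.seq (Q := fun m' => m' 11 = H ∧ ∀ i, i ≠ 11 → m' i = m4 i)
    (Exec.mono (Exec.block hm4 ?_) (by decide) fun _ _ h => h) fun m5 hm5 h5 => ?_
  · simp [BlockPost, Function.update_apply, o9]
    exact ⟨P.size_table, fun i h h' => absurd h' h⟩
  obtain ⟨p11, hF5⟩ := h5
  -- The table is filled from the top. Histories have addresses `0` modulo `3`, so they keep their
  -- initial value zero.
  have key3 := Exec.loop (ext := ext) (β := β) (e := reg 11) (p := entryProg Op)
    (τ := entryTime L s)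
    (I := fun c m' => m' 11 = c ∧ c ≤ H ∧
      (∀ h, c ≤ h → h < H → m' (32 + 3 * h) = versionCount (2 ^ j) L s h) ∧
      ∀ i, (i < 11 ∨ 24 ≤ i) → (i < 32 ∨ i % 3 = 0) → m' i = m5 i)
    (fun m' h => h.1) (fun c m' h => by simp [h.1]) (fun c m' hb h => by
      obtain ⟨hc, hcs, hT, hF⟩ := h
      have hlow : ∀ i, i < 8 → m' i = m3 i := fun i hi => by
        rw [hF i (by omega) (by omega), hF5 i (by omega), hF4 i (by omega)]
      refine (exec_entry (M := 2 ^ j) (L := L) (s := s) hb hs2 ?_ hM ?_ hL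
        (hLL.trans_lt hsβ) ?_ ?_ ?_).mono le_rfl fun m'' hb' h' => ?_
      · rw [hlow 5 (by omega), n5]
      · rw [hlow 6 (by omega), n6]
      · rw [hF 8 (by omega) (by omega), hF5 8 (by omega), o8]
      · omega
      · omega
      obtain ⟨q1, q2, q3⟩ := h'
      rw [hc, Nat.add_sub_cancel] at q1 q2 q3
      refine ⟨q1, by omega, fun h hch hhH => ?_, fun i h h' => ?_⟩
      · rcases Nat.eq_or_lt_of_le hch with rfl | hlt
        · exact q2
        · rw [q3 _ (by omega) (by omega) (by omega), hT h hlt hhH]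
      · rw [q3 i h (by omega) (by omega), hF i h h'])
  refine Exec.seq (Exec.mono (key3 H m5 hm5 ⟨p11, le_rfl, fun h h1 h2 => absurd h2 (by omega),
    fun _ _ _ => rfl⟩) (Nat.mul_le_mul_left _ ?_) fun _ _ h => h) fun m6 hm6 h6 => ?_
  · have : (reg 11).weight + 1 ≤ 100 := by decide
    omega
  obtain ⟨-, -, hT, hF6⟩ := h6
  have hlow : ∀ i, i < 8 → m6 i = m3 i := fun i hi => by
    rw [hF6 i (by omega) (by omega), hF5 i (by omega), hF4 i (by omega)]
  have hhigh : ∀ i, 26 ≤ i → (i < 32 ∨ i % 3 = 0) → m6 i = mem i := fun i hi hi' => by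
    rw [hF6 i (by omega) (by omega), hF5 i (by omega), hF4 i (by omega), hF3 i (by omega),
      hF2 i (by omega), hF1 i (by omega)]
  refine Exec.mono (Exec.block hm6 ?_) (by decide) fun _ _ h => h
  simp only [BlockPost, RamExpr.val_lit]
  refine ⟨hβ1, by omega, ?_, ?_, ?_, rfl, rfl, fun h hh => ?_, fun i => ?_, fun i hi => ?_⟩
  · simp [hlow 3, hF3 3, hF2 3, k3]
  · simp [hlow 5, n5]
  · simp [hlow 7, n7]
  · rw [Function.update_of_ne (by omega), Function.update_of_ne (by omega)]
    exact hT h (by omega) hh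
  · rw [Function.update_of_ne (by omega), Function.update_of_ne (by omega),
      hhigh _ (by omega) (by omega), harr _ (by omega)]
  · rw [Function.update_of_ne (by omega), Function.update_of_ne (by omega)]
    rcases hi with hi | hi
    · rw [hlow i (by omega), hF3 i (by omega), hF2 i (by omega), hF1 i (by omega)]
    · exact hhigh i hi.1 (Or.inl hi.2)

end Setup

/-! ### The hypothesis and its update

The point is in cell `0`, the number `n` in cell `3`, `(2 ^ m) ^ b` and the block `b` are in the
cells `24` and `25`. -/

def innerExpr : RamExpr := reg 0 / reg 24 % reg 5

/-- Histories are indexed by the pair of outer part and block, with `n + 1` slots per outer part.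
Each block thus finds fresh zero cells, and moving on requires no clearing. -/
def indexExpr : RamExpr :=
  (reg 0 % reg 24 + reg 24 * (reg 0 / (reg 24 * reg 5))) * (reg 3 + num 1) + reg 25

def extendExpr (v : RamExpr) : RamExpr :=
  .cell (histAddr indexExpr) * (num 2 * reg 5 + num 1) + (num 2 * innerExpr + num 1 + v)

/-- Non-zero if and only if the majority vote is for the value `1`. -/
def voteExpr : RamExpr :=
  .cell (countAddr (extendExpr (num 1))) + num 1 - .cell (countAddr (extendExpr (num 0)))

/-- The evaluation program of the hypothesis. -/
def hypProg : RamProg Empty := .assign (num 0) voteExpr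

/-- The update of the hypothesis on the counterexample in cell `0`. -/
def updateProg (Op : Type) : RamProg Op :=
  .seq (.block [(num 27, indexExpr), (num 28, extendExpr (num 1 - voteExpr))])
    (.cond (.cell (countAddr (reg 28))) (.block [(histAddr (reg 27), reg 28)])
      (.block [(num 24, reg 24 * reg 5), (num 25, reg 25 + num 1)]))

/-- The memory holds the state `σ` of the learner. -/
structure Holds (n m L s : ℕ) (σ : LearnState) (mem : Memory) : Prop where
  cell3 : mem 3 = n
  cell5 : mem 5 = 2 ^ m
  cell24 : mem 24 = (2 ^ m) ^ σ.block
  cell25 : mem 25 = σ.block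
  table : ∀ h < (2 * 2 ^ m + 1) ^ (s + 1), mem (32 + 3 * h) = versionCount (2 ^ m) L s h
  hist : ∀ ρ, mem (33 + 3 * (ρ * (n + 1) + σ.block)) = σ.hist ρ
  fresh : ∀ b, σ.block < b → b ≤ n → ∀ ρ, mem (33 + 3 * (ρ * (n + 1) + b)) = 0

section Hyp

variable {n m L s : ℕ} {σ : LearnState} {mem : Memory}

theorem Holds.congr (h : Holds n m L s σ mem) {mem' : Memory} (h3 : mem' 3 = mem 3)
    (h5 : mem' 5 = mem 5) (h24 : mem' 24 = mem 24) (h25 : mem' 25 = mem 25)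
    (hi : ∀ i, 32 ≤ i → mem' i = mem i) : Holds n m L s σ mem' where
  cell3 := h3.trans h.cell3
  cell5 := h5.trans h.cell5
  cell24 := h24.trans h.cell24
  cell25 := h25.trans h.cell25
  table i hi' := (hi _ (by omega)).trans (h.table i hi')
  hist ρ := (hi _ (by omega)).trans (h.hist ρ)
  fresh b h1 h2 ρ := (hi _ (by omega)).trans (h.fresh b h1 h2 ρ)

theorem Holds.val_index (h : Holds n m L s σ mem) : indexExpr.val mem =
    outerPart ((2 ^ m) ^ σ.block) (2 ^ m) (mem 0) * (n + 1) + σ.block := by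
  simp [indexExpr, h.cell3, h.cell5, h.cell24, h.cell25, outerPart]

theorem Holds.val_extend (h : Holds n m L s σ mem) (v : RamExpr) :
    (extendExpr v).val mem = extendHistory (2 ^ m) (σ.histAt m (mem 0))
      (innerPart ((2 ^ m) ^ σ.block) (2 ^ m) (mem 0)) (v.val mem) := by
  simp [extendExpr, innerExpr, h.val_index, h.hist, h.cell5, h.cell24, extendHistory,
    LearnState.histAt, innerPart]

/-- Truncated subtraction gives `c₁ + 1 - c₀ ≠ 0` exactly when `c₀ ≤ c₁`. A valid history has at
most `s` digits, so its extensions still lie in a table built for `s + 1` digits. -/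
theorem Holds.vote_ne_zero (h : Holds n m L s σ mem)
    (hσ : ∀ ρ, σ.hist ρ < (2 * 2 ^ m + 1) ^ s) :
    voteExpr.val mem ≠ 0 ↔ σ.value m L s (mem 0) = true := by
  have hy := innerPart_lt (m := m) ((2 ^ m) ^ σ.block) (mem 0)
  have h0 := h.table _ (extendHistory_lt (hσ (outerPart ((2 ^ m) ^ σ.block) (2 ^ m) (mem 0))) hy
    (zero_le_one))
  have h1 := h.table _ (extendHistory_lt (hσ (outerPart ((2 ^ m) ^ σ.block) (2 ^ m) (mem 0))) hy
    le_rfl)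
  rw [LearnState.value, predict, decide_eq_true_iff]
  simp only [voteExpr, RamExpr.val_sub, RamExpr.val_add, RamExpr.val_cell, RamExpr.val_countAddr,
    RamExpr.val_lit, h.val_extend, LearnState.histAt, h0, h1]
  omega

theorem cubeCode_succ {n : ℕ} (x : Cube (n + 1)) :
    cubeCode x = (x 0).toNat + 2 * cubeCode (fun i => x i.succ) := by
  rw [cubeCode, Fin.sum_univ_succ, cubeCode, Finset.mul_sum]
  congr 1
  · simp
  · refine Finset.sum_congr rfl fun i _ => ?_
    rw [Fin.val_succ, pow_succ]
    ring

theorem cubeCode_lt {n : ℕ} (x : Cube n) : cubeCode x < 2 ^ n := by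
  induction n with
  | zero => simp [cubeCode]
  | succ n ih =>
    have := ih fun i => x i.succ
    have := Bool.toNat_le (x 0)
    rw [cubeCode_succ, pow_succ]
    omega

theorem cubePoint_cubeCode {n : ℕ} (x : Cube n) : cubePoint n (cubeCode x) = x := by
  induction n with
  | zero => exact Subsingleton.elim _ _
  | succ n ih =>
    funext i
    rw [cubePoint, cubeCode_succ]
    refine Fin.cases ?_ (fun i => ?_) i
    · rw [Fin.val_zero, Nat.testBit_zero]
      cases x 0 <;> simp [Nat.add_mod]
    · have h2 : ((x 0).toNat + 2 * cubeCode fun i => x i.succ) / 2 =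
          cubeCode fun i => x i.succ := by
        have := Bool.toNat_le (x 0)
        omega
      rw [Fin.val_succ, Nat.testBit_succ, h2]
      exact congrFun (ih fun i => x i.succ) i

/-- The hypothesis of the learner in the state `σ`. -/
def LearnState.hypothesis (n m L s : ℕ) (σ : LearnState) : BoolFn n :=
  fun x => σ.value m L s (cubeCode x)

/-- The evaluation time of the hypothesis. -/
def hypTime {n : ℕ} (mem : Memory) (x : Cube n) : ℕ :=
  (num 0).cost (Function.update mem 0 (cubeCode x)) +
    voteExpr.cost (Function.update mem 0 (cubeCode x)) + 1

theorem Holds.represents (h : Holds n m L s σ mem) (hσ : ∀ ρ, σ.hist ρ < (2 * 2 ^ m + 1) ^ s) :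
    Represents hypProg mem (σ.hypothesis n m L s) (hypTime mem) := by
  intro x
  refine ⟨_, .assign (num 0) voteExpr _ (), ?_⟩
  have h' : Holds n m L s σ (Function.update mem 0 (cubeCode x)) := by
    refine h.congr ?_ ?_ ?_ ?_ fun i hi => ?_ <;> rw [Function.update_of_ne (by omega)]
  rw [RamExpr.val_lit, Function.update_self, h'.vote_ne_zero hσ, Function.update_self]
  rfl

theorem hypTime_le {β : ℕ} (hm : mem.Bounded β) (hn : 2 ^ n ≤ 2 ^ β) (x : Cube n) :
    hypTime mem x ≤ 30000 * (β + 1) := by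
  have hb := hm.update (i := 0) ((cubeCode_lt x).trans_le hn)
  have h1 := (num 0).cost_le hb
  have h2 := voteExpr.cost_le hb
  have h3 : (num 0).weight + voteExpr.weight + 1 ≤ 30000 := by decide
  have h4 := Nat.mul_le_mul_right (β + 1) h3
  rw [add_mul, add_mul, one_mul] at h4
  rw [hypTime]
  omega

end Hyp

/-! ### The update on a counterexample -/

section Update

variable {Op E : Type} {ext : Op → Memory × E → Memory × E → ℕ → Prop} {β : ℕ}

theorem index_injective {n b b' ρ ρ' : ℕ} (hb : b ≤ n) (hb' : b' ≤ n)
    (h : ρ * (n + 1) + b = ρ' * (n + 1) + b') : ρ = ρ' ∧ b = b' := by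
  have h1 : (ρ * (n + 1) + b) / (n + 1) = ρ := by
    rw [mul_comm, Nat.mul_add_div (by omega), Nat.div_eq_of_lt (by omega), add_zero]
  have h2 : (ρ' * (n + 1) + b') / (n + 1) = ρ' := by
    rw [mul_comm, Nat.mul_add_div (by omega), Nat.div_eq_of_lt (by omega), add_zero]
  have h3 : ρ = ρ' := by rw [← h1, h, h2]
  subst h3
  exact ⟨rfl, by omega⟩

theorem exec_update {t n m L s b : ℕ} {D : ℕ → ℕ} {σ : LearnState} {mem : Memory}
    (P : Params t n m L s β) (hm : mem.Bounded β) (hb : (b + 1) * m ≤ n)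
    (hmem : Holds n m L s σ mem) (hσ : σ.Valid m L s b D)
    (hσ' : (σ.next m L s (mem 0)).Valid m L s b D) (hx : mem 0 < 2 ^ n) :
    Exec ext β (updateProg Op) mem 100000 fun m' =>
      Holds n m L s (σ.next m L s (mem 0)) m' ∧
      ∀ i, i < 32 → (i ≠ 24 ∧ i ≠ 25 ∧ i ≠ 27 ∧ i ≠ 28) → m' i = mem i := by
  have hmpos := P.m_pos
  have hbn : b + 1 ≤ n := (Nat.le_mul_of_pos_right _ hmpos).trans hb
  set ρ := outerPart ((2 ^ m) ^ σ.block) (2 ^ m) (mem 0) with hρ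
  have hσb := hσ.block_le
  have hρlt : ρ < 2 ^ (n - m) :=
    outerPart_lt ((Nat.mul_le_mul_right m (Nat.add_le_add_right hσb 1)).trans hb) hx
  have hvote := hmem.vote_ne_zero hσ.hist_lt
  have hnew : (extendExpr (num 1 - voteExpr)).val mem = σ.newHist m L s (mem 0) := by
    rw [hmem.val_extend, LearnState.newHist, RamExpr.val_sub, RamExpr.val_lit]
    congr 1
    cases hv : σ.value m L s (mem 0)
    · have : voteExpr.val mem = 0 := by
        by_contra h0
        rw [hvote.1 h0] at hv
        cases hv
      simp [this]
    · have := hvote.2 hv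
      simp only [Bool.not_true, Bool.toNat_false]
      omega
  have hnlt : σ.newHist m L s (mem 0) < (2 * 2 ^ m + 1) ^ (s + 1) :=
    extendHistory_lt (hσ.hist_lt _) (innerPart_lt _ _) (Bool.toNat_le _)
  have hn1 : n + 1 ≤ 2 ^ n := Nat.lt_two_pow_self
  -- The index `ρ * (n + 1) + σ.block` has less than `2 * n + 1` bits up to slack, which is the
  -- purpose of `size_n`.
  have h2n : 2 ^ n * 2 ^ n * 2 ≤ 2 ^ β := by
    rw [← pow_add, ← pow_succ]
    exact Nat.pow_le_pow_right (by norm_num) (by have := P.size_n; omega)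
  have hidx : ρ * (n + 1) + σ.block < 2 ^ β := by
    have h1 : ρ ≤ 2 ^ n :=
      hρlt.le.trans (Nat.pow_le_pow_right (by norm_num) (Nat.sub_le _ _))
    have h2 := Nat.mul_le_mul h1 hn1
    have h3 : 2 ^ n ≤ 2 ^ n * 2 ^ n := Nat.le_mul_of_pos_left _ (by positivity)
    omega
  refine Exec.mono (τ := 60000 + (1000 + (1000 + 1000))) ?_ (by norm_num) (fun _ _ h => h)
  refine Exec.seq (Q := fun m' => m' 27 = ρ * (n + 1) + σ.block ∧
      m' 28 = σ.newHist m L s (mem 0) ∧ ∀ i, (i ≠ 27 ∧ i ≠ 28) → m' i = mem i)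
    (Exec.mono (Exec.block hm ?_) (by decide) fun _ _ h => h) fun m1 hm1 h1 => ?_
  · have h27 : ∀ i, i ≠ 27 → Function.update mem 27 (indexExpr.val mem) i = mem i :=
      fun i hi => Function.update_of_ne hi _ _
    have hmem' : Holds n m L s σ (Function.update mem 27 (indexExpr.val mem)) :=
      hmem.congr (h27 _ (by omega)) (h27 _ (by omega)) (h27 _ (by omega)) (h27 _ (by omega))
        fun i hi => h27 _ (by omega)
    have hvote' := hmem'.vote_ne_zero hσ.hist_lt
    rw [h27 0 (by omega)] at hvote'
    -- The new history is evaluated after cell `27` has been written; none of the cells that it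
    -- reads has changed.
    have hnew' : (extendExpr (num 1 - voteExpr)).val
        (Function.update mem 27 (indexExpr.val mem)) = σ.newHist m L s (mem 0) := by
      rw [← hnew, hmem'.val_extend, hmem.val_extend, h27 0 (by omega)]
      congr 1
      simp only [RamExpr.val_sub, RamExpr.val_lit]
      have := hvote'.trans hvote.symm
      omega
    rw [hmem.val_index] at hnew'
    simp only [BlockPost, RamExpr.val_lit, hmem.val_index, ← hρ] at hnew' ⊢
    rw [hnew']
    refine ⟨hidx, hnlt.trans P.size_table, ?_, ?_, fun i hi => ?_⟩
    · simp [hρ]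
    · simp
    · rw [Function.update_of_ne hi.2, Function.update_of_ne hi.1]
  obtain ⟨h27, h28, hF1⟩ := h1
  have hmem1 : Holds n m L s σ m1 :=
    hmem.congr (hF1 _ (by omega)) (hF1 _ (by omega)) (hF1 _ (by omega)) (hF1 _ (by omega))
      fun i hi => hF1 _ (by omega)
  have hcount : (RamExpr.cell (countAddr (reg 28))).val m1 =
      versionCount (2 ^ m) L s (σ.newHist m L s (mem 0)) := by
    simp only [RamExpr.val_cell, RamExpr.val_countAddr, RamExpr.val_reg, h28]
    exact hmem1.table _ hnlt
  refine Exec.mono (Exec.cond (τ := 1000) (τ' := 1000) hm1 (fun h => ?_) fun h => ?_) (by decide)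
    fun _ _ h => h
  · rw [hcount] at h
    have hnext : σ.next m L s (mem 0) =
        ⟨σ.block, Function.update σ.hist ρ (σ.newHist m L s (mem 0))⟩ := by
      rw [LearnState.next, if_neg h]
    refine Exec.mono (Exec.block hm1 ?_) (by decide) fun _ _ h => h
    simp only [BlockPost, RamExpr.val_histAddr, RamExpr.val_reg, h27, h28, hnext]
    refine ⟨hnlt.trans P.size_table, ⟨?_, ?_, ?_, ?_, fun h hh => ?_, fun ρ' => ?_,
      fun b' h1 h2 ρ' => ?_⟩, fun i hi hi' => ?_⟩
    · rw [Function.update_of_ne (by omega), hmem1.cell3]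
    · rw [Function.update_of_ne (by omega), hmem1.cell5]
    · rw [Function.update_of_ne (by omega), hmem1.cell24]
    · rw [Function.update_of_ne (by omega), hmem1.cell25]
    · rw [Function.update_of_ne (by omega), hmem1.table h hh]
    · dsimp only
      rw [Function.update_apply, Function.update_apply]
      by_cases he : ρ' = ρ
      · rw [he, if_pos rfl, if_pos rfl]
      · rw [if_neg he, if_neg, hmem1.hist]
        intro h'
        exact he (index_injective (by omega) (by omega) (show ρ' * (n + 1) + σ.block =
          ρ * (n + 1) + σ.block by omega)).1
    · dsimp only at h1
      rw [Function.update_of_ne, hmem1.fresh b' h1 h2]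
      intro h'
      have := (index_injective h2 (by omega) (show ρ' * (n + 1) + b' =
          ρ * (n + 1) + σ.block by omega)).2
      omega
    · rw [Function.update_of_ne (by omega), hF1 i (by omega)]
  · rw [hcount] at h
    have hnext : σ.next m L s (mem 0) = ⟨σ.block + 1, fun _ => 0⟩ := by
      rw [LearnState.next, if_pos h]
    rw [hnext] at hσ' ⊢
    have hle := hσ'.block_le
    dsimp only at hle
    refine Exec.mono (Exec.block hm1 ?_) (by decide) fun _ _ h => h
    -- Validity of the next state puts it at block at most `b`, so the new power of `2 ^ m` stays in
    -- range.
    have h24 : (2 ^ m) ^ σ.block * 2 ^ m ≤ 2 ^ n := by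
      rw [← pow_succ, ← pow_mul, mul_comm]
      exact Nat.pow_le_pow_right (by norm_num) ((Nat.mul_le_mul_right m (by omega)).trans hb)
    have hnβ := P.n_lt
    simp only [BlockPost, RamExpr.val_lit, RamExpr.val_mul, RamExpr.val_add, RamExpr.val_reg,
      hmem1.cell24, hmem1.cell5]
    rw [Function.update_of_ne (by omega : (25 : ℕ) ≠ 24), hmem1.cell25]
    refine ⟨by omega, by omega, ⟨?_, ?_, ?_, ?_, fun h hh => ?_, fun ρ' => ?_,
      fun b' h1 h2 ρ' => ?_⟩, fun i hi hi' => ?_⟩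
    · rw [Function.update_of_ne (by omega), Function.update_of_ne (by omega), hmem1.cell3]
    · rw [Function.update_of_ne (by omega), Function.update_of_ne (by omega), hmem1.cell5]
    · rw [Function.update_of_ne (by omega), Function.update_self, pow_succ]
    · rw [Function.update_self]
    · rw [Function.update_of_ne (by omega), Function.update_of_ne (by omega), hmem1.table h hh]
    · rw [Function.update_of_ne (by omega), Function.update_of_ne (by omega)]
      exact hmem1.fresh _ (Nat.lt_succ_self _) (by omega) ρ'
    · dsimp only at h1
      rw [Function.update_of_ne (by omega), Function.update_of_ne (by omega)]
      exact hmem1.fresh _ (by omega) h2 ρ'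
    · rw [Function.update_of_ne (by omega), Function.update_of_ne (by omega), hF1 i (by omega)]

end Update

/-! ### The exact learner -/

/-- One equivalence query and the update on its counterexample. -/
def exactBody : RamProg ExactOp :=
  .seq (.call (.equiv (num 26)))
    (.cond (reg 26) (.seq (.block [(num 0, reg 26 - num 1)]) (updateProg ExactOp)) .skip)

/-- Cell `26` is both loop flag and reply: a confirmation is stored as `0` and ends the loop. -/
def exactLearner (t : ℕ) : Learner ExactOp where
  main := .seq (setupProg ExactOp t) (.seq (.block [(num 26, num 1)])
    (.loop (reg 26) exactBody))
  hyp := hypProg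

def exactTime (t n m L s : ℕ) : ℕ :=
  setupTime t m L s + (1000 + (n * (2 ^ (n - m) * (s + 1)) + 1) * 200000)

section Exact

variable {t n m L s β : ℕ} {b : ℕ} {f : BoolFn n}

theorem LearnState.Valid.next_of_ne {σ : LearnState} {D : ℕ → ℕ} (hσ : σ.Valid m L s b D)
    (hb : (b + 1) * m ≤ n) (hD : ∀ ρ, D ρ < 2 ^ s)
    (hDf : ∀ x < 2 ^ n, codeEval (2 ^ m) L (D (outerPart ((2 ^ m) ^ b) (2 ^ m) x))
      (innerPart ((2 ^ m) ^ b) (2 ^ m) x) = (f (cubePoint n x)).toNat)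
    {x : Cube n} (hx : σ.hypothesis n m L s x ≠ f x) :
    (σ.next m L s (cubeCode x)).Valid m L s b D ∧
      (σ.next m L s (cubeCode x)).potential n m s b < σ.potential n m s b := by
  refine hσ.next hD (F := fun x => f (cubePoint n x)) hb hDf (cubeCode_lt x) ?_
  rw [cubePoint_cubeCode]
  exact hx

/-- Any counterexample, however chosen, lowers the potential, so the loop must end, and it can end
only by a confirmation. The induction bounds the number of queries by `k`. -/
theorem runs_exact_loop (P : Params t n m L s β) (O : EquivOracle f)
    {D : ℕ → ℕ} (hb : (b + 1) * m ≤ n) (hD : ∀ ρ, D ρ < 2 ^ s)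
    (hDf : ∀ x < 2 ^ n, codeEval (2 ^ m) L (D (outerPart ((2 ^ m) ^ b) (2 ^ m) x))
      (innerPart ((2 ^ m) ^ b) (2 ^ m) x) = (f (cubePoint n x)).toNat)
    (k : ℕ) (σ : LearnState) (hk : σ.potential n m s b < k) (hσ : σ.Valid m L s b D)
    (mem : Memory) (hm : mem.Bounded β) (hmem : Holds n m L s σ mem) (h26 : mem 26 ≠ 0)
    (z : ExactEnv n) :
    ∃ m' z' τ, Runs (ExactCall hypProg f O) (.loop (reg 26) exactBody) (mem, z) (m', z') τ ∧
      τ ≤ k * 200000 * (β + 1) ∧ Represents hypProg m' f (hypTime m') ∧ m'.Bounded β := by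
  induction k generalizing σ mem z with
  | zero => exact absurd hk (Nat.not_lt_zero _)
  | succ k ih =>
    obtain ⟨ω, past⟩ := z
    have hnβ := P.n_lt
    have hsn := P.size_n
    have hrep := hmem.represents hσ.hist_lt
    have hcall := ExactCall.equiv (ev := hypProg) (O := O) (num 26) mem ω past _ _ hrep
    have hsup : Finset.univ.sup (hypTime (n := n) mem) ≤ 30000 * (β + 1) :=
      Finset.sup_le fun x _ => hypTime_le hm hnβ.le x
    have hc0 := (reg 26).cost_le hm
    have hw : (reg 26).weight = 28 := by decide
    have hc1 := (num 26).cost_le hm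
    have hw1 : (num 26).weight = 27 := by decide
    rw [hw] at hc0
    rw [hw1] at hc1
    rw [RamExpr.val_lit] at hcall
    cases hr : O.reply past (σ.hypothesis n m L s) with
    | none =>
      rw [hr] at hcall
      have hf := (O.reply_none _ _).1 hr
      set m1 : Memory := Function.update mem 26 (replyCode (n := n) none) with hm1
      have h0 : (reg 26).val m1 = 0 := by simp [hm1, replyCode]
      have hm1b : m1.Bounded β := hm.update (by simp [replyCode])
      have hc2 := (reg 26).cost_le hm1b
      rw [hw] at hc2
      have hrep1 : Represents hypProg m1 f (hypTime m1) := by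
        rw [← hf]
        refine Holds.represents (σ := σ) ?_ hσ.hist_lt
        refine hmem.congr ?_ ?_ ?_ ?_ fun i hi => ?_ <;>
          exact Function.update_of_ne (by omega) _ _
      refine ⟨m1, _, _, .loop_true (by exact h26) (.seq (.call hcall)
        (.cond_false (by exact h0) (.skip _))) (.loop_false (by exact h0)), ?_, hrep1, hm1b⟩
      rw [add_mul k, add_mul _ _ (β + 1)]
      dsimp only
      omega
    | some x =>
      rw [hr] at hcall
      have hx := O.reply_some _ _ _ hr
      have hxn := cubeCode_lt x
      obtain ⟨hσ', hpot⟩ := hσ.next_of_ne hb hD hDf hx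
      set m1 : Memory := Function.update mem 26 (replyCode (some x)) with hm1
      have h1 : m1 26 = 1 + cubeCode x := by simp [hm1, replyCode]
      have hm1b : m1.Bounded β := hm.update (by simp only [replyCode]; omega)
      have hc2 := (reg 26).cost_le hm1b
      rw [hw] at hc2
      have hexec : Exec (ExactCall hypProg f O) β
          (.seq (.block [(num 0, reg 26 - num 1)]) (updateProg ExactOp)) m1 (1000 + 100000)
          fun m' => Holds n m L s (σ.next m L s (cubeCode x)) m' ∧ m' 26 ≠ 0 := by
        refine Exec.seq (Q := fun m' => m' = Function.update m1 0 (cubeCode x))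
          (Exec.mono (Exec.block hm1b ?_) (by decide) fun _ _ h => h) fun m2 hm2 h2 => ?_
        · simp [BlockPost, h1]
          omega
        · have e0 : m2 0 = cubeCode x := by rw [h2, Function.update_self]
          have hF : ∀ i, i ≠ 0 → i ≠ 26 → m2 i = mem i := fun i hi hi' => by
            rw [h2, Function.update_of_ne hi, hm1, Function.update_of_ne hi']
          have hmem2 : Holds n m L s σ m2 :=
            hmem.congr (hF _ (by omega) (by omega)) (hF _ (by omega) (by omega))
              (hF _ (by omega) (by omega)) (hF _ (by omega) (by omega))
              fun i hi => hF _ (by omega) (by omega)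
          rw [← e0] at hσ' hxn ⊢
          refine (exec_update P hm2 hb hmem2 hσ hσ' hxn).mono le_rfl fun m3 _ h3 => ⟨h3.1, ?_⟩
          rw [h3.2 26 (by omega) (by omega), h2, Function.update_of_ne (by omega), h1]
          omega
      obtain ⟨m3, τ3, hr3, hτ3, hb3, hq3, h26'⟩ := hexec ⟨ω, _⟩
      obtain ⟨m4, z4, τ4, hr4, hτ4, hrep4, hb4⟩ := ih _ (by omega) hσ' m3 hb3 hq3 h26' _
      refine ⟨m4, z4, _, .loop_true (by exact h26) (.seq (.call hcall) (.cond_true ?_ hr3)) hr4,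
        ?_, hrep4, hb4⟩
      · simp only [RamExpr.val_reg, h1]
        omega
      · rw [add_mul k, add_mul _ _ (β + 1)]
        dsimp only
        omega

theorem Params.bounded_start (P : Params t n m L s β) {k : ℕ} (hk : k < 2 ^ β) :
    Memory.Bounded β (Memory.ofList [n, k]) := by
  have h1 : n < 2 ^ β := Nat.lt_two_pow_self.trans P.n_lt
  intro i
  rcases i with _ | _ | i
  · exact h1
  · exact hk
  · simp [Memory.ofList]

theorem holds_start {mem : Memory} (h3 : mem 3 = n) (h5 : mem 5 = 2 ^ m) (h24 : mem 24 = 1)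
    (h25 : mem 25 = 0)
    (hT : ∀ h < (2 * 2 ^ m + 1) ^ (s + 1), mem (32 + 3 * h) = versionCount (2 ^ m) L s h)
    (hS : ∀ i, mem (33 + 3 * i) = 0) : Holds n m L s ⟨0, fun _ => 0⟩ mem where
  cell3 := h3
  cell5 := h5
  cell24 := by rw [h24]; rfl
  cell25 := h25
  table := hT
  hist ρ := hS _
  fresh b _ _ ρ := hS _

theorem runs_exact (P : Params t n m L s β) (O : EquivOracle f)
    (hgood : GoodBlock n m L s (fun x => f (cubePoint n x)) b) {k : ℕ} (hk : k < 2 ^ β)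
    (ω : ℕ → Bool) :
    ∃ m' z' τ, Runs (ExactCall hypProg f O) (exactLearner t).main
      (Memory.ofList [n, k], ⟨ω, []⟩) (m', z') τ ∧ τ ≤ exactTime t n m L s * (β + 1) ∧
      Represents hypProg m' f (hypTime m') ∧ m'.Bounded β := by
  obtain ⟨hb, D, hD, hDf⟩ := hgood
  have hm0 : Memory.Bounded β (Memory.ofList [n, k]) := P.bounded_start hk
  have hβ : 1 < 2 ^ β := by have := P.two_pow_s; have := Nat.one_le_two_pow (n := s); omega
  have hexec : Exec (ExactCall hypProg f O) β
      (.seq (setupProg ExactOp t) (.block [(num 26, num 1)])) (Memory.ofList [n, k])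
      (setupTime t m L s + 500) fun m' => Holds n m L s ⟨0, fun _ => 0⟩ m' ∧ m' 26 = 1 := by
    refine Exec.seq (exec_setup P hm0 rfl fun i hi => ?_) fun m1 hm1 h1 => ?_
    · obtain ⟨j, rfl⟩ : ∃ j, i = j + 2 := ⟨i - 2, by omega⟩
      simp [Memory.ofList]
    · obtain ⟨k3, k5, -, k24, k25, kT, kS, -⟩ := h1
      refine Exec.mono (Exec.block hm1 ?_) (by decide) fun _ _ h => h
      simp only [BlockPost, RamExpr.val_lit]
      refine ⟨hβ, ?_, Function.update_self ..⟩
      refine (holds_start k3 k5 k24 k25 kT kS).congr ?_ ?_ ?_ ?_ fun i hi => ?_ <;>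
        rw [Function.update_of_ne (by omega)]
  obtain ⟨m1, τ1, hr1, hτ1, hb1, hh1, h26⟩ := hexec ⟨ω, []⟩
  -- The triple was proved for a left-nested sequence; splitting its run allows reassembly in the
  -- nesting of the program.
  cases hr1 with
  | seq hr0 hr0' =>
    obtain ⟨m2, z2, τ2, hr2, hτ2, hrep, hb2⟩ := runs_exact_loop P O hb hD hDf
      (n * (2 ^ (n - m) * (s + 1)) + 1) _
      (Nat.lt_succ_of_le (LearnState.potential_start_le P.m_pos hb))
      (LearnState.valid_start 0 (Nat.zero_le _) D) m1 hb1 hh1 (by omega) ⟨ω, []⟩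
    refine ⟨m2, z2, _, .seq hr0 (.seq hr0' hr2), ?_, hrep, hb2⟩
    rw [exactTime]
    generalize setupTime t m L s = T at *
    generalize (n * (2 ^ (n - m) * (s + 1)) + 1) * 200000 = U at *
    rw [add_mul T, add_mul 1000]
    rw [add_mul T] at hτ1
    omega

end Exact

/-! ### The PAC learner -/

/-- One example and the update, if the hypothesis errs on it. -/
def pacBody : RamProg PACOp :=
  .seq (.call (.sample (num 0) (num 26)))
    (.cond ((num 1 - (num 1 - voteExpr) + reg 26) % num 2)
      (.seq (updateProg PACOp) (.block [(num 29, reg 30)]))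
      (.block [(num 29, reg 29 - num 1)]))

/-- Cell `30` keeps the test length, cell `29` counts how many correct predictions are still
required. -/
def pacStart : List (RamExpr × RamExpr) :=
  [(num 30, num 2 * reg 2 * (reg 1 + reg 2 + num 2 * reg 3 + reg 7 + num 5)), (num 29, reg 30)]

/-- The learner stops when the hypothesis has been correct on sufficiently many consecutive
examples. -/
def pacLearner (t : ℕ) : Learner PACOp where
  main := .seq (setupProg PACOp t) (.seq (.block pacStart) (.loop (reg 29) pacBody))
  hyp := hypProg

/-- The number of consecutive examples on which the final hypothesis is correct. -/
def testLength (n s k a : ℕ) : ℕ := 2 * a * (k + a + 2 * n + s + 5)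

/-- A bound for the number of examples. -/
def sampleBound (n m s R : ℕ) : ℕ := (n * (2 ^ (n - m) * (s + 1)) + 1) * R

def pacTime (t n m L s R : ℕ) : ℕ :=
  setupTime t m L s + (1000 + (sampleBound n m s R + 1) * 300000)

section PAC

variable {n : ℕ}

/-- The states of the learner that updates its hypothesis on all examples. -/
def learnRun (m L s : ℕ) (f : BoolFn n) (ξ : ℕ → Cube n) : ℕ → LearnState
  | 0 => ⟨0, fun _ => 0⟩
  | T + 1 =>
    if (learnRun m L s f ξ T).hypothesis n m L s (ξ T) = f (ξ T) then learnRun m L s f ξ T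
    else (learnRun m L s f ξ T).next m L s (cubeCode (ξ T))

variable {t m L s β : ℕ} {b : ℕ} {f : BoolFn n}

/-- `T` examples have been read, the current hypothesis is unchanged and correct since time `T₀`,
and `c` successes are missing. The final test starts at `T₁`, and its hypothesis depends only on the
examples before `T₁`; this is what the union bound needs. -/
theorem runs_pac_loop (P : Params t n m L s β) {R : ℕ}
    {D : ℕ → ℕ} (hb : (b + 1) * m ≤ n) (hD : ∀ ρ, D ρ < 2 ^ s)
    (hDf : ∀ x < 2 ^ n, codeEval (2 ^ m) L (D (outerPart ((2 ^ m) ^ b) (2 ^ m) x))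
      (innerPart ((2 ^ m) ^ b) (2 ^ m) x) = (f (cubePoint n x)).toNat)
    (ω : ℕ → Bool) (ξ : ℕ → Cube n)
    (k T T₀ c : ℕ) (hT : T₀ ≤ T) (hc : T - T₀ + c = R)
    (hk : (learnRun m L s f ξ T).potential n m s b * R + c < k)
    (hconst : learnRun m L s f ξ T₀ = learnRun m L s f ξ T)
    (hcorrect : ∀ i < T - T₀, (learnRun m L s f ξ T₀).hypothesis n m L s (ξ (T₀ + i)) =
      f (ξ (T₀ + i)))
    (hσ : (learnRun m L s f ξ T).Valid m L s b D)
    (mem : Memory) (hm : mem.Bounded β) (hmem : Holds n m L s (learnRun m L s f ξ T) mem)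
    (h29 : mem 29 = c) (h30 : mem 30 = R) :
    ∃ m' z' τ, Runs (PACCall f) (.loop (reg 29) pacBody) (mem, ⟨ω, fun i => ξ (T + i)⟩)
        (m', z') τ ∧ τ ≤ k * 300000 * (β + 1) ∧ m'.Bounded β ∧
      ∃ T₁ < T + k, Represents hypProg m' ((learnRun m L s f ξ T₁).hypothesis n m L s)
          (hypTime m') ∧
        ∀ i < R, (learnRun m L s f ξ T₁).hypothesis n m L s (ξ (T₁ + i)) = f (ξ (T₁ + i)) := by
  induction k generalizing T T₀ c mem with
  | zero => exact absurd hk (Nat.not_lt_zero _)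
  | succ k ih =>
    set σ := learnRun m L s f ξ T with hσdef
    have hw0 := (reg 29).cost_le hm
    have hw : (reg 29).weight = 31 := by decide
    rw [hw] at hw0
    rcases Nat.eq_zero_or_pos c with rfl | hcpos
    · refine ⟨mem, _, _, .loop_false (by exact h29), ?_, hm, T₀, by omega, ?_, ?_⟩
      · rw [add_mul k, add_mul _ _ (β + 1)]
        dsimp only
        omega
      · rw [hconst]
        exact hmem.represents hσ.hist_lt
      · rw [add_zero] at hc
        rw [← hc]
        exact hcorrect
    have hnβ := P.n_lt
    have hsn := P.size_n
    have hβ1 : 1 < 2 ^ β := by have := P.two_pow_s; have := Nat.one_le_two_pow (n := s); omega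
    have hcall := PACCall.sample (f := f) (num 0) (num 26) mem ω fun i => ξ (T + i)
    have henv : (fun i => ξ (T + (i + 1))) = fun i => ξ (T + 1 + i) := by
      funext i; congr 1; omega
    simp only [RamExpr.val_lit, add_zero, henv] at hcall
    set m1 : Memory := Function.update (Function.update mem 0 (cubeCode (ξ T))) 26
      (f (ξ T)).toNat with hm1
    have hxn := cubeCode_lt (ξ T)
    have hm1b : m1.Bounded β :=
      (hm.update (by omega)).update ((Bool.toNat_le _).trans_lt hβ1)
    have e0 : m1 0 = cubeCode (ξ T) := by simp [hm1]
    have e26 : m1 26 = (f (ξ T)).toNat := by simp [hm1]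
    have hF : ∀ i, i ≠ 0 → i ≠ 26 → m1 i = mem i := fun i hi hi' => by
      rw [hm1, Function.update_of_ne hi', Function.update_of_ne hi]
    have hmem1 : Holds n m L s σ m1 :=
      hmem.congr (hF _ (by omega) (by omega)) (hF _ (by omega) (by omega))
        (hF _ (by omega) (by omega)) (hF _ (by omega) (by omega))
        fun i hi => hF _ (by omega) (by omega)
    have hc1 := (num 0).cost_le hm
    have hw1 : (num 0).weight = 1 := by decide
    have hc2 := (num 26).cost_le hm
    have hw2 : (num 26).weight = 27 := by decide
    rw [hw1] at hc1
    rw [hw2] at hc2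
    have hc3 := RamExpr.cost_le hm1b ((num 1 - (num 1 - voteExpr) + reg 26) % num 2)
    have hw3 : ((num 1 - (num 1 - voteExpr) + reg 26) % num 2).weight ≤ 60000 := by decide
    have hc3' := hc3.trans (Nat.mul_le_mul_right _ hw3)
    have hvote := hmem1.vote_ne_zero hσ.hist_lt
    -- The double truncated difference turns the vote into a bit, and the sum modulo two compares it
    -- with the label.
    have hcond : ((num 1 - (num 1 - voteExpr) + reg 26) % num 2).val m1 ≠ 0 ↔
        σ.hypothesis n m L s (ξ T) ≠ f (ξ T) := by
      simp only [RamExpr.val_mod, RamExpr.val_add, RamExpr.val_sub, RamExpr.val_lit,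
        RamExpr.val_reg, e26]
      rw [e0] at hvote
      rw [LearnState.hypothesis]
      cases hv : σ.value m L s (cubeCode (ξ T))
      · have h0 : voteExpr.val m1 = 0 := by
          by_contra h0
          rw [hvote.1 h0] at hv
          cases hv
        rw [h0]
        cases f (ξ T) <;> simp
      · have h0 : 1 - voteExpr.val m1 = 0 := by have := hvote.2 hv; omega
        rw [h0]
        cases f (ξ T) <;> simp
    by_cases hx : σ.hypothesis n m L s (ξ T) = f (ξ T)
    · have hnext : learnRun m L s f ξ (T + 1) = σ := by rw [learnRun, if_pos hx]
      have hzero : ((num 1 - (num 1 - voteExpr) + reg 26) % num 2).val m1 = 0 := by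
        by_contra h0
        exact hcond.1 h0 hx
      have hexec : Exec (PACCall f) β (.block [(num 29, reg 29 - num 1)]) m1 1000
          fun m' => Holds n m L s σ m' ∧ m' 29 = c - 1 ∧ m' 30 = R := by
        refine Exec.mono (Exec.block hm1b ?_) (by decide) fun _ _ h => h
        have b29 := hm1b 29
        simp only [BlockPost, RamExpr.val_lit, RamExpr.val_sub, RamExpr.val_reg]
        refine ⟨by omega, ?_, ?_, ?_⟩
        · refine hmem1.congr ?_ ?_ ?_ ?_ fun i hi => ?_ <;>
            exact Function.update_of_ne (by omega) _ _
        · rw [Function.update_self, hF 29 (by omega) (by omega), h29]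
        · rw [Function.update_of_ne (by omega), hF 30 (by omega) (by omega), h30]
      obtain ⟨m2, τ2, hr2, hτ2, hb2, hq2, k29, k30⟩ := hexec ⟨ω, fun i => ξ (T + 1 + i)⟩
      obtain ⟨m3, z3, τ3, hr3, hτ3, hb3, T₁, hT₁, hrep, hall⟩ := ih (T + 1) T₀ (c - 1)
        (by omega) (by omega) (by rw [hnext]; omega) (by rw [hnext, hconst]) (fun i hi => by
          rcases Nat.lt_or_ge i (T - T₀) with h | h
          · exact hcorrect i h
          · have : T₀ + i = T := by omega
            rw [this, hconst, hx]) (by rw [hnext]; exact hσ) m2 hb2 (by rw [hnext]; exact hq2)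
          k29 k30
      refine ⟨m3, z3, _, .loop_true (by simp only [RamExpr.val_reg]; omega)
        (.seq (.call hcall) (.cond_false (by exact hzero) hr2)) hr3, ?_, hb3, T₁, by omega,
        hrep, hall⟩
      rw [add_mul k, add_mul _ _ (β + 1)]
      dsimp only
      omega
    · have hnext : learnRun m L s f ξ (T + 1) = σ.next m L s (cubeCode (ξ T)) := by
        rw [learnRun, if_neg hx]
      obtain ⟨hσ', hpot⟩ := hσ.next_of_ne hb hD hDf hx
      have hexec : Exec (PACCall f) β (.seq (updateProg PACOp) (.block [(num 29, reg 30)])) m1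
          (100000 + 1000) fun m' => Holds n m L s (σ.next m L s (cubeCode (ξ T))) m' ∧
            m' 29 = R ∧ m' 30 = R := by
        rw [← e0] at hσ' hxn ⊢
        refine Exec.seq (exec_update P hm1b hb hmem1 hσ hσ' hxn) fun m2 hm2 h2 => ?_
        refine Exec.mono (Exec.block hm2 ?_) (by decide) fun _ _ h => h
        have b30 := hm2 30
        have e30 : m2 30 = R := by
          rw [h2.2 30 (by omega) (by omega), hF 30 (by omega) (by omega), h30]
        simp only [BlockPost, RamExpr.val_lit, RamExpr.val_reg]
        refine ⟨by omega, ?_, ?_, ?_⟩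
        · refine h2.1.congr ?_ ?_ ?_ ?_ fun i hi => ?_ <;>
            exact Function.update_of_ne (by omega) _ _
        · rw [Function.update_self, e30]
        · rw [Function.update_of_ne (by omega), e30]
      obtain ⟨m2, τ2, hr2, hτ2, hb2, hq2, k29, k30⟩ := hexec ⟨ω, fun i => ξ (T + 1 + i)⟩
      -- The unit of potential lost by a mistake pays for restarting the test with `R` examples.
      have hpot' := Nat.mul_le_mul_right R (Nat.succ_le_of_lt hpot)
      rw [Nat.succ_mul] at hpot'
      obtain ⟨m3, z3, τ3, hr3, hτ3, hb3, T₁, hT₁, hrep, hall⟩ := ih (T + 1) (T + 1) R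
        le_rfl (by omega) (by rw [hnext]; omega) rfl (fun i hi => absurd hi (by omega))
        (by rw [hnext]; exact hσ') m2 hb2 (by rw [hnext]; exact hq2) k29 k30
      refine ⟨m3, z3, _, .loop_true (by simp only [RamExpr.val_reg]; omega)
        (.seq (.call hcall) (.cond_true (hcond.2 hx) hr2)) hr3, ?_, hb3, T₁, by omega,
        hrep, hall⟩
      rw [add_mul k, add_mul _ _ (β + 1)]
      dsimp only
      omega

theorem runs_pac (P : Params t n m L s β)
    (hgood : GoodBlock n m L s (fun x => f (cubePoint n x)) b) {k a : ℕ} (hk : k < 2 ^ β)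
    (ha : a < 2 ^ β) (hR : testLength n s k a < 2 ^ β) (ω : ℕ → Bool) (ξ : ℕ → Cube n) :
    ∃ m' z' τ, Runs (PACCall f) (pacLearner t).main
      (Memory.ofList [n, k, a], ⟨ω, ξ⟩) (m', z') τ ∧
      τ ≤ pacTime t n m L s (testLength n s k a) * (β + 1) ∧ m'.Bounded β ∧
      ∃ T < sampleBound n m s (testLength n s k a) + 1,
        Represents hypProg m' ((learnRun m L s f ξ T).hypothesis n m L s) (hypTime m') ∧
        ∀ i < testLength n s k a,
          (learnRun m L s f ξ T).hypothesis n m L s (ξ (T + i)) = f (ξ (T + i)) := by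
  obtain ⟨hb, D, hD, hDf⟩ := hgood
  have hm0 : Memory.Bounded β (Memory.ofList [n, k, a]) := by
    have h1 : n < 2 ^ β := Nat.lt_two_pow_self.trans P.n_lt
    intro i
    rcases i with _ | _ | _ | i
    · exact h1
    · exact hk
    · exact ha
    · simp [Memory.ofList]
  set R := testLength n s k a with hRdef
  have hexec : Exec (PACCall f) β
      (.seq (setupProg PACOp t) (.block pacStart)) (Memory.ofList [n, k, a])
      (setupTime t m L s + 500) fun m' => Holds n m L s ⟨0, fun _ => 0⟩ m' ∧ m' 29 = R ∧
        m' 30 = R := by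
    refine Exec.seq (exec_setup P hm0 rfl fun i hi => ?_) fun m1 hm1 h1 => ?_
    · obtain ⟨j, rfl⟩ : ∃ j, i = j + 3 := ⟨i - 3, by omega⟩
      simp [Memory.ofList]
    · obtain ⟨k3, k5, k7, k24, k25, kT, kS, kF⟩ := h1
      have k1 : m1 1 = k := kF 1 (by omega)
      have k2 : m1 2 = a := kF 2 (by omega)
      have kR : 2 * a * (k + a + 2 * n + s + 5) = R := hRdef.symm
      refine Exec.mono (Exec.block hm1 ?_) (by decide) fun _ _ h => h
      simp only [pacStart, BlockPost, RamExpr.val_lit, RamExpr.val_mul, RamExpr.val_add,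
        RamExpr.val_reg, k1, k2, k3, k7, kR, Function.update_self]
      refine ⟨hR, hR, ?_, trivial, ?_⟩
      · refine (holds_start k3 k5 k24 k25 kT kS).congr ?_ ?_ ?_ ?_ fun i hi => ?_ <;>
          rw [Function.update_of_ne (by omega), Function.update_of_ne (by omega)]
      · rw [Function.update_of_ne (by omega), Function.update_self]
  obtain ⟨m1, τ1, hr1, hτ1, hb1, hh1, h29, h30⟩ := hexec ⟨ω, ξ⟩
  cases hr1 with
  | seq hr0 hr0' =>
    have hpot := LearnState.potential_start_le (s := s) P.m_pos hb
    have hpotR := Nat.mul_le_mul_right R hpot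
    obtain ⟨m2, z2, τ2, hr2, hτ2, hb2, T, hT, hrep, hall⟩ := runs_pac_loop P hb hD hDf ω ξ
      (sampleBound n m s R + 1) 0 0 R le_rfl (by omega)
      (by rw [learnRun, sampleBound, add_mul _ 1, one_mul]; omega) rfl
      (fun i hi => absurd hi (by omega))
      (LearnState.valid_start 0 (Nat.zero_le _) D) m1 hb1 hh1 h29 h30
    simp only [zero_add] at hr2 hT
    refine ⟨m2, z2, _, .seq hr0 (.seq hr0' hr2), ?_, hb2, T, hT, hrep, hall⟩
    rw [pacTime]
    generalize setupTime t m L s = W at *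
    generalize (sampleBound n m s R + 1) * 300000 = U at *
    rw [add_mul W, add_mul 1000]
    rw [add_mul W] at hτ1
    omega

end PAC

/-! ### Correctness of the PAC learner -/

section Prob

variable {n m L s : ℕ} {f : BoolFn n}

theorem learnRun_congr {ξ ξ' : ℕ → Cube n} (T : ℕ) (h : ∀ i < T, ξ i = ξ' i) :
    learnRun m L s f ξ T = learnRun m L s f ξ' T := by
  induction T with
  | zero => rfl
  | succ T ih => rw [learnRun, learnRun, ih fun i hi => h i (by omega), h T (by omega)]

/-- A hypothesis that depends on the first `T` examples and has error more than `δ` is correct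
on the next `R` examples with probability at most `(1 - δ) ^ R`. -/
theorem measure_bad_le (D : Measure (Cube n)) [IsProbabilityMeasure D]
    (H : (ℕ → Cube n) → BoolFn n) (T R : ℕ) (hH : ∀ ξ ξ', (∀ i < T, ξ i = ξ' i) → H ξ = H ξ')
    (δ : ℝ) :
    (Measure.infinitePi fun _ : ℕ => D) {ξ | δ < D.real {x | H ξ x ≠ f x} ∧
      ∀ i < R, H ξ (ξ (T + i)) = f (ξ (T + i))} ≤ ENNReal.ofReal (1 - δ) ^ R := by
  classical
  set B := {ξ : ℕ → Cube n | δ < D.real {x | H ξ x ≠ f x} ∧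
      ∀ i < R, H ξ (ξ (T + i)) = f (ξ (T + i))} with hB
  -- The padding after time `T` is arbitrary, since `H` sees only the first `T` examples.
  set ext : (Fin T → Cube n) → ℕ → Cube n :=
    fun u j => if h : j < T then u ⟨j, h⟩ else fun _ => false with hext
  -- the part of the event with given first examples
  set box : (Fin T → Cube n) → ℕ → Set (Cube n) := fun u j =>
    if j < T then {ext u j} else {x | H (ext u) x = f x} with hbox
  set C : (Fin T → Cube n) → Set (ℕ → Cube n) := fun u =>
    if δ < D.real {x | H (ext u) x ≠ f x} then
      Set.pi (Finset.range (T + R) : Finset ℕ) (box u) else ∅ with hC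
  have hcover : B ⊆ ⋃ u, C u := by
    rintro ξ ⟨h1, h2⟩
    refine Set.mem_iUnion.2 ⟨fun i => ξ i, ?_⟩
    have he : H (ext fun i => ξ i) = H ξ := hH _ _ fun i hi => by simp [hext, hi]
    rw [hC]
    simp only [he, h1, if_true]
    intro j hj
    rw [Finset.coe_range, Set.mem_Iio] at hj
    by_cases hjT : j < T
    · simp [hbox, hjT, hext]
    · have := h2 (j - T) (by omega)
      rw [show T + (j - T) = j by omega] at this
      simp [hbox, hjT, he, this]
  have hmeas : ∀ u, (Measure.infinitePi fun _ : ℕ => D) (C u) ≤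
      (∏ i, D {u i}) * ENNReal.ofReal (1 - δ) ^ R := by
    intro u
    rw [hC]
    dsimp only
    split_ifs with hδ
    · rw [Measure.infinitePi_pi (fun _ : ℕ => D) fun j _ => (Set.toFinite _).measurableSet,
        Finset.prod_range_add, Finset.prod_range fun j => D (box u j)]
      refine mul_le_mul' (le_of_eq ?_) ?_
      · refine Finset.prod_congr rfl fun i _ => ?_
        simp [hbox, hext]
      · have hagree : D {x | H (ext u) x = f x} ≤ ENNReal.ofReal (1 - δ) := by
          have h1 : {x | H (ext u) x = f x} = {x | H (ext u) x ≠ f x}ᶜ := by ext; simp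
          have h2 := probReal_compl_eq_one_sub (μ := D)
            (Set.toFinite {x | H (ext u) x ≠ f x}).measurableSet
          rw [h1, ← ofReal_measureReal]
          exact ENNReal.ofReal_le_ofReal (by linarith)
        calc ∏ i ∈ Finset.range R, D (box u (T + i))
            = ∏ i ∈ Finset.range R, D {x | H (ext u) x = f x} :=
              Finset.prod_congr rfl fun i _ => by simp [hbox]
          _ = D {x | H (ext u) x = f x} ^ R := by simp
          _ ≤ _ := pow_le_pow_left' hagree R
    · simp
  calc (Measure.infinitePi fun _ : ℕ => D) B
      ≤ (Measure.infinitePi fun _ : ℕ => D) (⋃ u, C u) := measure_mono hcover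
    _ ≤ ∑ u, (Measure.infinitePi fun _ : ℕ => D) (C u) := measure_iUnion_fintype_le _ _
    _ ≤ ∑ u : Fin T → Cube n, (∏ i, D {u i}) * ENNReal.ofReal (1 - δ) ^ R :=
        Finset.sum_le_sum fun u _ => hmeas u
    -- Independence has separated the prefix from the test; summed over all prefixes, the prefix
    -- probabilities give one.
    _ = (∏ _i : Fin T, ∑ x : Cube n, D {x}) * ENNReal.ofReal (1 - δ) ^ R := by
        rw [← Finset.sum_mul, Finset.prod_univ_sum, Fintype.piFinset_univ]
    _ = ENNReal.ofReal (1 - δ) ^ R := by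
        have : ∑ x : Cube n, D {x} = 1 := by
          rw [sum_measure_singleton, Finset.coe_univ, measure_univ]
        simp [this]

/-- The number of tests in the union bound itself contains the test length, so the factor `k + a + 2
* n + s + 5` is chosen with room for both and for the confidence `2 ^ k`. -/
theorem sampleBound_mul_le (n m s k a : ℕ) :
    (sampleBound n m s (testLength n s k a) + 1) * 2 ^ k ≤ 4 ^ (k + a + 2 * n + s + 5) := by
  set r := k + a + 2 * n + s + 5 with hr
  have h1 : n * (2 ^ (n - m) * (s + 1)) + 1 ≤ 2 ^ (2 * n + s + 1) := by
    have e1 : n ≤ 2 ^ n := Nat.lt_two_pow_self.le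
    have e2 : 2 ^ (n - m) ≤ 2 ^ n := Nat.pow_le_pow_right (by norm_num) (Nat.sub_le _ _)
    have e3 : s + 1 ≤ 2 ^ s := Nat.lt_two_pow_self
    have e4 := Nat.mul_le_mul e1 (Nat.mul_le_mul e2 e3)
    have e5 : 2 ^ n * (2 ^ n * 2 ^ s) = 2 ^ (2 * n + s) := by rw [← pow_add, ← pow_add]; congr 1; ring
    have e6 : 1 ≤ 2 ^ (2 * n + s) := Nat.one_le_two_pow
    rw [pow_succ]
    omega
  have h2 : testLength n s k a ≤ 2 ^ (1 + a + r) := by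
    rw [testLength, ← hr, pow_add, pow_add, pow_one]
    exact Nat.mul_le_mul (Nat.mul_le_mul_left _ Nat.lt_two_pow_self.le) Nat.lt_two_pow_self.le
  have h3 : sampleBound n m s (testLength n s k a) + 1 ≤ 2 ^ (2 * n + s + 1 + (1 + a + r) + 1) := by
    have e1 := Nat.mul_le_mul h1 h2
    rw [← pow_add] at e1
    have e2 : 1 ≤ 2 ^ (2 * n + s + 1 + (1 + a + r)) := Nat.one_le_two_pow
    rw [pow_succ, sampleBound]
    omega
  calc (sampleBound n m s (testLength n s k a) + 1) * 2 ^ k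
      ≤ 2 ^ (2 * n + s + 1 + (1 + a + r) + 1) * 2 ^ k := Nat.mul_le_mul_right _ h3
    _ = 2 ^ (2 * n + s + 1 + (1 + a + r) + 1 + k) := (pow_add _ _ _).symm
    _ ≤ 2 ^ (2 * r) := Nat.pow_le_pow_right (by norm_num) (by omega)
    _ = 4 ^ r := by rw [pow_mul]; norm_num

/-- Each run of `a` examples contributes a factor at most `exp (-1) ≤ 1 / 2`, and the test consists
of `2 * r` such runs. -/
theorem one_sub_pow_testLength_le {n s k a : ℕ} (ha : 1 ≤ a) :
    (1 - 1 / (a : ℝ)) ^ testLength n s k a ≤ 1 / 4 ^ (k + a + 2 * n + s + 5) := by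
  set r := k + a + 2 * n + s + 5 with hr
  have ha' : (1 : ℝ) ≤ a := by exact_mod_cast ha
  have h0 : 0 ≤ 1 - 1 / (a : ℝ) := by
    rw [sub_nonneg, div_le_one (by linarith)]
    exact ha'
  have h1 : (1 - 1 / (a : ℝ)) ^ a ≤ 1 / 2 := by
    calc (1 - 1 / (a : ℝ)) ^ a ≤ Real.exp (-(1 / (a : ℝ))) ^ a :=
          pow_le_pow_left₀ h0 (Real.one_sub_le_exp_neg _) _
      _ = Real.exp (-1) := by
          rw [← Real.exp_nat_mul]
          congr 1
          field_simp
      _ ≤ 1 / 2 := by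
          rw [Real.exp_neg, one_div]
          have := Real.add_one_le_exp (1 : ℝ)
          exact inv_anti₀ (by norm_num) (by linarith)
  have h2 : testLength n s k a = a * (2 * r) := by rw [testLength, ← hr]; ring
  calc (1 - 1 / (a : ℝ)) ^ testLength n s k a = ((1 - 1 / (a : ℝ)) ^ a) ^ (2 * r) := by
        rw [h2, pow_mul]
    _ ≤ (1 / 2) ^ (2 * r) := pow_le_pow_left₀ (pow_nonneg h0 _) h1 _
    _ = 1 / 4 ^ r := by rw [pow_mul, ← one_div_pow]; norm_num

/-- The probability that one of the hypotheses is bad but passes the test. -/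
theorem measure_exists_bad_le (D : Measure (Cube n)) [IsProbabilityMeasure D] (k : ℕ) {a : ℕ}
    (ha : 1 ≤ a) :
    (Measure.infinitePi fun _ : ℕ => D).real {ξ |
      ∃ T < sampleBound n m s (testLength n s k a) + 1,
        1 / (a : ℝ) < D.real {x | (learnRun m L s f ξ T).hypothesis n m L s x ≠ f x} ∧
        ∀ i < testLength n s k a, (learnRun m L s f ξ T).hypothesis n m L s (ξ (T + i)) =
          f (ξ (T + i))} ≤ (1 / 2) ^ k := by
  set N := sampleBound n m s (testLength n s k a) + 1 with hN
  set R := testLength n s k a with hR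
  set B : ℕ → Set (ℕ → Cube n) := fun T => {ξ |
    1 / (a : ℝ) < D.real {x | (learnRun m L s f ξ T).hypothesis n m L s x ≠ f x} ∧
      ∀ i < R, (learnRun m L s f ξ T).hypothesis n m L s (ξ (T + i)) = f (ξ (T + i))} with hB
  have ha' : (1 : ℝ) ≤ a := by exact_mod_cast ha
  have h0 : 0 ≤ 1 - 1 / (a : ℝ) := by
    rw [sub_nonneg, div_le_one (by linarith)]
    exact ha'
  have hset : {ξ : ℕ → Cube n | ∃ T < N,
        1 / (a : ℝ) < D.real {x | (learnRun m L s f ξ T).hypothesis n m L s x ≠ f x} ∧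
        ∀ i < R, (learnRun m L s f ξ T).hypothesis n m L s (ξ (T + i)) =
          f (ξ (T + i))} = ⋃ T ∈ Finset.range N, B T := by
    ext ξ
    simp only [hB, Set.mem_iUnion, Finset.mem_range, Set.mem_ofPred_eq, exists_prop]
  have hbound : (Measure.infinitePi fun _ : ℕ => D) (⋃ T ∈ Finset.range N, B T) ≤
      ENNReal.ofReal (N * (1 - 1 / (a : ℝ)) ^ R) := by
    refine (measure_biUnion_finset_le _ _).trans ?_
    refine (Finset.sum_le_sum fun T _ => measure_bad_le D
      (fun ξ => (learnRun m L s f ξ T).hypothesis n m L s) T R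
      (fun ξ ξ' h => by rw [learnRun_congr T h]) (1 / (a : ℝ))).trans ?_
    rw [Finset.sum_const, Finset.card_range, nsmul_eq_mul, ENNReal.ofReal_mul (by positivity),
      ENNReal.ofReal_pow h0, ENNReal.ofReal_natCast]
  rw [hset, Measure.real]
  refine (ENNReal.toReal_mono ENNReal.ofReal_ne_top hbound).trans ?_
  rw [ENNReal.toReal_ofReal (mul_nonneg (by positivity) (pow_nonneg h0 _))]
  have h1 := one_sub_pow_testLength_le (n := n) (s := s) (k := k) ha
  have h2 : (N : ℝ) * 2 ^ k ≤ 4 ^ (k + a + 2 * n + s + 5) := by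
    exact_mod_cast sampleBound_mul_le n m s k a
  calc (N : ℝ) * (1 - 1 / (a : ℝ)) ^ R ≤ N * (1 / 4 ^ (k + a + 2 * n + s + 5)) :=
        mul_le_mul_of_nonneg_left h1 (by positivity)
    _ ≤ (1 / 2) ^ k := by
        rw [one_div_pow, mul_one_div, div_le_div_iff₀ (by positivity) (by positivity)]
        linarith

end Prob

/-! ### The choice of the parameters -/

/-- The number of wires of the circuits on a block. -/
def wiresOf (t m : ℕ) : ℕ := (2 * m) ^ t + 1

/-- The number of bits of their codes. -/
def bitsOf (t m : ℕ) : ℕ := (2 * t + 5) * m * wiresOf t m * wiresOf t m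

/-- The number of bits of the numbers in the memory. -/
def widthOf (t n m k a : ℕ) : ℕ :=
  2 * n + 1 + (m + 2) * (bitsOf t m + 1) + k + a + testLength n (bitsOf t m) k a

theorem exists_root (q n : ℕ) (hq : q ≠ 0) : ∃ m, m ^ q ≤ n ∧ n < (m + 1) ^ q := by
  refine ⟨Nat.findGreatest (fun m => m ^ q ≤ n) n, ?_, ?_⟩
  · exact Nat.findGreatest_spec (P := fun m => m ^ q ≤ n) (Nat.zero_le n) (by simp [hq])
  · by_contra! h
    have h1 : Nat.findGreatest (fun m => m ^ q ≤ n) n + 1 ≤ n := (Nat.le_self_pow hq _).trans h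
    exact Nat.findGreatest_is_greatest (Nat.lt_succ_self _) h1 h

theorem table_size_le (m s : ℕ) : (2 * 2 ^ m + 1) ^ (s + 1) ≤ 2 ^ ((m + 2) * (s + 1)) := by
  rw [pow_mul]
  refine Nat.pow_le_pow_left ?_ _
  have := Nat.one_le_two_pow (n := m)
  rw [pow_add]
  omega

theorem params_of_root {t n m k a : ℕ} (hn : 0 < n) (h1 : m ^ (2 * t + 3) ≤ n)
    (h2 : n < (m + 1) ^ (2 * t + 3)) :
    Params t n m (wiresOf t m) (bitsOf t m) (widthOf t n m k a) where
  n_pos := hn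
  root_le := h1
  lt_root := h2
  wires := rfl
  bits := rfl
  size_n := by rw [widthOf]; omega
  size_table := (table_size_le _ _).trans_lt
    (Nat.pow_lt_pow_right (by norm_num) (by rw [widthOf]; omega))

theorem two_mul_le_two_pow (m : ℕ) (hm : 0 < m) : 2 * m ≤ 2 ^ m := by
  obtain ⟨j, rfl⟩ : ∃ j, m = j + 1 := ⟨m - 1, by omega⟩
  have : j < 2 ^ j := Nat.lt_two_pow_self
  rw [pow_succ]
  omega

/-- From `L ≤ 2 ^ ((t + 1) * m)` the gates take at most `(2 * t + 2) * m * L * L` bits, and the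
labels at most `3 * m * L * L`; this explains the factor `2 * t + 5`. -/
theorem codes_le {t m : ℕ} (hm : 0 < m) :
    (4 * 2 ^ m) ^ wiresOf t m * (wiresOf t m * wiresOf t m) ^ (wiresOf t m * wiresOf t m) ≤
      2 ^ bitsOf t m := by
  set L := wiresOf t m with hL
  have hL1 : 1 ≤ L := by rw [hL, wiresOf]; omega
  have h1 : L ≤ 2 ^ ((t + 1) * m) := by
    have e1 : (2 * m) ^ t ≤ (2 ^ m) ^ t := Nat.pow_le_pow_left (two_mul_le_two_pow m hm) t
    have e2 : 2 ^ 1 ≤ 2 ^ m := Nat.pow_le_pow_right (by norm_num) hm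
    have e3 : 1 ≤ (2 ^ m) ^ t := Nat.one_le_pow _ _ (by positivity)
    have e4 : 2 ^ ((t + 1) * m) = (2 ^ m) ^ t * 2 ^ m := by rw [← pow_succ, ← pow_mul]; congr 1; ring
    rw [e4, hL, wiresOf]
    nlinarith
  have h2 : (4 * 2 ^ m) ^ L = 2 ^ ((m + 2) * L) := by
    rw [pow_mul, pow_add]; congr 1; ring
  have h3 : (L * L) ^ (L * L) ≤ 2 ^ (2 * ((t + 1) * m) * (L * L)) := by
    have e := Nat.pow_le_pow_left (Nat.mul_le_mul h1 h1) (L * L)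
    rwa [← pow_add, ← two_mul, ← pow_mul] at e
  rw [h2]
  refine (Nat.mul_le_mul_left _ h3).trans ?_
  rw [← pow_add]
  refine Nat.pow_le_pow_right (by norm_num) ?_
  have e1 : (m + 2) * L ≤ 3 * m * (L * L) :=
    Nat.mul_le_mul (by omega) (Nat.le_mul_of_pos_left _ hL1)
  rw [bitsOf, ← hL]
  nlinarith

/-- Averaging gives `a ≤ 2 * m * n ^ (1 / 2 - ε)`. With `n ≤ (2 * m) ^ (2 * t + 3)` the last power
is at most `(2 * m) ^ (t - 1)`, because `(2 * t + 3) / 2 - 5 / 2 = t - 1`. -/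
theorem wires_bound {t n m ℓ a : ℕ} {ε : ℝ} (hn : 0 < n) (hε : ε ≤ 1 / 2)
    (ht : 5 / 2 ≤ (2 * t + 3) * ε) (h1 : m ^ (2 * t + 3) ≤ n) (hm : 0 < m)
    (h2 : n < (m + 1) ^ (2 * t + 3)) (hℓ : (ℓ : ℝ) ≤ (n : ℝ) ^ (3 / 2 - ε))
    (ha : a * (n / m) ≤ ℓ) : a + 1 ≤ wiresOf t m := by
  have hmn : m ≤ n := (Nat.le_self_pow (by omega) m).trans h1
  have hnR : (0 : ℝ) < n := by exact_mod_cast hn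
  have hn2 : n ≤ 2 * m * (n / m) := by
    have e1 := Nat.div_add_mod n m
    have e2 := Nat.mod_lt n hm
    have e3 : m * 1 ≤ m * (n / m) := Nat.mul_le_mul_left _ (Nat.div_pos hmn hm)
    have e4 : 2 * m * (n / m) = 2 * (m * (n / m)) := by ring
    omega
  have h3 : (a : ℝ) * n ≤ 2 * m * (n : ℝ) ^ (3 / 2 - ε) := by
    have e1 : a * n ≤ 2 * m * ℓ := by
      calc a * n ≤ a * (2 * m * (n / m)) := Nat.mul_le_mul_left _ hn2
        _ = 2 * m * (a * (n / m)) := by ring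
        _ ≤ 2 * m * ℓ := Nat.mul_le_mul_left _ ha
    have e2 : (a : ℝ) * n ≤ 2 * m * ℓ := by exact_mod_cast e1
    exact e2.trans (mul_le_mul_of_nonneg_left hℓ (by positivity))
  have h4 : (n : ℝ) ^ (3 / 2 - ε) = (n : ℝ) ^ (1 / 2 - ε) * n := by
    rw [← Real.rpow_add_one hnR.ne']
    congr 1
    ring
  have h5 : (a : ℝ) ≤ 2 * m * (n : ℝ) ^ (1 / 2 - ε) := by
    rw [h4, ← mul_assoc] at h3
    exact le_of_mul_le_mul_right h3 hnR
  have hmR : (1 : ℝ) ≤ 2 * m := by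
    have : (1 : ℝ) ≤ m := by exact_mod_cast hm
    linarith
  have h6 : (n : ℝ) ^ (1 / 2 - ε) ≤ (2 * m : ℝ) ^ ((t : ℝ) - 1) := by
    have e1 : (n : ℝ) ≤ (2 * m : ℝ) ^ (2 * t + 3) := by
      have : n ≤ (2 * m) ^ (2 * t + 3) := h2.le.trans (Nat.pow_le_pow_left (by omega) _)
      exact_mod_cast this
    calc (n : ℝ) ^ (1 / 2 - ε) ≤ ((2 * m : ℝ) ^ (2 * t + 3)) ^ (1 / 2 - ε) :=
          Real.rpow_le_rpow hnR.le e1 (by linarith)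
      _ = (2 * m : ℝ) ^ (((2 * t + 3 : ℕ) : ℝ) * (1 / 2 - ε)) := by
          rw [← Real.rpow_natCast, ← Real.rpow_mul (by linarith)]
      _ ≤ (2 * m : ℝ) ^ ((t : ℝ) - 1) := by
          refine Real.rpow_le_rpow_of_exponent_le hmR ?_
          push_cast
          linarith
  have h7 : (a : ℝ) ≤ (2 * m : ℝ) ^ t := by
    refine (h5.trans (mul_le_mul_of_nonneg_left h6 (by linarith))).trans_eq ?_
    have h0 : (0 : ℝ) < 2 * m := by linarith
    rw [mul_comm, ← Real.rpow_add_one h0.ne', sub_add_cancel, Real.rpow_natCast]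
  have h8 : a ≤ (2 * m) ^ t := by exact_mod_cast h7
  rw [wiresOf]
  omega

/-! ### The running time -/

/-- Polynomially bounded functions of the parameters. -/
def PolyBounded (g : ℕ → ℕ → ℕ → ℕ → ℕ) : Prop :=
  ∃ A, ∀ n m k a, m ≤ n → g n m k a ≤ A * (n + k + a + 1) ^ A

namespace PolyBounded

variable {g h : ℕ → ℕ → ℕ → ℕ → ℕ}

theorem const (c : ℕ) : PolyBounded fun _ _ _ _ => c :=
  ⟨c, fun n _ k a _ => Nat.le_mul_of_pos_right _ (by positivity)⟩

theorem of_le (hg : ∀ n m k a, m ≤ n → g n m k a ≤ n + k + a + 1) : PolyBounded g :=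
  ⟨1, fun n m k a hm => by simpa using hg n m k a hm⟩

theorem add (hg : PolyBounded g) (hh : PolyBounded h) :
    PolyBounded fun n m k a => g n m k a + h n m k a := by
  obtain ⟨A, hA⟩ := hg
  obtain ⟨B, hB⟩ := hh
  refine ⟨A + B, fun n m k a hm => ?_⟩
  rw [add_mul]
  exact add_le_add
    ((hA n m k a hm).trans (Nat.mul_le_mul_left _ (Nat.pow_le_pow_right (by omega) (by omega))))
    ((hB n m k a hm).trans (Nat.mul_le_mul_left _ (Nat.pow_le_pow_right (by omega) (by omega))))

theorem mul (hg : PolyBounded g) (hh : PolyBounded h) :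
    PolyBounded fun n m k a => g n m k a * h n m k a := by
  obtain ⟨A, hA⟩ := hg
  obtain ⟨B, hB⟩ := hh
  refine ⟨A * B + A + B, fun n m k a hm => ?_⟩
  calc g n m k a * h n m k a
      ≤ A * (n + k + a + 1) ^ A * (B * (n + k + a + 1) ^ B) :=
        Nat.mul_le_mul (hA n m k a hm) (hB n m k a hm)
    _ = A * B * (n + k + a + 1) ^ (A + B) := by ring
    _ ≤ (A * B + A + B) * (n + k + a + 1) ^ (A * B + A + B) :=
        Nat.mul_le_mul (by omega) (Nat.pow_le_pow_right (by omega) (by omega))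

theorem pow (hg : PolyBounded g) (e : ℕ) : PolyBounded fun n m k a => g n m k a ^ e := by
  induction e with
  | zero => exact const 1
  | succ e ih => simpa only [pow_succ] using ih.mul hg

theorem n : PolyBounded fun n _ _ _ => n := of_le fun _ _ _ _ _ => by omega
theorem m : PolyBounded fun _ m _ _ => m := of_le fun _ _ _ _ _ => by omega
theorem k : PolyBounded fun _ _ k _ => k := of_le fun _ _ _ _ _ => by omega
theorem a : PolyBounded fun _ _ _ a => a := of_le fun _ _ _ _ _ => by omega

end PolyBounded

open PolyBounded in
theorem polyBounded_wiresOf (t : ℕ) : PolyBounded fun _ m _ _ => wiresOf t m :=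
  (((const 2).mul m).pow t).add (const 1)

open PolyBounded in
theorem polyBounded_bitsOf (t : ℕ) : PolyBounded fun _ m _ _ => bitsOf t m :=
  (((const (2 * t + 5)).mul m).mul (polyBounded_wiresOf t)).mul (polyBounded_wiresOf t)

open PolyBounded in
theorem polyBounded_testLength (t : ℕ) :
    PolyBounded fun n m k a => testLength n (bitsOf t m) k a :=
  ((const 2).mul a).mul
    ((((k.add a).add ((const 2).mul n)).add (polyBounded_bitsOf t)).add (const 5))

open PolyBounded in
theorem polyBounded_widthOf (t : ℕ) : PolyBounded fun n m k a => widthOf t n m k a :=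
  ((((((const 2).mul n).add (const 1)).add ((m.add (const 2)).mul
    ((polyBounded_bitsOf t).add (const 1)))).add k).add a).add (polyBounded_testLength t)

open PolyBounded in
theorem polyBounded_codeTime (t : ℕ) :
    PolyBounded fun _ m _ _ => codeTime (wiresOf t m) (bitsOf t m) :=
  have hL := polyBounded_wiresOf t
  (const 1000).add (((polyBounded_bitsOf t).add (const 2)).mul
    ((((const 5000).add ((hL.add (const 1)).mul (const 1000))).add
      (((hL.mul hL).add (const 1)).mul (const 1000))).add (const 100)))

/-- The table is small compared with the number of subfunctions. -/
theorem exponent_le {t n m : ℕ} (hm : 0 < m) (h1 : m ^ (2 * t + 3) ≤ n) :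
    (m + 2) * (bitsOf t m + 1) + 1 + (bitsOf t m + 1) + m ≤
      n + (10 * (2 * t + 5) * 4 ^ (t + 1)) ^ (2 * t + 3) := by
  set C := 10 * (2 * t + 5) * 4 ^ (t + 1) with hC
  have hL : wiresOf t m ≤ 2 * (2 * m) ^ t := by
    have : 1 ≤ (2 * m) ^ t := Nat.one_le_pow _ _ (by omega)
    rw [wiresOf]
    omega
  have hs : bitsOf t m ≤ (2 * t + 5) * 4 ^ (t + 1) * m ^ (2 * t + 1) := by
    rw [bitsOf, mul_assoc _ (wiresOf t m)]
    refine (Nat.mul_le_mul_left _ (Nat.mul_le_mul hL hL)).trans_eq ?_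
    rw [mul_pow, show (4 : ℕ) = 2 ^ 2 by norm_num, ← pow_mul]
    ring
  have hs1 : 1 ≤ bitsOf t m := by
    have : 0 < wiresOf t m := by rw [wiresOf]; omega
    rw [bitsOf]
    exact Nat.succ_le_of_lt (by positivity)
  have h2 : (m + 2) * (bitsOf t m + 1) + 1 + (bitsOf t m + 1) + m ≤ 10 * m * bitsOf t m := by
    have e1 : (m + 2) * (bitsOf t m + 1) ≤ 3 * m * (2 * bitsOf t m) :=
      Nat.mul_le_mul (by omega) (by omega)
    have e2 : bitsOf t m ≤ m * bitsOf t m := Nat.le_mul_of_pos_left _ hm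
    have e3 : m ≤ m * bitsOf t m := Nat.le_mul_of_pos_right _ hs1
    have e4 : 3 * m * (2 * bitsOf t m) = 6 * (m * bitsOf t m) := by ring
    have e5 : 10 * m * bitsOf t m = 10 * (m * bitsOf t m) := by ring
    omega
  have h3 : 10 * m * bitsOf t m ≤ C * m ^ (2 * t + 2) := by
    refine (Nat.mul_le_mul_left _ hs).trans_eq ?_
    rw [hC]
    ring
  refine h2.trans (h3.trans ?_)
  -- One factor `m` is left in `n` to absorb the constant `C` when `m` is large; for small `m`
  -- everything is bounded by a constant depending on `t`.
  rcases Nat.le_total C m with h | h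
  · calc C * m ^ (2 * t + 2) ≤ m * m ^ (2 * t + 2) := Nat.mul_le_mul_right _ h
      _ = m ^ (2 * t + 3) := by ring
      _ ≤ _ := by omega
  · calc C * m ^ (2 * t + 2) ≤ C * C ^ (2 * t + 2) :=
          Nat.mul_le_mul_left _ (Nat.pow_le_pow_left h _)
      _ = C ^ (2 * t + 3) := by ring
      _ ≤ _ := by omega

/-- The table has one entry per history, each costs `2 ^ s` code checks, and `exponent_le` fits the
product of both into `2 ^ (n - m)` up to a constant factor. -/
theorem table_time_le {t n m : ℕ} (hm : 0 < m) (h1 : m ^ (2 * t + 3) ≤ n) :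
    ((2 * 2 ^ m + 1) ^ (bitsOf t m + 1) + 1) * (entryTime (wiresOf t m) (bitsOf t m) + 100) ≤
      2 ^ (n - m) * (2 ^ (10 * (2 * t + 5) * 4 ^ (t + 1)) ^ (2 * t + 3) *
        (codeTime (wiresOf t m) (bitsOf t m) + 1200)) := by
  set s := bitsOf t m with hs
  have hmn : m ≤ n := (Nat.le_self_pow (by omega) m).trans h1
  have e1 : (2 * 2 ^ m + 1) ^ (s + 1) + 1 ≤ 2 ^ ((m + 2) * (s + 1) + 1) := by
    have := table_size_le m s
    have := Nat.one_le_two_pow (n := (m + 2) * (s + 1))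
    rw [pow_succ 2]
    omega
  have e2 : entryTime (wiresOf t m) s + 100 ≤
      2 ^ (s + 1) * (codeTime (wiresOf t m) s + 1200) := by
    have h2 := Nat.one_le_two_pow (n := s)
    rw [entryTime, pow_succ]
    nlinarith
  have e3 := exponent_le hm h1
  rw [← hs] at e3
  calc _ ≤ 2 ^ ((m + 2) * (s + 1) + 1) * (2 ^ (s + 1) * (codeTime (wiresOf t m) s + 1200)) :=
        Nat.mul_le_mul e1 e2
    _ = 2 ^ ((m + 2) * (s + 1) + 1 + (s + 1)) * (codeTime (wiresOf t m) s + 1200) := by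
        rw [pow_add _ _ (s + 1)]; ring
    _ ≤ 2 ^ (n - m + (10 * (2 * t + 5) * 4 ^ (t + 1)) ^ (2 * t + 3)) *
        (codeTime (wiresOf t m) s + 1200) :=
        Nat.mul_le_mul_right _ (Nat.pow_le_pow_right (by norm_num) (by omega))
    _ = _ := by rw [pow_add, mul_assoc]

/-- A common bound for the running times. -/
theorem exists_time_bound (t : ℕ) : ∃ A, ∀ n m k a, 0 < m → m ^ (2 * t + 3) ≤ n →
    (exactTime t n m (wiresOf t m) (bitsOf t m) + 30000) * (widthOf t n m k a + 1) ≤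
      2 ^ (n - m) * (A * (n + k + a + 1) ^ A) ∧
    (pacTime t n m (wiresOf t m) (bitsOf t m) (testLength n (bitsOf t m) k a) + 30000) *
      (widthOf t n m k a + 1) ≤ 2 ^ (n - m) * (A * (n + k + a + 1) ^ A) := by
  have hs := polyBounded_bitsOf t
  have hR := polyBounded_testLength t
  have hw := (polyBounded_widthOf t).add (.const 1)
  have hsetup := (((PolyBounded.m.add hs).add (.const 4)).mul (.const (setupConst t))).add
    ((PolyBounded.const (2 ^ (10 * (2 * t + 5) * 4 ^ (t + 1)) ^ (2 * t + 3))).mul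
      ((polyBounded_codeTime t).add (.const 1200)))
  have hq := (PolyBounded.n.mul (hs.add (.const 1))).add (.const 1)
  obtain ⟨A, hA⟩ := ((hsetup.add (((PolyBounded.const 1000).add
    (((hq.mul hR).add (.const 1)).mul (.const 300000))).add
    (hq.mul (.const 200000)))).add (.const 30000)).mul hw
  refine ⟨A, fun n m k a hm h1 => ?_⟩
  have hmn : m ≤ n := (Nat.le_self_pow (by omega) m).trans h1
  have hA := hA n m k a hmn
  beta_reduce at hA
  have ht := table_time_le hm h1
  set s := bitsOf t m
  set R := testLength n s k a
  set W := widthOf t n m k a + 1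
  set Z := 2 ^ (n - m) with hZ
  have hZ1 : 1 ≤ Z := Nat.one_le_two_pow
  have le_Z : ∀ x, x ≤ Z * x := fun x => Nat.le_mul_of_pos_left x hZ1
  have hset : setupTime t m (wiresOf t m) s ≤ Z * ((m + s + 4) * setupConst t +
      2 ^ (10 * (2 * t + 5) * 4 ^ (t + 1)) ^ (2 * t + 3) *
        (codeTime (wiresOf t m) s + 1200)) := by
    rw [setupTime, mul_add Z]
    exact add_le_add (le_Z _) ht
  have hmist : n * (Z * (s + 1)) + 1 ≤ Z * (n * (s + 1) + 1) := by
    have : Z * (n * (s + 1) + 1) = n * (Z * (s + 1)) + Z := by ring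
    omega
  generalize (m + s + 4) * setupConst t + 2 ^ (10 * (2 * t + 5) * 4 ^ (t + 1)) ^ (2 * t + 3) *
        (codeTime (wiresOf t m) s + 1200) = G at *
  generalize hQ : n * (s + 1) + 1 = Q at *
  generalize hT : setupTime t m (wiresOf t m) s = T at *
  clear_value W R s
  -- One polynomial dominates both learners; the extra `30000` covers the evaluation of the final
  -- hypothesis.
  have fin : ∀ x, x + 30000 ≤ Z * (G + (1000 + (Q * R + 1) * 300000 + Q * 200000) + 30000) →
      (x + 30000) * W ≤ Z * (A * (n + k + a + 1) ^ A) := fun x hx => by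
    refine (Nat.mul_le_mul_right W hx).trans ?_
    exact (Nat.mul_assoc _ _ _).le.trans (Nat.mul_le_mul_left _ hA)
  have expand : Z * (G + (1000 + (Q * R + 1) * 300000 + Q * 200000) + 30000) =
      Z * G + 1000 * Z + 300000 * (Z * Q * R) + 300000 * Z + 200000 * (Z * Q) + 30000 * Z := by
    ring
  refine ⟨fin _ ?_, fin _ ?_⟩
  · rw [expand, exactTime, ← hZ, hT]
    have z1 := Nat.zero_le (Z * Q * R)
    have z2 := Nat.zero_le (Z * Q)
    linarith
  · have h3 := Nat.mul_le_mul_right R hmist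
    rw [expand, pacTime, sampleBound, ← hZ, hT]
    have z1 := Nat.zero_le (Z * Q * R)
    have z2 := Nat.zero_le (Z * Q)
    linarith

/-! ### The main theorem -/

/-- Rounding the root down costs at most one in the exponent, hence the factor two. -/
theorem two_pow_sub_le {n m : ℕ} {δ : ℝ} (hmn : m ≤ n) (h : (n : ℝ) ^ δ ≤ m + 1) :
    ((2 ^ (n - m) : ℕ) : ℝ) ≤ 2 * (2 : ℝ) ^ ((n : ℝ) - (n : ℝ) ^ δ) := by
  have h2 : (2 : ℝ) * (2 : ℝ) ^ ((n : ℝ) - (n : ℝ) ^ δ) = (2 : ℝ) ^ ((n : ℝ) - (n : ℝ) ^ δ + 1) := by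
    rw [Real.rpow_add_one (by norm_num), mul_comm]
  rw [h2, Nat.cast_pow, Nat.cast_ofNat, ← Real.rpow_natCast, Nat.cast_sub hmn]
  exact Real.rpow_le_rpow_of_exponent_le (by norm_num) (by linarith)

theorem exists_parameters {ε : ℝ} (hε : 0 < ε) : ∃ t : ℕ, ∀ n : ℕ,
    ∀ f ∈ comparatorClass n ((n : ℝ) ^ (3 / 2 - ε)), ∃ m b, 0 < n ∧ 0 < m ∧
      m ^ (2 * t + 3) ≤ n ∧ n < (m + 1) ^ (2 * t + 3) ∧ (n : ℝ) ^ (1 / 15 * ε) ≤ m + 1 ∧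
      GoodBlock n m (wiresOf t m) (bitsOf t m) (fun x => f (cubePoint n x)) b := by
  -- Capping at `1 / 2` keeps the exponent `1 / 2 - η` in `wires_bound` non-negative.
  set η := min ε (1 / 2) with hη
  have hη0 : 0 < η := lt_min hε (by norm_num)
  have hη1 : η ≤ 1 / 2 := min_le_right _ _
  obtain ⟨t, ht1, ht2⟩ : ∃ t : ℕ, 5 / (4 * η) ≤ t ∧ (t : ℝ) < 5 / (4 * η) + 1 :=
    ⟨⌈5 / (4 * η)⌉₊, Nat.le_ceil _, Nat.ceil_lt_add_one (by positivity)⟩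
  have ht3 : 5 / 4 ≤ t * η := by
    rw [div_le_iff₀ (by positivity)] at ht1
    linarith
  have ht4 : t * η < 5 / 4 + η := by
    have := mul_lt_mul_of_pos_right ht2 hη0
    have e : (5 / (4 * η) + 1) * η = 5 / 4 + η := by field_simp
    linarith
  refine ⟨t, fun n f hf => ?_⟩
  obtain ⟨ℓ, hℓ, C, rfl⟩ := hf
  -- The label of the output wire is a variable, so there is nothing to learn for `n = 0`.
  have hn : 0 < n := (Nat.zero_le _).trans_lt (C.label C.output).1.isLt
  have hℓ1 : (1 : ℝ) ≤ ℓ := by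
    have : 0 < ℓ := (Nat.zero_le _).trans_lt C.output.isLt
    exact_mod_cast this
  have hn1 : (1 : ℝ) ≤ n := by exact_mod_cast hn
  obtain ⟨m, h1, h2⟩ := exists_root (2 * t + 3) n (by omega)
  have hm : 0 < m := by
    rcases Nat.eq_zero_or_pos m with rfl | h
    · simp at h2; omega
    · exact h
  have hmn : m ≤ n := (Nat.le_self_pow (by omega) m).trans h1
  have hroot : (n : ℝ) ^ (1 / 5 * η) ≤ m + 1 := by
    have e1 : (n : ℝ) ≤ ((m : ℝ) + 1) ^ (2 * t + 3) := by exact_mod_cast h2.le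
    calc (n : ℝ) ^ (1 / 5 * η) ≤ (((m : ℝ) + 1) ^ (2 * t + 3)) ^ (1 / 5 * η) :=
          Real.rpow_le_rpow (by linarith) e1 (by positivity)
      _ = ((m : ℝ) + 1) ^ (((2 * t + 3 : ℕ) : ℝ) * (1 / 5 * η)) := by
          rw [← Real.rpow_natCast, ← Real.rpow_mul (by positivity)]
      _ ≤ ((m : ℝ) + 1) ^ (1 : ℝ) := by
          -- From `t * η < 5 / 4 + η` and `η ≤ 1 / 2` follows `(2 * t + 3) * η ≤ 5`; this is where
          -- `1 / 5` comes from.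
          refine Real.rpow_le_rpow_of_exponent_le (by linarith [Nat.cast_nonneg (α := ℝ) m]) ?_
          push_cast
          nlinarith
      _ = m + 1 := Real.rpow_one _
  have hexp : (n : ℝ) ^ (1 / 15 * ε) ≤ (n : ℝ) ^ (1 / 5 * η) := by
    rcases hn1.eq_or_lt with h | h
    · rw [← h, Real.one_rpow, Real.one_rpow]
    -- For larger `ε` and `n > 1` fewer than one wire would be allowed. Hence `η ≥ ε / 3`, which
    -- turns `1 / 5` into the final constant `1 / 15`.
    · have hε' : ε ≤ 3 / 2 := by
        by_contra! hlt
        have := Real.rpow_lt_one_of_one_lt_of_neg h (show 3 / 2 - ε < 0 by linarith)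
        linarith
      refine Real.rpow_le_rpow_of_exponent_le hn1 ?_
      rcases min_choice ε (1 / 2) with h' | h' <;> rw [hη, h'] <;> linarith
  have hℓη : (ℓ : ℝ) ≤ (n : ℝ) ^ (3 / 2 - η) :=
    hℓ.trans (Real.rpow_le_rpow_of_exponent_le hn1 (by linarith [min_le_left ε (1 / 2)]))
  obtain ⟨b, hb⟩ := exists_goodBlock C hm hmn
    (fun a ha => wires_bound hn hη1 (by linarith) h1 hm h2 hℓη ha) (codes_le hm)
  exact ⟨m, b, hn, hm, h1, h2, hexp.trans hroot, hb⟩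

theorem time_le_of_le {n m A X τ : ℕ} {δ : ℝ} (hmn : m ≤ n) (h : (n : ℝ) ^ δ ≤ m + 1)
    (hX : 1 ≤ X) (hτ : τ ≤ 2 ^ (n - m) * (A * X ^ A)) :
    (τ : ℝ) ≤ (2 : ℝ) ^ ((n : ℝ) - (n : ℝ) ^ δ) * ((2 * A : ℕ) * (X : ℝ) ^ (2 * A)) := by
  have h1 : (τ : ℝ) ≤ ((2 ^ (n - m) : ℕ) : ℝ) * (A * (X : ℝ) ^ A) := by exact_mod_cast hτ
  have hX' : (1 : ℝ) ≤ X := by exact_mod_cast hX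
  have h2 : (X : ℝ) ^ A ≤ (X : ℝ) ^ (2 * A) := pow_le_pow_right₀ hX' (by omega)
  calc (τ : ℝ) ≤ ((2 ^ (n - m) : ℕ) : ℝ) * (A * (X : ℝ) ^ A) := h1
    _ ≤ 2 * (2 : ℝ) ^ ((n : ℝ) - (n : ℝ) ^ δ) * (A * (X : ℝ) ^ (2 * A)) :=
        mul_le_mul (two_pow_sub_le hmn h) (mul_le_mul_of_nonneg_left h2 (by positivity))
          (by positivity) (by positivity)
    _ = _ := by push_cast; ring

theorem exact_learning {ε : ℝ} (hε : 0 < ε) : ∃ (L : Learner ExactOp) (A : ℕ),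
    L.LearnsExactly (fun n => comparatorClass n ((n : ℝ) ^ (3 / 2 - ε)))
      (fun n k => (2 : ℝ) ^ ((n : ℝ) - (n : ℝ) ^ (1 / 15 * ε)) *
        (A * ((n : ℝ) + k + 1) ^ A)) := by
  obtain ⟨t, ht⟩ := exists_parameters hε
  obtain ⟨A, hA⟩ := exists_time_bound t
  refine ⟨exactLearner t, 2 * A, fun n k f hf O => ?_⟩
  obtain ⟨m, b, hn, hm, h1, h2, hδ, hgood⟩ := ht n f hf
  have hmn : m ≤ n := (Nat.le_self_pow (by omega) m).trans h1
  -- The accuracy parameter is absent from exact learning and is set to zero.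
  have hA := (hA n m k 0 hm h1).1
  set β := widthOf t n m k 0 with hβ
  have P : Params t n m (wiresOf t m) (bitsOf t m) β := params_of_root hn h1 h2
  have hk : k < 2 ^ β := lt_of_le_of_lt (by rw [hβ, widthOf]; omega) Nat.lt_two_pow_self
  have time : ∀ τ : ℕ,
      τ ≤ (exactTime t n m (wiresOf t m) (bitsOf t m) + 30000) * (β + 1) →
      (τ : ℝ) ≤ (2 : ℝ) ^ ((n : ℝ) - (n : ℝ) ^ (1 / 15 * ε)) *
        ((2 * A : ℕ) * ((n : ℝ) + k + 1) ^ (2 * A)) := fun τ hτ => by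
    have := time_le_of_le (X := n + k + 0 + 1) hmn hδ (by omega) (hτ.trans hA)
    simpa using this
  have run : ∀ ω, ∃ mem, (exactLearner t).ExactHalts f O k
      ((2 : ℝ) ^ ((n : ℝ) - (n : ℝ) ^ (1 / 15 * ε)) *
        ((2 * A : ℕ) * ((n : ℝ) + k + 1) ^ (2 * A))) ω mem ∧
      HoldsHypothesis (exactLearner t).hyp mem
        ((2 : ℝ) ^ ((n : ℝ) - (n : ℝ) ^ (1 / 15 * ε)) *
        ((2 * A : ℕ) * ((n : ℝ) + k + 1) ^ (2 * A))) fun h => h = f := fun ω => by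
    obtain ⟨mem, z, τ, hr, hτ, hrep, hb⟩ := runs_exact P O hgood hk ω
    refine ⟨mem, ⟨z, τ, time τ (hτ.trans (Nat.mul_le_mul_right _ (Nat.le_add_right _ _))), hr⟩,
      f, _, hrep, fun x => time _ ?_, rfl⟩
    exact (hypTime_le hb P.n_lt.le x).trans (Nat.mul_le_mul_right _ (Nat.le_add_left _ _))
  refine ⟨fun ω => ⟨_, (run ω).choose_spec.1⟩, ?_⟩
  have : IsProbabilityMeasure coinMeasure := by unfold coinMeasure; infer_instance
  -- The learner succeeds for every sequence of coins.
  rw [Set.eq_univ_of_forall (s := {ω | ∃ mem, _ ∧ _}) fun ω => run ω, probReal_univ]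
  have : (0 : ℝ) ≤ (1 / 2) ^ k := by positivity
  linarith

theorem pac_learning {ε : ℝ} (hε : 0 < ε) : ∃ (L : Learner PACOp) (A : ℕ),
    L.PACLearns (fun n => comparatorClass n ((n : ℝ) ^ (3 / 2 - ε)))
      (fun n k a => (2 : ℝ) ^ ((n : ℝ) - (n : ℝ) ^ (1 / 15 * ε)) *
        (A * ((n : ℝ) + k + a + 1) ^ A)) := by
  obtain ⟨t, ht⟩ := exists_parameters hε
  obtain ⟨A, hA⟩ := exists_time_bound t
  refine ⟨pacLearner t, 2 * A, fun n k a ha f hf D _ => ?_⟩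
  obtain ⟨m, b, hn, hm, h1, h2, hδ, hgood⟩ := ht n f hf
  have hmn : m ≤ n := (Nat.le_self_pow (by omega) m).trans h1
  have hA := (hA n m k a hm h1).2
  set L := wiresOf t m
  set s := bitsOf t m with hs
  set R := testLength n s k a with hR
  set β := widthOf t n m k a with hβ
  have P : Params t n m L s β := params_of_root hn h1 h2
  have hw : k ≤ β ∧ a ≤ β ∧ R ≤ β := by
    rw [hβ, widthOf, ← hs, ← hR]
    omega
  have time : ∀ τ : ℕ, τ ≤ (pacTime t n m L s R + 30000) * (β + 1) →
      (τ : ℝ) ≤ (2 : ℝ) ^ ((n : ℝ) - (n : ℝ) ^ (1 / 15 * ε)) *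
        ((2 * A : ℕ) * ((n : ℝ) + k + a + 1) ^ (2 * A)) := fun τ hτ => by
    have := time_le_of_le (X := n + k + a + 1) hmn hδ (by omega) (hτ.trans hA)
    simpa using this
  have run := fun ω ξ => runs_pac P hgood (hw.1.trans_lt Nat.lt_two_pow_self)
    (hw.2.1.trans_lt Nat.lt_two_pow_self) (hw.2.2.trans_lt Nat.lt_two_pow_self) ω ξ
  refine ⟨fun ω ξ => ?_, ?_⟩
  · obtain ⟨mem, z, τ, hr, hτ, -⟩ := run ω ξ
    exact ⟨mem, z, τ, time τ (hτ.trans (Nat.mul_le_mul_right _ (Nat.le_add_right _ _))), hr⟩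
  have hcoin : IsProbabilityMeasure coinMeasure := by unfold coinMeasure; infer_instance
  set μ := Measure.infinitePi fun _ : ℕ => D with hμ
  set B : Set (ℕ → Cube n) := {ξ | ∃ T < sampleBound n m s R + 1,
    1 / (a : ℝ) < D.real {x | (learnRun m L s f ξ T).hypothesis n m L s x ≠ f x} ∧
    ∀ i < R, (learnRun m L s f ξ T).hypothesis n m L s (ξ (T + i)) = f (ξ (T + i))} with hB
  have hbad : μ.real B ≤ (1 / 2) ^ k := measure_exists_bad_le D k ha
  -- Subadditivity and monotonicity suffice, so measurability of `B` and of the success event is not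
  -- needed.
  have hgoodB : 1 - (1 / 2 : ℝ) ^ k ≤ (coinMeasure.prod μ).real (Set.univ ×ˢ Bᶜ) := by
    rw [measureReal_prod_prod, probReal_univ, one_mul]
    have h3 := measureReal_union_le (μ := μ) B Bᶜ
    rw [Set.union_compl_self, probReal_univ] at h3
    linarith
  refine hgoodB.trans (measureReal_mono ?_)
  rintro ⟨ω, ξ⟩ ⟨-, hξ⟩
  obtain ⟨mem, z, τ, hr, hτ, hb, T, hT, hrep, hall⟩ := run ω ξ
  refine ⟨mem, ⟨z, τ, time τ (hτ.trans (Nat.mul_le_mul_right _ (Nat.le_add_right _ _))), hr⟩,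
    _, _, hrep, fun x => time _ ?_, ?_⟩
  · exact (hypTime_le hb P.n_lt.le x).trans (Nat.mul_le_mul_right _ (Nat.le_add_left _ _))
  · by_contra! hlt
    exact hξ ⟨T, hT, hlt, hall⟩

theorem mainTheorem7 :
    ∃ c : ℝ, 0 < c ∧ ∀ ε : ℝ, 0 < ε →
      (∃ (L : Learner ExactOp) (A : ℕ),
        L.LearnsExactly (fun n => comparatorClass n ((n : ℝ) ^ (3 / 2 - ε)))
          (fun n k => (2 : ℝ) ^ ((n : ℝ) - (n : ℝ) ^ (c * ε)) * (A * ((n : ℝ) + k + 1) ^ A))) ∧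
      (∃ (L : Learner PACOp) (A : ℕ),
        L.PACLearns (fun n => comparatorClass n ((n : ℝ) ^ (3 / 2 - ε)))
          (fun n k a =>
            (2 : ℝ) ^ ((n : ℝ) - (n : ℝ) ^ (c * ε)) * (A * ((n : ℝ) + k + a + 1) ^ A))) :=
  ⟨1 / 15, by norm_num, fun _ hε => ⟨exact_learning hε, pac_learning hε⟩⟩
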